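/- **Setting.** Let $Z$ be a positive random variable whose distribution function $G$ is continuous. Assume that there is $\hat x\in(0,\infty)$ with $G\in C^2([0,\hat x])$, and that $\lambda:=G'(0+)>0$. Let $(s_n)_{n}$ be a sequence of positive numbers with $s_n\log n\to\gamma\in[0,\infty)$. For each $n$, give the edges of the complete graph $K_n$ on $\{1,\dots,n\}$ i.i.d. weights $X_e$, each distributed as $Z^{s_n}$. The weight of a self-avoiding path is the sum of the weights of its edges. Let $W_n$ be the smallest weight of a self-avoiding path between the vertices $1$ and $2$, and let $H_n$ be the number of edges of the (almost surely unique) path attaining it. All limits are as $n\to\infty$. For $x>0$ and $k\in\mathbb N=\{1,2,\dots\}$ put $$g_\gamma(x)=x\,e^{-\gamma(1-1/x)},\qquad \gamma_k=k(k+1)\log\tfrac{k+1}{k},\qquad \Gamma=\{\gamma_k:k\in\mathbb N\},\qquad a_k=\frac{(2\pi)^{k/2}}{\sqrt{2\pi k}}.$$ If $\gamma\notin\Gamma$, let $k(\gamma)$ be the unique minimizer of $g_\gamma$ on $\mathbb N$. Let $\Lambda$ be a standard Gumbel random variable, i.e. $\mathbb P(\Lambda\le t)=e^{-e^{-t}}$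 for all $t\in\mathbb R$. **Theorem 1.4.** (a) If $\gamma\in[0,2\log2)$, then $\dfrac{W_n-1}{s_n}\to\log Z$ in distribution and $\mathbb P(H_n=1)\to1$. (b) If $\gamma=2\log2$, then $W_n\to1$ in probability and $\mathbb P(H_n\in\{1,2\})\to1$. (c) If $s_n\log n-\gamma=o((\log n)^{-1/2})$, $\gamma\notin\Gamma$ and $\gamma>2\log2$, then, with $k=k(\gamma)$ (which exists), $$\frac{k}{g_\gamma(k)s_n}\big[\lambda^{s_n}W_n-g_\gamma(k)\big]+\frac{k-1}{s_n}\Big(s_n\log n-\gamma-\frac{s_n\log s_n}{2}\Big)\to-\Lambda-\log a_k\quad\text{in distribution, and}\quad \mathbb P(H_n=k)\to1.$$ (d) If $s_n\log n-\gamma=o((\log n)^{-1/2})$ and $\gamma=\gamma_k$ for some integer $k\ge2$, then $W_n\to g_\gamma(k)$ in probability and $\mathbb P(H_n\in\{k,k+1\})\to1$. -/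

import Mathlib

open MeasureTheory ProbabilityTheory Filter Asymptotics
open scoped Topology

/-- The weight of a self-avoiding path in the complete graph on `V`:
the sum of the weights `w e` over the edges `e` of the path. -/
noncomputable def pathWeight {V : Type*} (w : Sym2 V → ℝ) {u v : V}
    (p : (⊤ : SimpleGraph V).Path u v) : ℝ :=
  ((p : (⊤ : SimpleGraph V).Walk u v).edges.map w).sum

/-- `p` minimizes the weight among all self-avoiding paths from `u` to `v`. -/
def IsOptimalPath {V : Type*} (w : Sym2 V → ℝ) {u v : V}
    (p : (⊤ : SimpleGraph V).Path u v) : Prop :=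
  ∀ q : (⊤ : SimpleGraph V).Path u v, pathWeight w p ≤ pathWeight w q

/-- The weight of an optimal path between `u` and `v` in the complete graph on `V`.
For finite `V` there are finitely many self-avoiding paths and at least one, so this infimum is
a minimum whenever `V` is finite. -/
noncomputable def optimalWeight {V : Type*} (w : Sym2 V → ℝ) (u v : V) : ℝ :=
  ⨅ p : (⊤ : SimpleGraph V).Path u v, pathWeight w p

open Classical in
/-- The number of edges of the optimal path between `u` and `v` when this path is unique;
by convention `0` when it is not (for distinct `u`, `v` no path has `0` edges). -/
noncomputable def optimalLength {V : Type*} (w : Sym2 V → ℝ) (u v : V) : ℕ :=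
  if h : ∃! p : (⊤ : SimpleGraph V).Path u v, IsOptimalPath w p then
    (h.exists.choose : (⊤ : SimpleGraph V).Walk u v).length
  else 0

/-- `W_n`: the weight of the optimal path between the vertices with labels `1` and `2` of the
complete graph `K_n`, that is, between the elements `0` and `1` of `Fin n`.
Meaningful for `2 ≤ n`; the value is `0` otherwise. -/
noncomputable def fppWeight (n : ℕ) (w : Sym2 (Fin n) → ℝ) : ℝ :=
  if h : 2 ≤ n then optimalWeight w ⟨0, by omega⟩ ⟨1, by omega⟩ else 0

/-- `H_n`: the hopcount, the number of edges of the optimal path between the vertices with labels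
`1` and `2` of `K_n`. Meaningful for `2 ≤ n`; the value is `0` otherwise. -/
noncomputable def fppHopcount (n : ℕ) (w : Sym2 (Fin n) → ℝ) : ℕ :=
  if h : 2 ≤ n then optimalLength w ⟨0, by omega⟩ ⟨1, by omega⟩ else 0

/-- `X` is a family of edge weights on `K_n` that are independent over the edges, each of them
distributed as the random variable `Y`. Nothing is required on the loops of `Sym2 (Fin n)`,
which belong to no path. -/
def IsIIDEdgeWeights {Ω Ω₀ : Type*} [MeasurableSpace Ω] [MeasurableSpace Ω₀] {n : ℕ}
    (X : Sym2 (Fin n) → Ω → ℝ) (P : Measure Ω) (Y : Ω₀ → ℝ) (P₀ : Measure Ω₀) : Prop :=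
  iIndepFun (fun e : (⊤ : SimpleGraph (Fin n)).edgeSet => X e) P ∧
    ∀ e ∈ (⊤ : SimpleGraph (Fin n)).edgeSet, IdentDistrib (X e) Y P P₀

/-- Convergence in probability, as `n → ∞`, of real random variables `Y n`, each defined on its own
probability space, to a constant. -/
def TendstoInProbConst {Ω : ℕ → Type*} [∀ n, MeasurableSpace (Ω n)]
    (Y : ∀ n, Ω n → ℝ) (P : ∀ n, Measure (Ω n)) (c : ℝ) : Prop :=
  ∀ ε : ℝ, 0 < ε → Tendsto (fun n => P n {ω | ε ≤ |Y n ω - c|}) atTop (𝓝 0)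

/-- `Λ` is a standard Gumbel random variable: `P(Λ ≤ t) = exp(-exp(-t))` for all real `t`. -/
def IsStandardGumbel {Ω : Type*} [MeasurableSpace Ω] (Λ : Ω → ℝ) (P : Measure Ω) : Prop :=
  AEMeasurable Λ P ∧ ∀ t : ℝ, P.real {ω | Λ ω ≤ t} = Real.exp (-Real.exp (-t))

/-- `g_γ(x) = x exp(-γ (1 - 1/x))`, used for `x > 0`. -/
noncomputable def gFun (γ x : ℝ) : ℝ := x * Real.exp (-γ * (1 - 1 / x))

/-- `γ_k = k (k+1) log ((k+1)/k)`, used for `k ≥ 1`. -/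
noncomputable def gammaSeq (k : ℕ) : ℝ :=
  (k : ℝ) * ((k : ℝ) + 1) * Real.log (((k : ℝ) + 1) / (k : ℝ))

/-- `Γ = {γ_k : k = 1, 2, 3, …}`. -/
def gammaSet : Set ℝ := {x | ∃ k : ℕ, 1 ≤ k ∧ x = gammaSeq k}

/-- `k` is the unique minimizer `k(γ)` of `g_γ` on the positive integers. -/
def IsUniqueMinimizer (γ : ℝ) (k : ℕ) : Prop :=
  1 ≤ k ∧ ∀ j : ℕ, 1 ≤ j → j ≠ k → gFun γ k < gFun γ j

/-- `a_k = (2π)^{k/2} / √(2πk)`. -/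
noncomputable def aConst (k : ℕ) : ℝ :=
  (2 * Real.pi) ^ ((k : ℝ) / 2) / Real.sqrt (2 * Real.pi * k)

/-! Write `s` for `s n`. Everything lives on the exponential scale `1 / s`. Because `s log n → γ`,
there are about `exp((k-1)γ/s)` paths with `k` edges, while an edge weight is below `y < 1` with
probability about `λ y^(1/s)`. A sum of `k` weights is made small most cheaply by taking all of them
equal to `c/k`, which costs `(c/k)^(k/s)` up to factors `exp(o(1/s))`. The expected number of
`k`-edge paths lighter than `c` is therefore `exp(((k-1)γ + k log(c/k))/s)` to leading order, and
this passes from negligible to huge at `c = gFun γ k`. So `W` should tend to the minimum of `gFun γ`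
and `H` should sit at the minimizers.

Lower bounds need only the first moment, but uniformly over all lengths. The arithmetic-geometric
mean inequality and Markov's inequality for the moment of order `-(1-s)/s`
(`measure_weighted_sum_le`, `lintegral_neg_rpow_le`) give a geometric series in the length, hence
`IsEdgeModel.eventually_exists_weightOf_le`.

Upper bounds come from two sources. For length one the law of the direct edge is explicit; it gives
the bound `1` and the limit `log Z`. For `k ≥ 2` with `gFun γ k < 1`, the tail of a `k`-fold sum is
sandwiched between Dirichlet integrals, and Stirling's formula gives the expected number of paths in
the critical window, `aConst k * exp t` in the limit (`tendsto_pow_mul_dirichletTail`). Stein's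
method with a local dependency neighbourhood then makes the probability of no such path tend to
`exp(-aConst k * exp t)`, which is the Gumbel law; pairs of paths that share edges do not contribute
because their exponential rate is negative (`overlap_rate_neg`).

The minimizers are read off from `log_gFun_succ`: the sign of the increment of `gFun γ` at `k` is
the sign of `gammaSeq k - γ`, and `gammaSeq` increases. -/

/-! ### Counting self-avoiding paths of the complete graph and their overlaps. -/

section PathCombinatorics

/-- A path between two given vertices is determined by its edges, even by an inclusion. -/
theorem SimpleGraph.Walk.IsPath.eq_of_edges_subset {V : Type*} {G : SimpleGraph V} {u v : V}
    {p q : G.Walk u v} (hp : p.IsPath) (hq : q.IsPath) (h : p.edges ⊆ q.edges) : p = q := by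
  induction p with
  | nil => exact (SimpleGraph.Walk.eq_nil_iff_nil.2 (SimpleGraph.Walk.isPath_iff_nil.1 hq)).symm
  | @cons u x v hux p' ih =>
    cases q with
    | nil =>
      rw [SimpleGraph.Walk.cons_isPath_iff] at hp
      exact absurd p'.end_mem_support hp.2
    | @cons _ x' _ hux' q' =>
      rw [SimpleGraph.Walk.cons_isPath_iff] at hp hq
      have h1 : s(u, x) ∈ (SimpleGraph.Walk.cons hux' q').edges := h (by simp)
      rw [SimpleGraph.Walk.edges_cons, List.mem_cons] at h1
      -- The vertex `u` is not revisited, so the only edge of the second path at `u` is its first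
      -- one.
      rcases h1 with h1 | h1
      · have hxx : x = x' := by
          rcases Sym2.eq_iff.1 h1 with h2 | h2
          · exact h2.2
          · exact absurd h2.2 hux.ne'
        subst hxx
        congr 1
        refine ih hp.1 hq.1 fun e he => ?_
        have h2 : e ∈ (SimpleGraph.Walk.cons hux' q').edges := h (by simp [he])
        rw [SimpleGraph.Walk.edges_cons, List.mem_cons] at h2
        rcases h2 with h2 | h2
        · subst h2
          exact absurd (SimpleGraph.Walk.fst_mem_support_of_mem_edges p' he) hp.2
        · exact h2
      · exact absurd (SimpleGraph.Walk.fst_mem_support_of_mem_edges q' h1) hq.2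

theorem one_le_length {V : Type*} {u v : V} (huv : u ≠ v) (p : (⊤ : SimpleGraph V).Path u v) :
    1 ≤ p.1.length := by
  by_contra h
  exact huv (SimpleGraph.Walk.eq_of_length_eq_zero (p := p.1) (by omega))

variable {V : Type*} [DecidableEq V] {u v : V}

/-- The edges of a path in the complete graph, as a finset of edges. -/
def pathEdges (p : (⊤ : SimpleGraph V).Path u v) : Finset (⊤ : SimpleGraph V).edgeSet :=
  p.1.edges.toFinset.subtype (· ∈ (⊤ : SimpleGraph V).edgeSet)

theorem mem_pathEdges {p : (⊤ : SimpleGraph V).Path u v} {e : (⊤ : SimpleGraph V).edgeSet} :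
    e ∈ pathEdges p ↔ e.1 ∈ p.1.edges := by
  simp [pathEdges]

theorem map_pathEdges (p : (⊤ : SimpleGraph V).Path u v) :
    (pathEdges p).map (Function.Embedding.subtype _) = p.1.edges.toFinset := by
  rw [pathEdges, Finset.subtype_map_of_mem]
  intro e he
  exact p.1.edges_subset_edgeSet (List.mem_toFinset.1 he)

theorem card_pathEdges (p : (⊤ : SimpleGraph V).Path u v) :
    (pathEdges p).card = p.1.length := by
  rw [← Finset.card_map (Function.Embedding.subtype _), map_pathEdges,
    List.toFinset_card_of_nodup p.2.isTrail.edges_nodup, SimpleGraph.Walk.length_edges]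

theorem pathWeight_eq_sum (w : Sym2 V → ℝ) (p : (⊤ : SimpleGraph V).Path u v) :
    pathWeight w p = ∑ e ∈ pathEdges p, w e := by
  have h := Finset.sum_map (pathEdges p) (Function.Embedding.subtype _) w
  rw [map_pathEdges, List.sum_toFinset w p.2.isTrail.edges_nodup] at h
  exact h

theorem eq_of_pathEdges_subset {p q : (⊤ : SimpleGraph V).Path u v}
    (h : pathEdges p ⊆ pathEdges q) : p = q := by
  refine Subtype.ext (p.2.eq_of_edges_subset q.2 fun e he => ?_)
  have he' := p.1.edges_subset_edgeSet he
  exact mem_pathEdges.1 (h (mem_pathEdges (e := ⟨e, he'⟩) |>.2 he))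

/-- Let `r` be the position in `q` of an edge missing from `p`. Send a shared edge before `r` to its
far endpoint and one after `r` to its near endpoint. These endpoints are interior and at distinct
positions, so `l` shared edges cost `l` interior vertices, not merely `l - 1`. -/
theorem card_interior_ge {k : ℕ} {p q : (⊤ : SimpleGraph V).Path u v}
    (hq : q.1.length = k) (hpq : ¬ pathEdges q ⊆ pathEdges p) :
    (pathEdges p ∩ pathEdges q).card ≤
      (Finset.univ.filter fun i : Fin (k - 1) => q.1.getVert (i + 1) ∈ p.1.support).card := by
  classical
  obtain ⟨e, heq, hep⟩ := Finset.not_subset.1 hpq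
  have hpos : ∀ e ∈ pathEdges q, ∃ t, t < k ∧
      s(q.1.getVert t, q.1.getVert (t + 1)) = (e : Sym2 V) := by
    intro e he
    have h := mem_pathEdges.1 he
    induction' h' : (e : Sym2 V) using Sym2.ind with a b
    rw [h', SimpleGraph.Walk.mk_mem_edges_iff_exists, hq] at h
    exact h
  choose! pos hpos1 hpos2 using hpos
  set r := pos e with hr
  have hne : ∀ e' ∈ pathEdges p ∩ pathEdges q, pos e' ≠ r := by
    intro e' he' h
    rw [Finset.mem_inter] at he'
    have h1 := hpos2 e' he'.2
    rw [h, hr, hpos2 e heq] at h1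
    exact hep (Subtype.ext h1 ▸ he'.1)
  have hinj : ∀ e₁ ∈ pathEdges q, ∀ e₂ ∈ pathEdges q, pos e₁ = pos e₂ → e₁ = e₂ := by
    intro e₁ h₁ e₂ h₂ h
    have h3 := hpos2 e₁ h₁
    rw [h, hpos2 e₂ h₂] at h3
    exact Subtype.ext h3.symm
  rcases Nat.eq_zero_or_pos (k - 1) with hk | hk
  · have : pathEdges p ∩ pathEdges q = ∅ := by
      refine Finset.eq_empty_of_forall_notMem fun e' he' => hne e' he' ?_
      have h1 := hpos1 e' (Finset.mem_inter.1 he').2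
      have h2 := hpos1 e heq
      omega
    simp [this]
  -- Index `i` stands for the vertex at position `i + 1`. The `min` only supplies the bound required
  -- by `Fin`; on shared edges it changes nothing.
  refine Finset.card_le_card_of_injOn (fun e' =>
    (⟨min (if pos e' < r then pos e' else pos e' - 1) (k - 2), by omega⟩ : Fin (k - 1))) ?_ ?_
  · intro e' he'
    have he'' := Finset.mem_inter.1 he'
    have h1 := hpos1 e' he''.2
    have h2 := hpos2 e' he''.2
    have h3 : (e' : Sym2 V) ∈ p.1.edges := mem_pathEdges.1 he''.1
    have h4 := hne e' he'
    have h5 := hpos1 e heq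
    rw [← h2] at h3
    simp only [Finset.coe_filter, Finset.mem_univ, true_and, Set.mem_ofPred_eq]
    split_ifs with h
    · have : min (pos e') (k - 2) + 1 = pos e' + 1 := by omega
      rw [this]
      exact SimpleGraph.Walk.snd_mem_support_of_mem_edges _ h3
    · have : min (pos e' - 1) (k - 2) + 1 = pos e' := by omega
      rw [this]
      exact SimpleGraph.Walk.fst_mem_support_of_mem_edges _ h3
  · intro e₁ h₁ e₂ h₂ h
    have hq₁ := (Finset.mem_inter.1 h₁).2
    have hq₂ := (Finset.mem_inter.1 h₂).2
    have a1 := hne e₁ h₁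
    have a2 := hne e₂ h₂
    have b1 := hpos1 e₁ hq₁
    have b2 := hpos1 e₂ hq₂
    have b3 := hpos1 e heq
    refine hinj e₁ hq₁ e₂ hq₂ ?_
    simp only [Fin.mk.injEq] at h
    split_ifs at h with c1 c2 c2 <;> omega

variable [Fintype V]

/-- The self-avoiding paths with `k` edges. -/
def pathsOfLength (u v : V) (k : ℕ) : Finset ((⊤ : SimpleGraph V).Path u v) :=
  Finset.univ.filter fun p => p.1.length = k

theorem mem_pathsOfLength {k : ℕ} {p : (⊤ : SimpleGraph V).Path u v} :
    p ∈ pathsOfLength u v k ↔ p.1.length = k := by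
  simp [pathsOfLength]

/-- Both endpoints being fixed, a path with `k` edges has `k - 1` free positions; this is the source
of the exponent in every count below. -/
theorem injOn_interior (k : ℕ) :
    Set.InjOn (fun (p : (⊤ : SimpleGraph V).Path u v) (i : Fin (k - 1)) => p.1.getVert (i + 1))
      (pathsOfLength u v k) := by
  intro p hp q hq h
  rw [Finset.mem_coe, mem_pathsOfLength] at hp hq
  refine Subtype.ext (SimpleGraph.Walk.ext_getVert_le_length (by rw [hp, hq]) fun r hr => ?_)
  rcases Nat.eq_zero_or_pos r with rfl | h0
  · simp
  · rcases Nat.lt_or_ge r k with h1 | h1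
    · have := congrFun h ⟨r - 1, by omega⟩
      simpa [Nat.sub_add_cancel h0] using this
    · rw [SimpleGraph.Walk.getVert_of_length_le _ (by omega),
        SimpleGraph.Walk.getVert_of_length_le _ (by omega)]

theorem card_pathsOfLength_le (k : ℕ) :
    (pathsOfLength u v k).card ≤ Fintype.card V ^ (k - 1) := by
  have h := Finset.card_le_card_of_injOn (t := (Finset.univ : Finset (Fin (k - 1) → V))) _
    (fun p _ => Finset.mem_univ _) (injOn_interior (u := u) (v := v) k)
  simpa using h

/-- Any injective sequence of `k - 1` vertices avoiding `u` and `v` is the interior of a path, and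
the falling factorial of `card V - 2` dominates the power. -/
theorem le_card_pathsOfLength (huv : u ≠ v) {k : ℕ} (hk : 1 ≤ k) (hkn : k ≤ Fintype.card V) :
    (Fintype.card V - k) ^ (k - 1) ≤ (pathsOfLength u v k).card := by
  classical
  let S := {x : V // x ≠ u ∧ x ≠ v}
  let L : (Fin (k - 1) ↪ S) → List V := fun f => u :: (List.ofFn fun i => (f i : V)) ++ [v]
  have hne : ∀ f, L f ≠ [] := fun f => by simp [L]
  have hnodup : ∀ f, (L f).Nodup := by
    intro f
    simp only [L, List.cons_append, List.nodup_cons, List.mem_append, List.mem_ofFn, List.mem_cons,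
      List.not_mem_nil, or_false, not_or, not_exists, List.nodup_append, List.nodup_nil,
      not_false_eq_true, and_true]
    refine ⟨⟨fun i => (f i).2.1, huv⟩, ?_, ?_⟩
    · exact List.nodup_ofFn.2 (Subtype.val_injective.comp f.injective)
    · refine ⟨trivial, ?_⟩
      rintro a ⟨i, rfl⟩ b hb
      exact hb ▸ (f i).2.2
  have hchain : ∀ f, (L f).IsChain (⊤ : SimpleGraph V).Adj := by
    intro f
    refine List.Pairwise.isChain ?_
    exact (hnodup f).imp fun h => h
  have hhead : ∀ f, (L f).head (hne f) = u := fun f => by simp [L]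
  have hlast : ∀ f, (L f).getLast (hne f) = v := fun f => by simp [L]
  let P : (Fin (k - 1) ↪ S) → (⊤ : SimpleGraph V).Path u v := fun f =>
    ⟨(SimpleGraph.Walk.ofSupport (L f) (hne f) (hchain f)).copy (hhead f) (hlast f), by
      rw [SimpleGraph.Walk.isPath_copy, SimpleGraph.Walk.isPath_def,
        SimpleGraph.Walk.support_ofSupport]
      exact hnodup f⟩
  have hsupp : ∀ f, (P f).1.support = L f := fun f => by
    simp only [P, SimpleGraph.Walk.support_copy, SimpleGraph.Walk.support_ofSupport]
  have hinj : Function.Injective P := by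
    intro f g hfg
    have h1 : L f = L g := by rw [← hsupp, ← hsupp, hfg]
    simp only [L, List.cons_append, List.cons.injEq, true_and, List.append_left_inj] at h1
    have h2 := List.ofFn_injective h1
    ext i
    exact congrFun h2 i
  have hlen : ∀ f, P f ∈ pathsOfLength u v k := by
    intro f
    rw [mem_pathsOfLength]
    have := (P f).1.length_support
    rw [hsupp] at this
    simp [L] at this
    omega
  have hcard := Finset.card_le_card_of_injOn (s := (Finset.univ : Finset (Fin (k - 1) ↪ S))) P
    (fun f _ => hlen f) hinj.injOn
  rw [Finset.card_univ, Fintype.card_embedding_eq, Fintype.card_fin] at hcard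
  have hS : Fintype.card S = Fintype.card V - 2 := by
    have : Fintype.card S = ((Finset.univ.erase u).erase v).card := by
      rw [Fintype.card_subtype]
      congr 1
      ext x
      simp [and_comm]
    rw [this, Finset.card_erase_of_mem (by simp [huv.symm]), Finset.card_erase_of_mem (by simp),
      Finset.card_univ]
    omega
  rw [hS] at hcard
  refine le_trans ?_ hcard
  refine le_trans (Nat.pow_le_pow_left ?_ _) (Nat.pow_sub_le_descFactorial _ _)
  have : 1 < Fintype.card V := Fintype.one_lt_card_iff.2 ⟨u, v, huv⟩
  omega

/-- The number of paths with `k` edges that share at least `l` edges with a given path, without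
being that path. -/
theorem card_overlap_le {k l : ℕ} {p : (⊤ : SimpleGraph V).Path u v} (hp : p.1.length = k) :
    ((pathsOfLength u v k).filter fun q =>
      l ≤ (pathEdges p ∩ pathEdges q).card ∧ q ≠ p).card ≤
      (k - 1).choose l * ((k + 1) ^ l * Fintype.card V ^ (k - 1 - l)) := by
  classical
  -- Choose `l` of the `k - 1` interior positions to lie on `p`, which has `k + 1` vertices; the
  -- other positions are unconstrained.
  have hsub := Finset.card_le_card_of_injOn
    (s := (pathsOfLength u v k).filter fun q => l ≤ (pathEdges p ∩ pathEdges q).card ∧ q ≠ p)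
    (t := (Finset.powersetCard l (Finset.univ : Finset (Fin (k - 1)))).biUnion fun Q =>
      Fintype.piFinset fun i => if i ∈ Q then p.1.support.toFinset else Finset.univ)
    (fun q i => q.1.getVert (i + 1)) ?_ ((injOn_interior k).mono ?_)
  · refine hsub.trans (Finset.card_biUnion_le.trans ?_)
    have hchoose : (k - 1).choose l =
        (Finset.powersetCard l (Finset.univ : Finset (Fin (k - 1)))).card := by
      rw [Finset.card_powersetCard, Finset.card_fin]
    rw [hchoose, ← smul_eq_mul, ← Finset.sum_const]
    refine Finset.sum_le_sum fun Q hQ => ?_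
    rw [Finset.mem_powersetCard] at hQ
    rw [Fintype.card_piFinset]
    have h1 : ∀ i : Fin (k - 1), (if i ∈ Q then p.1.support.toFinset else Finset.univ).card =
        if i ∈ Q then (k + 1) else Fintype.card V := by
      intro i
      split_ifs
      · rw [List.toFinset_card_of_nodup p.2.support_nodup, SimpleGraph.Walk.length_support, hp]
      · rw [Finset.card_univ]
    rw [Finset.prod_congr rfl fun i _ => h1 i, Finset.prod_ite, Finset.prod_const,
      Finset.prod_const]
    have h2 : (Finset.univ.filter fun i => i ∈ Q) = Q := by ext; simp
    have h3 : (Finset.univ.filter fun i => i ∉ Q) = Qᶜ := by ext; simp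
    rw [h2, h3, Finset.card_compl, hQ.2, Fintype.card_fin]
  · intro q hq
    rw [Finset.mem_coe, Finset.mem_filter, mem_pathsOfLength] at hq
    have h1 := card_interior_ge hq.1 (fun h => hq.2.2 (eq_of_pathEdges_subset h))
    obtain ⟨Q, hQ1, hQ2⟩ := Finset.exists_subset_card_eq (hq.2.1.trans h1)
    rw [Finset.mem_coe, Finset.mem_biUnion]
    refine ⟨Q, Finset.mem_powersetCard.2 ⟨Finset.subset_univ _, hQ2⟩, ?_⟩
    rw [Fintype.mem_piFinset]
    intro i
    split_ifs with hi
    · have := hQ1 hi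
      simpa using this
    · exact Finset.mem_univ _
  · intro q hq
    rw [Finset.mem_coe, Finset.mem_filter] at hq
    exact hq.1

end PathCombinatorics

/-! ### Poisson approximation by Stein's method under local dependence. -/

section PoissonApproximation

/-- The solution of the Stein equation of the Poisson distribution of mean `m` for the set `{0}`. -/
noncomputable def steinFun (m : ℝ) (j : ℕ) : ℝ := ∫ v in (0 : ℝ)..1, v ^ j * Real.exp (-(m * v))

/-- Integrate the derivative of `-(v ^ j * exp (-(m * v)))` over `[0, 1]`: the boundary term at `0`
survives only for `j = 0`. The index is shifted by one from the usual Stein equation, and the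
truncated `j - 1` is harmless because its coefficient vanishes at `j = 0`. -/
theorem steinFun_eq (m : ℝ) (j : ℕ) :
    m * steinFun m j - j * steinFun m (j - 1) = (if j = 0 then 1 else 0) - Real.exp (-m) := by
  have hderiv : ∀ v : ℝ, HasDerivAt (fun v : ℝ => -(v ^ j * Real.exp (-(m * v))))
      (m * (v ^ j * Real.exp (-(m * v))) - j * (v ^ (j - 1) * Real.exp (-(m * v)))) v := by
    intro v
    have h1 : HasDerivAt (fun v : ℝ => -(m * v)) (-(m * 1)) v :=
      ((hasDerivAt_id v).const_mul m).neg
    have h2 := ((hasDerivAt_pow j v).mul h1.exp).neg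
    refine h2.congr_deriv ?_
    ring
  have hint : ∀ i : ℕ, IntervalIntegrable (fun v : ℝ => v ^ i * Real.exp (-(m * v))) volume 0 1 :=
    fun i => Continuous.intervalIntegrable (by fun_prop) _ _
  have h := intervalIntegral.integral_eq_sub_of_hasDerivAt (a := 0) (b := 1)
    (fun v _ => hderiv v) (((hint j).const_mul m).sub ((hint (j - 1)).const_mul j))
  rw [intervalIntegral.integral_sub ((hint j).const_mul m) ((hint (j - 1)).const_mul j),
    intervalIntegral.integral_const_mul, intervalIntegral.integral_const_mul] at h
  rw [steinFun, steinFun, h]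
  rcases Nat.eq_zero_or_pos j with rfl | hj
  · simp; ring
  · simp [hj.ne']

theorem steinFun_nonneg (m : ℝ) (j : ℕ) : 0 ≤ steinFun m j :=
  intervalIntegral.integral_nonneg zero_le_one fun _ hv =>
    mul_nonneg (pow_nonneg hv.1 _) (Real.exp_pos _).le

theorem steinFun_le_one {m : ℝ} (hm : 0 ≤ m) (j : ℕ) : steinFun m j ≤ 1 := by
  have h : steinFun m j ≤ ∫ _ in (0 : ℝ)..1, (1 : ℝ) := by
    refine intervalIntegral.integral_mono_on zero_le_one
      (Continuous.intervalIntegrable (by fun_prop) _ _) (by simp) fun v hv => ?_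
    exact mul_le_one₀ (pow_le_one₀ hv.1 hv.2) (Real.exp_pos _).le
      (Real.exp_le_one_iff.2 (neg_nonpos.2 (mul_nonneg hm hv.1)))
  simpa using h

/-- All values lie in `[0, 1]`, so any nonzero shift costs at most `1 ≤ b`. This crude Lipschitz
bound is all that the approximation needs. -/
theorem abs_steinFun_sub_le {m : ℝ} (hm : 0 ≤ m) (a b : ℕ) :
    |steinFun m (a + b) - steinFun m a| ≤ b := by
  rcases Nat.eq_zero_or_pos b with rfl | hb
  · simp
  · have h1 := steinFun_nonneg m (a + b)
    have h2 := steinFun_nonneg m a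
    have h3 := steinFun_le_one hm (a + b)
    have h4 := steinFun_le_one hm a
    have h5 : (1 : ℝ) ≤ b := by exact_mod_cast hb
    rw [abs_le]
    constructor <;> linarith

variable {Ω ι : Type*} [MeasurableSpace Ω] [DecidableEq ι]

/-- **Poisson approximation** of the probability that none of the events `A i` occurs, when each
`A i` is independent of the number of those events that occur outside its neighbourhood `D i`. -/
theorem abs_measure_biInter_compl_sub_exp_le {μ : Measure Ω} [IsProbabilityMeasure μ]
    (s : Finset ι) (A : ι → Set Ω) (hA : ∀ i ∈ s, MeasurableSet (A i)) (D : ι → Finset ι)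
    (hDs : ∀ i ∈ s, D i ⊆ s) (hD : ∀ i ∈ s, i ∈ D i)
    (hind : ∀ i ∈ s, IndepFun ((A i).indicator (1 : Ω → ℝ))
      (fun ω => ∑ j ∈ s \ D i, (A j).indicator (1 : Ω → ℕ) ω) μ) :
    |μ.real (⋂ i ∈ s, (A i)ᶜ) - Real.exp (-∑ i ∈ s, μ.real (A i))| ≤
      ∑ i ∈ s, ∑ j ∈ D i, μ.real (A i) * μ.real (A j) +
        ∑ i ∈ s, ∑ j ∈ (D i).erase i, μ.real (A i ∩ A j) := by
  set m := ∑ i ∈ s, μ.real (A i) with hm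
  have hm0 : 0 ≤ m := Finset.sum_nonneg fun i _ => measureReal_nonneg
  set N : Ω → ℕ := fun ω => ∑ j ∈ s, (A j).indicator (1 : Ω → ℕ) ω with hN
  set N' : ι → Ω → ℕ := fun i ω => ∑ j ∈ s \ D i, (A j).indicator (1 : Ω → ℕ) ω with hN'
  set g := steinFun m with hg
  have hNm : Measurable N := by
    refine Finset.measurable_sum _ fun j hj => ?_
    exact (measurable_const (a := 1)).indicator (hA j hj)
  have hNm' : ∀ i, Measurable (N' i) := by
    intro i
    refine Finset.measurable_sum _ fun j hj => ?_
    exact (measurable_const (a := 1)).indicator (hA j (Finset.mem_sdiff.1 hj).1)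
  have hgm : Measurable g := measurable_of_countable g
  have hgb : ∀ j, ‖g j‖ ≤ 1 := fun j => by
    rw [Real.norm_eq_abs, abs_of_nonneg (steinFun_nonneg m j)]
    exact steinFun_le_one hm0 j
  have hgint : ∀ M : Ω → ℕ, Measurable M → Integrable (fun ω => g (M ω)) μ := fun M hM =>
    Integrable.of_bound (hgm.comp hM).aestronglyMeasurable 1 (Eventually.of_forall fun ω => hgb _)
  have hI : ∀ i ∈ s, ∀ f : Ω → ℝ, Integrable f μ →
      Integrable (fun ω => (A i).indicator (1 : Ω → ℝ) ω * f ω) μ := by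
    intro i hi f hf
    have : (fun ω => (A i).indicator (1 : Ω → ℝ) ω * f ω) = (A i).indicator f := by
      ext ω
      by_cases h : ω ∈ A i <;> simp [h]
    rw [this]
    exact hf.indicator (hA i hi)
  have hI1 : ∀ i ∈ s, Integrable ((A i).indicator (1 : Ω → ℝ)) μ := fun i hi =>
    (integrable_const (1 : ℝ)).indicator (hA i hi)
  have hIint : ∀ i ∈ s, ∫ ω, (A i).indicator (1 : Ω → ℝ) ω ∂μ = μ.real (A i) := fun i hi =>
    integral_indicator_one (hA i hi)
  have hcast : ∀ (i : ι) (ω : Ω), (((A i).indicator (1 : Ω → ℕ) ω : ℕ) : ℝ) =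
      (A i).indicator (1 : Ω → ℝ) ω := by
    intro i ω
    by_cases h : ω ∈ A i <;> simp [h]
  have hNcast : ∀ ω, (N ω : ℝ) = ∑ i ∈ s, (A i).indicator (1 : Ω → ℝ) ω := by
    intro ω
    rw [hN]
    push_cast
    exact Finset.sum_congr rfl fun i _ => hcast i ω
  -- the left-hand side through the Stein equation
  have hzero : ∀ ω, (⋂ i ∈ s, (A i)ᶜ).indicator (1 : Ω → ℝ) ω = if N ω = 0 then 1 else 0 := by
    intro ω
    have : ω ∈ (⋂ i ∈ s, (A i)ᶜ) ↔ N ω = 0 := by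
      simp [hN, Finset.sum_eq_zero_iff]
    by_cases h : N ω = 0
    · rw [Set.indicator_of_mem (this.2 h), if_pos h, Pi.one_apply]
    · rw [Set.indicator_of_notMem (fun h' => h (this.1 h')), if_neg h]
  have hmeas : MeasurableSet (⋂ i ∈ s, (A i)ᶜ) :=
    Finset.measurableSet_biInter _ fun i hi => (hA i hi).compl
  -- Evaluate the Stein equation at `N`, take expectations, and distribute both `m` and the factor
  -- `N` over the events.
  have hlhs : μ.real (⋂ i ∈ s, (A i)ᶜ) - Real.exp (-m) = ∑ i ∈ s,
      (μ.real (A i) * ∫ ω, g (N ω) ∂μ -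
        ∫ ω, (A i).indicator (1 : Ω → ℝ) ω * g (N ω - 1) ∂μ) := by
    have h1 : ∀ ω, (⋂ i ∈ s, (A i)ᶜ).indicator (1 : Ω → ℝ) ω - Real.exp (-m) =
        m * g (N ω) - ∑ i ∈ s, (A i).indicator (1 : Ω → ℝ) ω * g (N ω - 1) := by
      intro ω
      rw [hzero, ← Finset.sum_mul, ← hNcast, hg, steinFun_eq]
    have h2 : ∫ ω, ((⋂ i ∈ s, (A i)ᶜ).indicator (1 : Ω → ℝ) ω - Real.exp (-m)) ∂μ =
        μ.real (⋂ i ∈ s, (A i)ᶜ) - Real.exp (-m) := by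
      have hint : Integrable ((⋂ i ∈ s, (A i)ᶜ).indicator (1 : Ω → ℝ)) μ :=
        (integrable_const (1 : ℝ)).indicator hmeas
      rw [integral_sub hint (integrable_const _),
        integral_indicator_one hmeas]
      simp
    rw [← h2, integral_congr_ae (Eventually.of_forall h1), integral_sub
      ((hgint N hNm).const_mul m) (integrable_finsetSum _ fun i hi => hI i hi _
        (hgint _ (hNm.sub_const 1))), integral_finsetSum _ fun i hi => hI i hi _
        (hgint _ (hNm.sub_const 1)), integral_const_mul, Finset.sum_sub_distrib, ← Finset.sum_mul]
  rw [hlhs, ← Finset.sum_add_distrib]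
  refine (Finset.abs_sum_le_sum_abs _ _).trans (Finset.sum_le_sum fun i hi => ?_)
  have hsplit : ∀ ω, N ω = N' i ω + ∑ j ∈ D i, (A j).indicator (1 : Ω → ℕ) ω := fun ω =>
    (Finset.sum_sdiff (hDs i hi)).symm
  -- The comparison quantity: with the neighbourhood removed, the indicator and the count are
  -- independent. Both terms of the summand are compared with it.
  have hfac : ∫ ω, (A i).indicator (1 : Ω → ℝ) ω * g (N' i ω) ∂μ =
      μ.real (A i) * ∫ ω, g (N' i ω) ∂μ := by
    rw [← hIint i hi]
    exact (hind i hi).integral_fun_comp_mul_comp (f := fun x => x) (g := g)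
      ((measurable_const (a := (1 : ℝ))).indicator (hA i hi)).aemeasurable (hNm' i).aemeasurable
      measurable_id.aestronglyMeasurable hgm.aestronglyMeasurable
  have hfirst : |∫ ω, g (N ω) ∂μ - ∫ ω, g (N' i ω) ∂μ| ≤ ∑ j ∈ D i, μ.real (A j) := by
    rw [← integral_sub (hgint _ hNm) (hgint _ (hNm' i))]
    refine (abs_integral_le_integral_abs).trans ?_
    have : ∑ j ∈ D i, μ.real (A j) = ∫ ω, ∑ j ∈ D i, (A j).indicator (1 : Ω → ℝ) ω ∂μ := by
      rw [integral_finsetSum _ fun j hj => hI1 j (hDs i hi hj)]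
      exact Finset.sum_congr rfl fun j hj => (hIint j (hDs i hi hj)).symm
    rw [this]
    refine integral_mono ((hgint _ hNm).sub (hgint _ (hNm' i))).abs
      (integrable_finsetSum _ fun j hj => hI1 j (hDs i hi hj)) fun ω => ?_
    simp only [hsplit ω]
    refine (abs_steinFun_sub_le hm0 _ _).trans (le_of_eq ?_)
    push_cast
    exact Finset.sum_congr rfl fun j _ => hcast j ω
  have hsecond : |∫ ω, (A i).indicator (1 : Ω → ℝ) ω * g (N' i ω) ∂μ -
      ∫ ω, (A i).indicator (1 : Ω → ℝ) ω * g (N ω - 1) ∂μ| ≤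
      ∑ j ∈ (D i).erase i, μ.real (A i ∩ A j) := by
    have hint2 : ∀ j ∈ (D i).erase i, Integrable ((A i ∩ A j).indicator (1 : Ω → ℝ)) μ :=
      fun j hj => (integrable_const (1 : ℝ)).indicator
        ((hA i hi).inter (hA j (hDs i hi (Finset.mem_of_mem_erase hj))))
    rw [← integral_sub (hI i hi _ (hgint _ (hNm' i))) (hI i hi _ (hgint _ (hNm.sub_const 1)))]
    refine (abs_integral_le_integral_abs).trans ?_
    have : ∑ j ∈ (D i).erase i, μ.real (A i ∩ A j) =
        ∫ ω, ∑ j ∈ (D i).erase i, (A i ∩ A j).indicator (1 : Ω → ℝ) ω ∂μ := by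
      rw [integral_finsetSum _ hint2]
      refine Finset.sum_congr rfl fun j hj => (integral_indicator_one ?_).symm
      exact (hA i hi).inter (hA j (hDs i hi (Finset.mem_of_mem_erase hj)))
    rw [this]
    refine integral_mono ((hI i hi _ (hgint _ (hNm' i))).sub
      (hI i hi _ (hgint _ (hNm.sub_const 1)))).abs (integrable_finsetSum _ hint2) fun ω => ?_
    by_cases h : ω ∈ A i
    · have hN1 : N ω - 1 = N' i ω + ∑ j ∈ (D i).erase i, (A j).indicator (1 : Ω → ℕ) ω := by
        rw [hsplit ω, ← Finset.add_sum_erase _ _ (hD i hi), Set.indicator_of_mem h, Pi.one_apply]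
        omega
      simp only [Set.indicator_of_mem h, Pi.one_apply, one_mul, hN1]
      rw [abs_sub_comm]
      refine (abs_steinFun_sub_le hm0 _ _).trans (le_of_eq ?_)
      push_cast
      refine Finset.sum_congr rfl fun j _ => ?_
      by_cases h' : ω ∈ A j <;> simp [h, h']
    · simp only [Set.indicator_of_notMem h, zero_mul, sub_self, abs_zero]
      exact Finset.sum_nonneg fun j _ => Set.indicator_nonneg (fun _ _ => zero_le_one) _
  rw [hfac] at hsecond
  have h3 : |μ.real (A i) * ∫ ω, g (N ω) ∂μ - μ.real (A i) * ∫ ω, g (N' i ω) ∂μ| ≤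
      ∑ j ∈ D i, μ.real (A i) * μ.real (A j) := by
    rw [← mul_sub, abs_mul, abs_of_nonneg measureReal_nonneg, ← Finset.mul_sum]
    exact mul_le_mul_of_nonneg_left hfirst measureReal_nonneg
  exact (abs_sub_le _ _ _).trans (add_le_add h3 hsecond)

end PoissonApproximation

/-! ### Convergence in distribution from convergence of distribution functions. -/

section ConvergenceOfDistributionFunctions

theorem measureReal_map_Ioc {Ω : Type*} [MeasurableSpace Ω] {P : Measure Ω}
    [IsProbabilityMeasure P] {X : Ω → ℝ} (hX : AEMeasurable X P) {a b : ℝ} (hab : a ≤ b) :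
    (P.map X).real (Set.Ioc a b) = P.real {ω | X ω ≤ b} - P.real {ω | X ω ≤ a} := by
  have := Measure.isProbabilityMeasure_map hX
  have h1 : ∀ c, (P.map X).real (Set.Iic c) = P.real {ω | X ω ≤ c} := fun c =>
    map_measureReal_apply_of_aemeasurable hX measurableSet_Iic
  rw [← h1, ← h1, ← Set.Iic_sdiff_Iic, measureReal_sdiff (Set.Iic_subset_Iic.2 hab)
    measurableSet_Iic]

/-- Pointwise convergence of the distribution functions implies convergence in distribution. -/
theorem tendstoInDistribution_of_tendsto_cdf {Ω : ℕ → Type*} [∀ n, MeasurableSpace (Ω n)]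
    {Ω' : Type*} [MeasurableSpace Ω'] {P : ∀ n, Measure (Ω n)} [∀ n, IsProbabilityMeasure (P n)]
    {P' : Measure Ω'} [IsProbabilityMeasure P'] {X : ∀ n, Ω n → ℝ} {Z : Ω' → ℝ}
    (hX : ∀ n, AEMeasurable (X n) (P n)) (hZ : AEMeasurable Z P')
    (h : ∀ t : ℝ, Tendsto (fun n => (P n).real {ω | X n ω ≤ t}) atTop
      (𝓝 (P'.real {ω | Z ω ≤ t}))) :
    TendstoInDistribution X atTop Z P P' := by
  refine ⟨hX, hZ, ?_⟩
  -- Half-open intervals form a π-system containing small neighbourhoods of every point, and their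
  -- masses are differences of values of the distribution function.
  refine IsPiSystem.tendsto_probabilityMeasure_of_tendsto_of_mem
    (isPiSystem_Ioc (fun x : ℝ => x) (fun x : ℝ => x)) ?_ ?_ ?_
  · rintro s ⟨a, b, _, rfl⟩
    exact measurableSet_Ioc
  · intro u hu x hx
    obtain ⟨ε, hε, hball⟩ := Metric.isOpen_iff.1 hu x hx
    refine ⟨Set.Ioc (x - ε / 2) (x + ε / 2), ⟨_, _, by linarith, rfl⟩,
      Ioc_mem_nhds (by linarith) (by linarith), fun y hy => hball ?_⟩
    rw [Metric.mem_ball, Real.dist_eq, abs_lt]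
    constructor <;> linarith [hy.1, hy.2]
  · rintro s ⟨a, b, hab, rfl⟩
    rw [← NNReal.tendsto_coe]
    change Tendsto (fun n => ((P n).map (X n)).real (Set.Ioc a b)) atTop
      (𝓝 ((P'.map Z).real (Set.Ioc a b)))
    rw [measureReal_map_Ioc hZ hab.le,
      funext fun n => measureReal_map_Ioc (hX n) hab.le]
    exact (h b).sub (h a)

end ConvergenceOfDistributionFunctions

/-! ### Independent sums: absence of ties and a robust bound on the lower tail. -/

section IndependentSums

variable {Ω : Type*} [MeasurableSpace Ω] {μ : Measure Ω}

theorem IndepFun.measure_add_le [IsProbabilityMeasure μ] {A B : Ω → ℝ}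
    (hA : Measurable A) (hB : Measurable B)
    (h : IndepFun A B μ) (c : ℝ) :
    μ {ω | A ω + B ω ≤ c} = ∫⁻ ω, μ {ω' | A ω' ≤ c - B ω} ∂μ := by
  have hs : MeasurableSet {x : ℝ × ℝ | x.1 + x.2 ≤ c} :=
    measurableSet_le (measurable_fst.add measurable_snd) measurable_const
  have h1 : μ {ω | A ω + B ω ≤ c} =
      μ.map (fun ω => (A ω, B ω)) {x : ℝ × ℝ | x.1 + x.2 ≤ c} := by
    rw [Measure.map_apply (hA.prodMk hB) hs]
    rfl
  have := Measure.isProbabilityMeasure_map (μ := μ) hA.aemeasurable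
  have := Measure.isProbabilityMeasure_map (μ := μ) hB.aemeasurable
  rw [h1, h.map_prod_eq_prod_map_map hA.aemeasurable hB.aemeasurable,
    Measure.prod_apply_symm hs, lintegral_map (measurable_measure_prodMk_right hs) hB]
  refine lintegral_congr fun ω => ?_
  rw [Measure.map_apply hA (measurable_prodMk_right hs)]
  congr 1
  ext ω'
  simp [le_sub_iff_add_le]

theorem IndepFun.measure_eq_eq_zero [IsProbabilityMeasure μ] {A B : Ω → ℝ}
    (hA : Measurable A) (hB : Measurable B)
    (h : IndepFun A B μ) (hatom : ∀ x, μ {ω | A ω = x} = 0) : μ {ω | A ω = B ω} = 0 := by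
  have hs : MeasurableSet {x : ℝ × ℝ | x.1 = x.2} :=
    measurableSet_eq_fun measurable_fst measurable_snd
  have h1 : μ {ω | A ω = B ω} = μ.map (fun ω => (A ω, B ω)) {x : ℝ × ℝ | x.1 = x.2} := by
    rw [Measure.map_apply (hA.prodMk hB) hs]
    rfl
  have := Measure.isProbabilityMeasure_map (μ := μ) hA.aemeasurable
  have := Measure.isProbabilityMeasure_map (μ := μ) hB.aemeasurable
  rw [h1, h.map_prod_eq_prod_map_map hA.aemeasurable hB.aemeasurable,
    Measure.prod_apply_symm hs]
  refine lintegral_eq_zero_of_ae_eq_zero (Eventually.of_forall fun y => ?_)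
  change μ.map A ((fun x => (x, y)) ⁻¹' {x : ℝ × ℝ | x.1 = x.2}) = 0
  rw [Measure.map_apply hA (measurable_prodMk_right hs)]
  exact hatom y

variable {ι : Type*} {Y : ι → Ω → ℝ}

/-- Sums of independent atomless random variables over two distinct sets of indices almost surely
do not coincide. -/
theorem measure_sum_eq_sum_eq_zero [IsProbabilityMeasure μ] [DecidableEq ι]
    (hY : ∀ i, Measurable (Y i))
    (hind : iIndepFun Y μ)
    (hatom : ∀ i x, μ {ω | Y i ω = x} = 0) {S T : Finset ι} (hST : ¬ S ⊆ T) :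
    μ {ω | ∑ i ∈ S, Y i ω = ∑ i ∈ T, Y i ω} = 0 := by
  -- Solve the equation for `Y a`: the remaining terms are independent of it, and `Y a` has no atom.
  obtain ⟨a, haS, haT⟩ := Finset.not_subset.1 hST
  have hdisj : Disjoint ({a} : Finset ι) ((S ∪ T).erase a) := by simp
  have h := hind.indepFun_finset {a} ((S ∪ T).erase a) hdisj hY
  have hS : S.erase a ⊆ (S ∪ T).erase a := Finset.erase_subset_erase _ Finset.subset_union_left
  have hT : T ⊆ (S ∪ T).erase a := fun x hx => Finset.mem_erase.2
    ⟨fun hxa => haT (hxa ▸ hx), Finset.mem_union_right _ hx⟩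
  have hφ : Measurable fun f : ({a} : Finset ι) → ℝ => f ⟨a, Finset.mem_singleton_self a⟩ :=
    measurable_pi_apply _
  have hψ : Measurable fun f : ((S ∪ T).erase a : Finset ι) → ℝ =>
      ∑ i ∈ T.attach, f ⟨i, hT i.2⟩ - ∑ i ∈ (S.erase a).attach, f ⟨i, hS i.2⟩ := by
    refine (Finset.measurable_sum _ fun i _ => ?_).sub (Finset.measurable_sum _ fun i _ => ?_) <;>
      exact measurable_pi_apply _
  have h2 := h.comp hφ hψ
  have h3 := IndepFun.measure_eq_eq_zero (hY a)
    (B := fun ω => ∑ i ∈ T, Y i ω - ∑ i ∈ S.erase a, Y i ω) (by fun_prop) ?_ (hatom a)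
  · rw [← h3]
    congr 1
    ext ω
    simp only [Set.mem_ofPred_eq]
    rw [← Finset.add_sum_erase S (fun i => Y i ω) haS]
    exact ⟨fun h => by linarith, fun h => by linarith⟩
  · have h4 : (fun ω => ∑ i ∈ T, Y i ω - ∑ i ∈ S.erase a, Y i ω) =
        fun ω => ∑ i ∈ T.attach, Y i ω - ∑ i ∈ (S.erase a).attach, Y i ω := funext fun ω => by
      rw [Finset.sum_attach T (fun i => Y i ω), Finset.sum_attach (S.erase a) (fun i => Y i ω)]
    rw [h4]
    exact h2

/-- The exponent `(1 - s) / s` is just below the critical `1 / s`. By the layer-cake formula the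
levels below `1` contribute at most `1`. Beyond `1` the tail is at most `C * t ^ (-(1 / (1 - s)))`,
whose integral `C * (1 - s) / s` loses only a factor `1 / s`. -/
theorem lintegral_neg_rpow_le [IsProbabilityMeasure μ] {A : Ω → ℝ} (hA : Measurable A)
    (hpos : ∀ᵐ ω ∂μ, 0 < A ω)
    {C s : ℝ} (hC : 0 ≤ C) (hs : 0 < s) (hs1 : s < 1)
    (hle : ∀ y > 0, μ {ω | A ω ≤ y} ≤ ENNReal.ofReal (C * y ^ (1 / s))) :
    ∫⁻ ω, ENNReal.ofReal (A ω ^ (-((1 - s) / s))) ∂μ ≤ ENNReal.ofReal ((1 + C) / s) := by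
  have hnn : 0 ≤ᵐ[μ] fun ω => A ω ^ (-((1 - s) / s)) := by
    filter_upwards [hpos] with ω hω
    exact Real.rpow_nonneg hω.le _
  have ha : 0 < (1 - s) / s := div_pos (by linarith) hs
  rw [lintegral_eq_lintegral_meas_le μ hnn (hA.pow_const _).aemeasurable,
    ← Set.Ioc_union_Ioi_eq_Ioi zero_le_one, lintegral_union measurableSet_Ioi
      (Set.disjoint_left.2 fun x hx hx' => not_lt.2 hx.2 hx')]
  have h1 : ∫⁻ t in Set.Ioc (0 : ℝ) 1, μ {ω | t ≤ A ω ^ (-((1 - s) / s))} ≤ 1 := by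
    refine (lintegral_mono fun t => prob_le_one).trans ?_
    simp
  have hexp : -(1 / (1 - s)) < -1 := by
    rw [neg_lt_neg_iff, lt_div_iff₀ (by linarith)]
    linarith
  have h2 : ∫⁻ t in Set.Ioi (1 : ℝ), μ {ω | t ≤ A ω ^ (-((1 - s) / s))} ≤
      ∫⁻ t in Set.Ioi (1 : ℝ), ENNReal.ofReal (C * t ^ (-(1 / (1 - s)))) := by
    refine setLIntegral_mono' measurableSet_Ioi fun t ht => ?_
    have ht0 : (0 : ℝ) < t := zero_lt_one.trans ht
    refine le_trans ?_ ((hle (t ^ (-(s / (1 - s)))) (Real.rpow_pos_of_pos ht0 _)).trans ?_)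
    · refine measure_mono_ae ?_
      filter_upwards [hpos] with ω hω h
      change A ω ≤ t ^ (-(s / (1 - s)))
      have h3 := Real.rpow_le_rpow_of_nonpos ht0 h
        (neg_nonpos.2 (div_pos hs (by linarith : (0 : ℝ) < 1 - s)).le)
      rw [← Real.rpow_mul hω.le] at h3
      have h4 : -((1 - s) / s) * -(s / (1 - s)) = 1 := by
        have : 1 - s ≠ 0 := by linarith
        field_simp
      rwa [h4, Real.rpow_one] at h3
    · rw [← Real.rpow_mul ht0.le]
      apply le_of_eq
      congr 3
      have : 1 - s ≠ 0 := by linarith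
      field_simp
  have h3 : ∫⁻ t in Set.Ioi (1 : ℝ), ENNReal.ofReal (C * t ^ (-(1 / (1 - s)))) =
      ENNReal.ofReal (C * ((1 - s) / s)) := by
    rw [← ofReal_integral_eq_lintegral_ofReal
      ((integrableOn_Ioi_rpow_of_lt hexp zero_lt_one).const_mul C), integral_const_mul,
      integral_Ioi_rpow_of_lt hexp zero_lt_one, Real.one_rpow]
    · congr 2
      have : 1 - s ≠ 0 := by linarith
      have h5 : -(1 / (1 - s)) + 1 = -(s / (1 - s)) := by field_simp; ring
      rw [h5]
      field_simp
    · filter_upwards [ae_restrict_mem measurableSet_Ioi] with t ht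
      exact mul_nonneg hC (Real.rpow_nonneg (zero_le_one.trans (le_of_lt ht)) _)
  refine (add_le_add h1 (h2.trans h3.le)).trans ?_
  rw [← ENNReal.ofReal_one, ← ENNReal.ofReal_add zero_le_one
    (mul_nonneg hC (div_pos (by linarith) hs).le)]
  refine ENNReal.ofReal_le_ofReal ?_
  rw [← mul_div_assoc, ← sub_nonneg]
  have : (1 + C) / s - (1 + C * (1 - s) / s) = (1 - s) / s + C := by field_simp; ring
  rw [this]
  positivity

theorem prod_le_pow_of_sum_le {S : Finset ι} (hS : S.Nonempty) {z : ι → ℝ}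
    (hz : ∀ i ∈ S, 0 ≤ z i) {c : ℝ} (h : ∑ i ∈ S, z i ≤ c) :
    ∏ i ∈ S, z i ≤ (c / S.card) ^ S.card := by
  have hm : (0 : ℝ) < S.card := by exact_mod_cast hS.card_pos
  have h1 := Real.geom_mean_le_arith_mean S (fun _ => 1) z (fun _ _ => zero_le_one)
    (by simpa using hm) hz
  simp only [Real.rpow_one, Finset.sum_const, nsmul_eq_mul, mul_one, one_mul] at h1
  have h2 : (∏ i ∈ S, z i) ^ ((S.card : ℝ)⁻¹) ≤ c / S.card :=
    h1.trans (div_le_div_of_nonneg_right h hm.le)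
  have h0 : 0 ≤ ∏ i ∈ S, z i := Finset.prod_nonneg hz
  have h3 := pow_le_pow_left₀ (Real.rpow_nonneg h0 _) h2 S.card
  rwa [Real.rpow_inv_natCast_pow h0 hS.card_ne_zero] at h3

/-- Bound for the lower tail of a weighted sum of independent positive random variables, from the
arithmetic-geometric mean inequality and Markov's inequality. -/
theorem measure_weighted_sum_le (hY : ∀ i, Measurable (Y i)) (hind : iIndepFun Y μ)
    (hpos : ∀ i, ∀ᵐ ω ∂μ, 0 < Y i ω) {a M : ℝ} (ha : 0 < a) (hM : 0 ≤ M)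
    (hmom : ∀ i, ∫⁻ ω, ENNReal.ofReal (Y i ω ^ (-a)) ∂μ ≤ ENNReal.ofReal M)
    {S : Finset ι} (hS : S.Nonempty) {w : ι → ℝ} (hw : ∀ i ∈ S, 0 < w i) {c : ℝ} (hc : 0 < c) :
    μ {ω | ∑ i ∈ S, w i * Y i ω ≤ c} ≤
      ENNReal.ofReal (((c / S.card) ^ S.card / ∏ i ∈ S, w i) ^ a * M ^ S.card) := by
  set q := (c / S.card) ^ S.card / ∏ i ∈ S, w i with hq
  have hm : (0 : ℝ) < S.card := by exact_mod_cast hS.card_pos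
  have hwp : 0 < ∏ i ∈ S, w i := Finset.prod_pos hw
  have hq0 : 0 < q := div_pos (pow_pos (div_pos hc hm) _) hwp
  have hposS : ∀ᵐ ω ∂μ, ∀ i ∈ S, 0 < Y i ω :=
    (Finset.eventually_all S).2 fun i _ => hpos i
  -- A small weighted sum forces a small product, `∏ Y i ≤ q`; the negative power turns this into a
  -- large product of independent factors, ready for Markov's inequality.
  have hsub : μ {ω | ∑ i ∈ S, w i * Y i ω ≤ c} ≤
      μ {ω | ENNReal.ofReal (q ^ (-a)) ≤ ∏ i ∈ S, ENNReal.ofReal (Y i ω ^ (-a))} := by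
    refine measure_mono_ae ?_
    filter_upwards [hposS] with ω hω h
    change ENNReal.ofReal (q ^ (-a)) ≤ ∏ i ∈ S, ENNReal.ofReal (Y i ω ^ (-a))
    rw [← ENNReal.ofReal_prod_of_nonneg fun i hi => Real.rpow_nonneg (hω i hi).le _,
      Real.finsetProd_rpow S _ fun i hi => (hω i hi).le]
    refine ENNReal.ofReal_le_ofReal (Real.rpow_le_rpow_of_nonpos (Finset.prod_pos hω) ?_
      (neg_nonpos.2 ha.le))
    rw [hq, le_div_iff₀ hwp, mul_comm, ← Finset.prod_mul_distrib]
    exact prod_le_pow_of_sum_le hS (fun i hi => (mul_pos (hw i hi) (hω i hi)).le) h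
  have hfm : ∀ i, Measurable fun ω => ENNReal.ofReal (Y i ω ^ (-a)) := fun i =>
    ((hY i).pow_const _).ennreal_ofReal
  have hprod : ∫⁻ ω, ∏ i ∈ S, ENNReal.ofReal (Y i ω ^ (-a)) ∂μ ≤ ENNReal.ofReal (M ^ S.card) := by
    have hind' : iIndepFun (fun i ω => ENNReal.ofReal (Y i ω ^ (-a))) μ :=
      hind.comp (fun _ y => ENNReal.ofReal (y ^ (-a)))
        fun _ => (measurable_id.pow_const _).ennreal_ofReal
    rw [lintegral_prod_eq_prod_lintegral_of_indepFun S _ hind' hfm, ENNReal.ofReal_pow hM,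
      ← Finset.prod_const]
    exact Finset.prod_le_prod' fun i _ => hmom i
  have hqa : 0 < q ^ (-a) := Real.rpow_pos_of_pos hq0 _
  refine hsub.trans ((meas_ge_le_lintegral_div
    (Finset.measurable_prod _ fun i _ => hfm i).aemeasurable
    (ENNReal.ofReal_pos.2 hqa).ne' ENNReal.ofReal_ne_top).trans ?_)
  refine (ENNReal.div_le_div_right hprod _).trans (le_of_eq ?_)
  rw [← ENNReal.ofReal_div_of_pos hqa, Real.rpow_neg hq0.le, div_inv_eq_mul, mul_comm]

end IndependentSums

/-! ### Sharp lower tails of sums, through beta integrals. -/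

section DirichletSums

/-- The substitution `t = c * x` reduces this to the normalization of the beta density. -/
theorem lintegral_sub_rpow_mul_rpow {p q c : ℝ} (hp : 0 < p) (hq : 0 < q) (hc : 0 < c) :
    ∫⁻ t in Set.Ioo 0 c, ENNReal.ofReal ((c - t) ^ p * t ^ (q - 1)) =
      ENNReal.ofReal (c ^ (p + q) * beta q (p + 1)) := by
  have himage : (fun x : ℝ => c * x) '' Set.Ioo 0 1 = Set.Ioo 0 c := by
    rw [Set.image_mul_left_Ioo hc, mul_zero, mul_one]
  have hbeta : 0 < beta q (p + 1) := beta_pos hq (by linarith)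
  have hderiv : ∀ x ∈ Set.Ioo (0 : ℝ) 1,
      HasDerivWithinAt (fun x : ℝ => c * x) c (Set.Ioo 0 1) x := fun x _ =>
    (((hasDerivAt_id x).const_mul c).congr_deriv (mul_one c)).hasDerivWithinAt
  rw [← himage, lintegral_image_eq_lintegral_abs_deriv_mul measurableSet_Ioo hderiv
    (mul_right_injective₀ hc.ne').injOn]
  have h1 := lintegral_betaPDF_eq_one hq (show 0 < p + 1 by linarith)
  rw [lintegral_betaPDF] at h1
  have h2 : ∀ x ∈ Set.Ioo (0 : ℝ) 1,
      ENNReal.ofReal |c| * ENNReal.ofReal ((c - c * x) ^ p * (c * x) ^ (q - 1)) =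
        ENNReal.ofReal (c ^ (p + q) * beta q (p + 1)) *
        ENNReal.ofReal (1 / beta q (p + 1) * x ^ (q - 1) * (1 - x) ^ (p + 1 - 1)) := by
    intro x hx
    rw [← ENNReal.ofReal_mul (abs_nonneg _), ← ENNReal.ofReal_mul (by positivity)]
    congr 1
    have h3 : c - c * x = c * (1 - x) := by ring
    have h4 : c ^ (p + q) = c * c ^ p * c ^ (q - 1) := by
      rw [← Real.rpow_one_add' hc.le (by linarith), ← Real.rpow_add hc]
      ring_nf
    rw [abs_of_pos hc, h3, Real.mul_rpow hc.le (by linarith [hx.2]), Real.mul_rpow hc.le hx.1.le,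
      h4, add_sub_cancel_right]
    field_simp
  rw [setLIntegral_congr_fun measurableSet_Ioo h2, lintegral_const_mul' _ _ ENNReal.ofReal_ne_top,
    h1, mul_one]

variable {Ω : Type*} [MeasurableSpace Ω] {μ : Measure Ω}

/-- Layer-cake formula; levels `t ≥ c` vanish because `A` is positive. It expresses a convolution
step through the distribution function of `A` alone, so no density is needed. -/
theorem lintegral_max_sub_rpow {A : Ω → ℝ} (hA : Measurable A) (hpos : ∀ᵐ ω ∂μ, 0 < A ω)
    {q c : ℝ} (hq : 0 < q) :
    ∫⁻ ω, ENNReal.ofReal (max (c - A ω) 0 ^ q) ∂μ =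
      ENNReal.ofReal q *
        ∫⁻ t in Set.Ioo 0 c, μ {ω | A ω ≤ c - t} * ENNReal.ofReal (t ^ (q - 1)) := by
  have hm : Measurable fun ω => max (c - A ω) 0 := by fun_prop
  have hnn : 0 ≤ᵐ[μ] fun ω => max (c - A ω) 0 := ae_of_all _ fun ω => le_max_right _ _
  rw [lintegral_rpow_eq_lintegral_meas_le_mul μ hnn hm.aemeasurable hq]
  congr 1
  have h1 : ∀ t ∈ Set.Ioi (0 : ℝ),
      μ {ω | t ≤ max (c - A ω) 0} * ENNReal.ofReal (t ^ (q - 1)) =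
        (Set.Ioo 0 c).indicator
          (fun t => μ {ω | A ω ≤ c - t} * ENNReal.ofReal (t ^ (q - 1))) t := by
    intro t ht
    have h2 : {ω | t ≤ max (c - A ω) 0} = {ω | A ω ≤ c - t} := by
      ext ω
      rw [Set.mem_ofPred_eq, Set.mem_ofPred_eq, le_max_iff]
      constructor
      · rintro (h | h)
        · linarith
        · exact absurd h (not_le.2 ht)
      · intro h
        exact Or.inl (by linarith)
    rw [h2]
    by_cases htc : t < c
    · rw [Set.indicator_of_mem (show t ∈ Set.Ioo 0 c from ⟨ht, htc⟩)]
    · rw [Set.indicator_of_notMem fun h => htc h.2]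
      have : μ {ω | A ω ≤ c - t} = 0 := by
        refine measure_mono_null (fun ω hω => ?_) hpos
        have h3 : A ω ≤ c - t := hω
        change ¬ 0 < A ω
        linarith [not_lt.1 htc]
      rw [this, zero_mul]
  rw [setLIntegral_congr_fun measurableSet_Ioi h1, setLIntegral_indicator measurableSet_Ioo]
  congr 2
  ext t
  simp only [Set.mem_inter_iff, Set.mem_Ioo, Set.mem_Ioi]
  tauto

/-- The volume-type factor of the lower tail of a sum of `k` independent variables whose
distribution function is `y ^ p` near zero. -/
noncomputable def dirichletTail (p : ℝ) (k : ℕ) (c : ℝ) : ℝ :=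
  c ^ ((k : ℝ) * p) * (Real.Gamma (p + 1) ^ k / Real.Gamma ((k : ℝ) * p + 1))

theorem dirichletTail_nonneg {p : ℝ} (hp : 0 < p) (k : ℕ) {c : ℝ} (hc : 0 ≤ c) :
    0 ≤ dirichletTail p k c := by
  have h1 : 0 < Real.Gamma (p + 1) := Real.Gamma_pos_of_pos (by linarith)
  have h2 : 0 < Real.Gamma ((k : ℝ) * p + 1) := Real.Gamma_pos_of_pos (by positivity)
  unfold dirichletTail
  positivity

theorem dirichletTail_one {p : ℝ} (hp : 0 < p) (c : ℝ) : dirichletTail p 1 c = c ^ p := by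
  have h1 : 0 < Real.Gamma (p + 1) := Real.Gamma_pos_of_pos (by linarith)
  simp [dirichletTail, h1.ne']

/-- The recursion in the number of summands: the beta integral contributes `Γ(kp) Γ(p+1) /
Γ((k+1)p+1)`, and `Γ(kp+1) = kp Γ(kp)` cancels the old denominator. -/
theorem lintegral_dirichletTail_step {p b : ℝ} (hp : 0 < p) (hb : 0 ≤ b) {k : ℕ} (hk : 1 ≤ k)
    {c : ℝ} (hc : 0 < c) :
    ENNReal.ofReal (b ^ k * (Real.Gamma (p + 1) ^ k / Real.Gamma ((k : ℝ) * p + 1))) *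
      (ENNReal.ofReal (k * p) * (ENNReal.ofReal b *
        ∫⁻ t in Set.Ioo 0 c, ENNReal.ofReal ((c - t) ^ p * t ^ (k * p - 1)))) =
      ENNReal.ofReal (b ^ (k + 1) * dirichletTail p (k + 1) c) := by
  have hk0 : (0 : ℝ) < k := by exact_mod_cast hk
  have hkp : 0 < (k : ℝ) * p := mul_pos hk0 hp
  have h1 : 0 < Real.Gamma (p + 1) := Real.Gamma_pos_of_pos (by linarith)
  have h2 : 0 < Real.Gamma ((k : ℝ) * p) := Real.Gamma_pos_of_pos hkp
  have h3 : Real.Gamma ((k : ℝ) * p + 1) = k * p * Real.Gamma ((k : ℝ) * p) :=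
    Real.Gamma_add_one hkp.ne'
  have h4 : (k : ℝ) * p + (p + 1) = ((k + 1 : ℕ) : ℝ) * p + 1 := by push_cast; ring
  have h5 : p + (k : ℝ) * p = ((k + 1 : ℕ) : ℝ) * p := by push_cast; ring
  have h6 : 0 < Real.Gamma (((k + 1 : ℕ) : ℝ) * p + 1) := Real.Gamma_pos_of_pos (by positivity)
  have h7 : 0 < Real.Gamma ((k : ℝ) * p + 1) := Real.Gamma_pos_of_pos (by positivity)
  rw [lintegral_sub_rpow_mul_rpow hp hkp hc, ← ENNReal.ofReal_mul hb, ← ENNReal.ofReal_mul hkp.le,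
    ← ENNReal.ofReal_mul (by positivity)]
  congr 1
  unfold dirichletTail beta
  rw [h3, h4, h5, pow_succ, pow_succ]
  field_simp

variable {ι : Type*} {Y : ι → Ω → ℝ} [IsProbabilityMeasure μ]

theorem measure_sum_cons (hY : ∀ i, Measurable (Y i)) (hind : iIndepFun Y μ) {S : Finset ι} {a : ι}
    (ha : a ∉ S) (c : ℝ) :
    μ {ω | ∑ i ∈ Finset.cons a S ha, Y i ω ≤ c} =
      ∫⁻ ω, μ {ω' | ∑ i ∈ S, Y i ω' ≤ c - Y a ω} ∂μ := by
  have h1 : IndepFun (fun ω => ∑ i ∈ S, Y i ω) (Y a) μ := by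
    have := hind.indepFun_finsetSum_of_notMem hY ha
    rwa [show (∑ j ∈ S, Y j) = fun ω => ∑ i ∈ S, Y i ω from
      funext fun ω => Finset.sum_apply ω S Y] at this
  rw [← IndepFun.measure_add_le (by fun_prop) (hY a) h1]
  congr 1
  ext ω
  rw [Set.mem_ofPred_eq, Set.mem_ofPred_eq, Finset.sum_cons, add_comm]

/-- Induction on the number of summands: conditioning on the new one leaves a multiple of `(c - Y
a)₊ ^ (k * p)`. As all variables are positive, only levels below `c ≤ c₀` matter, and there the
hypothesis on one variable applies. -/
theorem measure_sum_le_dirichletTail (hY : ∀ i, Measurable (Y i)) (hind : iIndepFun Y μ)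
    (hpos : ∀ i, ∀ᵐ ω ∂μ, 0 < Y i ω) {p b c₀ : ℝ} (hp : 0 < p) (hb : 0 ≤ b)
    (hle : ∀ i, ∀ y, 0 < y → y ≤ c₀ → μ {ω | Y i ω ≤ y} ≤ ENNReal.ofReal (b * y ^ p))
    {S : Finset ι} (hS : S.Nonempty) {c : ℝ} (hc : 0 < c) (hcc : c ≤ c₀) :
    μ {ω | ∑ i ∈ S, Y i ω ≤ c} ≤ ENNReal.ofReal (b ^ S.card * dirichletTail p S.card c) := by
  induction hS using Finset.Nonempty.cons_induction generalizing c with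
  | singleton a => simpa [dirichletTail_one hp] using hle a c hc hcc
  | cons a S ha hS ih =>
    have hk : 1 ≤ S.card := hS.card_pos
    have hk0 : (0 : ℝ) < S.card := by exact_mod_cast hk
    have hkp : 0 < (S.card : ℝ) * p := mul_pos hk0 hp
    set K := Real.Gamma (p + 1) ^ S.card / Real.Gamma ((S.card : ℝ) * p + 1) with hK
    have hK0 : 0 ≤ K := div_nonneg (pow_nonneg (Real.Gamma_pos_of_pos (by linarith)).le _)
      (Real.Gamma_pos_of_pos (by linarith)).le
    have hposS : ∀ᵐ ω ∂μ, 0 < ∑ i ∈ S, Y i ω := by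
      filter_upwards [(Finset.eventually_all S).2 fun i _ => hpos i] with ω hω
      exact Finset.sum_pos hω hS
    rw [measure_sum_cons hY hind ha]
    have h1 : ∀ᵐ ω ∂μ, μ {ω' | ∑ i ∈ S, Y i ω' ≤ c - Y a ω} ≤
        ENNReal.ofReal (b ^ S.card * K) *
          ENNReal.ofReal (max (c - Y a ω) 0 ^ ((S.card : ℝ) * p)) := by
      filter_upwards [hpos a] with ω hω
      rcases le_or_gt (c - Y a ω) 0 with h | h
      · have : μ {ω' | ∑ i ∈ S, Y i ω' ≤ c - Y a ω} = 0 := by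
          refine measure_mono_null (fun ω' hω' => ?_) hposS
          have h3 : ∑ i ∈ S, Y i ω' ≤ c - Y a ω := hω'
          change ¬ 0 < ∑ i ∈ S, Y i ω'
          linarith
        rw [this]
        exact bot_le
      · refine (ih h (by linarith)).trans (le_of_eq ?_)
        rw [← ENNReal.ofReal_mul (by positivity), max_eq_left h.le, dirichletTail]
        congr 1
        ring
    refine (lintegral_mono_ae h1).trans ?_
    rw [lintegral_const_mul' _ _ ENNReal.ofReal_ne_top, lintegral_max_sub_rpow (hY a) (hpos a) hkp,
      Finset.card_cons, ← lintegral_dirichletTail_step hp hb hk hc, ← hK]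
    refine mul_le_mul_right (mul_le_mul_right ?_ _) _
    rw [← lintegral_const_mul' _ _ ENNReal.ofReal_ne_top]
    refine setLIntegral_mono' measurableSet_Ioo fun t ht => ?_
    have htc : 0 < c - t := by linarith [ht.2]
    refine (mul_le_mul_left (hle a _ htc (by linarith [ht.1])) _).trans (le_of_eq ?_)
    rw [← ENNReal.ofReal_mul (by positivity), ← ENNReal.ofReal_mul hb, mul_assoc]

/-- The same convolution induction with the inequalities reversed; where `c - Y a ≤ 0` the lower
bound is zero and nothing is to be shown. -/
theorem dirichletTail_le_measure_sum (hY : ∀ i, Measurable (Y i)) (hind : iIndepFun Y μ)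
    (hpos : ∀ i, ∀ᵐ ω ∂μ, 0 < Y i ω) {p b c₀ : ℝ} (hp : 0 < p) (hb : 0 ≤ b)
    (hle : ∀ i, ∀ y, 0 < y → y ≤ c₀ → ENNReal.ofReal (b * y ^ p) ≤ μ {ω | Y i ω ≤ y})
    {S : Finset ι} (hS : S.Nonempty) {c : ℝ} (hc : 0 < c) (hcc : c ≤ c₀) :
    ENNReal.ofReal (b ^ S.card * dirichletTail p S.card c) ≤ μ {ω | ∑ i ∈ S, Y i ω ≤ c} := by
  induction hS using Finset.Nonempty.cons_induction generalizing c with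
  | singleton a => simpa [dirichletTail_one hp] using hle a c hc hcc
  | cons a S ha hS ih =>
    have hk : 1 ≤ S.card := hS.card_pos
    have hk0 : (0 : ℝ) < S.card := by exact_mod_cast hk
    have hkp : 0 < (S.card : ℝ) * p := mul_pos hk0 hp
    set K := Real.Gamma (p + 1) ^ S.card / Real.Gamma ((S.card : ℝ) * p + 1) with hK
    have hK0 : 0 ≤ K := div_nonneg (pow_nonneg (Real.Gamma_pos_of_pos (by linarith)).le _)
      (Real.Gamma_pos_of_pos (by linarith)).le
    rw [measure_sum_cons hY hind ha]
    have h1 : ∀ᵐ ω ∂μ, ENNReal.ofReal (b ^ S.card * K) *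
          ENNReal.ofReal (max (c - Y a ω) 0 ^ ((S.card : ℝ) * p)) ≤
          μ {ω' | ∑ i ∈ S, Y i ω' ≤ c - Y a ω} := by
      filter_upwards [hpos a] with ω hω
      rcases le_or_gt (c - Y a ω) 0 with h | h
      · rw [max_eq_right h, Real.zero_rpow hkp.ne']
        simp
      · refine le_trans (le_of_eq ?_) (ih h (by linarith))
        rw [← ENNReal.ofReal_mul (by positivity), max_eq_left h.le, dirichletTail]
        congr 1
        ring
    refine le_trans ?_ (lintegral_mono_ae h1)
    rw [lintegral_const_mul' _ _ ENNReal.ofReal_ne_top, lintegral_max_sub_rpow (hY a) (hpos a) hkp,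
      Finset.card_cons, ← lintegral_dirichletTail_step hp hb hk hc, ← hK]
    refine mul_le_mul_right (mul_le_mul_right ?_ _) _
    rw [← lintegral_const_mul' _ _ ENNReal.ofReal_ne_top]
    refine setLIntegral_mono' measurableSet_Ioo fun t ht => ?_
    have htc : 0 < c - t := by linarith [ht.2]
    refine le_trans (le_of_eq ?_) (mul_le_mul_left (hle a _ htc (by linarith [ht.1])) _)
    rw [← ENNReal.ofReal_mul (by positivity), ← ENNReal.ofReal_mul (by positivity), mul_assoc]

end DirichletSums

/-! ### Stirling's formula for real arguments and the constant `aConst`. -/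

section RealStirling

theorem tendsto_log_factorial_sub :
    Tendsto (fun n : ℕ => Real.log n.factorial - (n * Real.log n - n + Real.log n / 2)) atTop
      (𝓝 (Real.log (2 * Real.pi) / 2)) := by
  have h1 := (Real.continuousAt_log (Real.sqrt_pos.2 Real.pi_pos).ne').tendsto.comp
    Stirling.tendsto_stirlingSeq_sqrt_pi
  have h2 := h1.add_const (Real.log 2 / 2)
  have h3 : Real.log (Real.sqrt Real.pi) + Real.log 2 / 2 = Real.log (2 * Real.pi) / 2 := by
    rw [Real.log_sqrt Real.pi_pos.le, Real.log_mul two_ne_zero Real.pi_ne_zero]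
    ring
  rw [h3] at h2
  refine h2.congr' ?_
  filter_upwards [eventually_ge_atTop 1] with n hn
  have hn0 : (n : ℝ) ≠ 0 := by exact_mod_cast (by omega : n ≠ 0)
  rw [Function.comp, Stirling.log_stirlingSeq_formula, Real.log_div hn0 (Real.exp_pos _).ne',
    Real.log_exp, Real.log_mul two_ne_zero hn0]
  ring

/-- **Stirling's formula** for the Gamma function. -/
theorem tendsto_log_Gamma_add_one_sub :
    Tendsto (fun x : ℝ => Real.log (Real.Gamma (x + 1)) - (x * Real.log x - x + Real.log x / 2))
      atTop (𝓝 (Real.log (2 * Real.pi) / 2)) := by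
  have hfl : Tendsto (fun x : ℝ => ⌊x⌋₊) atTop atTop := tendsto_nat_floor_atTop
  have h1 := tendsto_log_factorial_sub.comp hfl
  have h2 : Tendsto (fun x : ℝ => (3 : ℝ) / (⌊x⌋₊ : ℝ)) atTop (𝓝 0) :=
    (tendsto_const_div_atTop_nhds_zero_nat 3).comp hfl
  -- Compare `x` with its integer part `n`: Stirling's expression changes by at most `3 / n`.
  have h3 : Tendsto (fun x : ℝ =>
      (Real.log (Real.Gamma (x + 1)) - (x * Real.log x - x + Real.log x / 2)) -
        (Real.log (⌊x⌋₊).factorial -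
          (⌊x⌋₊ * Real.log ⌊x⌋₊ - ⌊x⌋₊ + Real.log ⌊x⌋₊ / 2))) atTop (𝓝 0) := by
    refine squeeze_zero_norm' ?_ h2
    filter_upwards [eventually_ge_atTop 1] with x hx
    have hx0 : (0 : ℝ) < x := by linarith
    set n := ⌊x⌋₊ with hn
    have hn1 : 1 ≤ n := Nat.le_floor (by simpa using hx)
    have hn0 : (0 : ℝ) < n := by exact_mod_cast hn1
    have hnx : (n : ℝ) ≤ x := Nat.floor_le hx0.le
    have hxn : x < n + 1 := Nat.lt_floor_add_one x
    -- Log-convexity of the Gamma function, as in the Bohr–Mollerup theorem, traps `log Γ(x+1)`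
    -- between interpolations from `n!` with slopes `log n` and `log (n+1)`.
    have hG : 0 ≤ Real.log (Real.Gamma (x + 1)) - (Real.log n.factorial + (x - n) * Real.log n) ∧
        Real.log (Real.Gamma (x + 1)) - (Real.log n.factorial + (x - n) * Real.log (n + 1)) ≤
          0 := by
      have hfac : Real.log (Real.Gamma ((n : ℝ) + 1)) = Real.log n.factorial := by
        rw [Real.Gamma_nat_eq_factorial]
      rcases eq_or_lt_of_le hnx with h | h
      · rw [← h, hfac]
        simp
      · have hfeq : ∀ {y : ℝ}, 0 < y →
            (Real.log ∘ Real.Gamma) (y + 1) = (Real.log ∘ Real.Gamma) y + Real.log y := by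
          intro y hy
          rw [Function.comp, Function.comp, Real.Gamma_add_one hy.ne',
            Real.log_mul hy.ne' (Real.Gamma_pos_of_pos hy).ne', add_comm]
        have a1 := Real.BohrMollerup.f_add_nat_le (n := n + 1) (x := x - n)
          Real.convexOn_log_Gamma hfeq (by omega) (by linarith) (by linarith)
        have a2 := Real.BohrMollerup.f_add_nat_ge (n := n + 1) (x := x - n)
          Real.convexOn_log_Gamma hfeq (by omega) (by linarith)
        have a3 : ((n + 1 : ℕ) : ℝ) + (x - n) = x + 1 := by push_cast; ring
        have a4 : ((n + 1 : ℕ) : ℝ) - 1 = n := by push_cast; ring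
        rw [a3] at a1 a2
        rw [a4] at a2
        simp only [Function.comp, Nat.cast_add, Nat.cast_one, hfac] at a1 a2
        constructor <;> linarith
    -- logarithmic bounds
    have hlog : Real.log x - Real.log n = Real.log (x / n) :=
      (Real.log_div hx0.ne' hn0.ne').symm
    have b1 : Real.log (x / n) ≤ x / n - 1 := Real.log_le_sub_one_of_pos (by positivity)
    have b2 : 1 - (x / n)⁻¹ ≤ Real.log (x / n) := Real.one_sub_inv_le_log_of_pos (by positivity)
    have b3 : Real.log (n + 1) - Real.log n ≤ 1 / n := by
      rw [← Real.log_div (by positivity) hn0.ne']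
      refine (Real.log_le_sub_one_of_pos (by positivity)).trans (le_of_eq ?_)
      field_simp
      ring
    have b3' : 0 ≤ Real.log (n + 1) - Real.log n :=
      sub_nonneg.2 (Real.log_le_log hn0 (by linarith))
    have b4 : 0 ≤ Real.log (x / n) := Real.log_nonneg (by rw [le_div_iff₀ hn0]; linarith)
    have c0 : x / n - 1 ≤ 1 / n := by
      rw [div_sub_one hn0.ne']
      gcongr
      linarith
    have c1 : x * Real.log (x / n) ≤ (x - n) + 1 / n := by
      have e1 : x * (x / n - 1) = (x - n) + (x - n) * (x / n - 1) := by field_simp; ring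
      have e2 : (x - n) * (x / n - 1) ≤ 1 * (1 / n) := by
        refine mul_le_mul (by linarith) c0 ?_ zero_le_one
        rw [sub_nonneg, le_div_iff₀ hn0]
        linarith
      linarith [mul_le_mul_of_nonneg_left b1 hx0.le]
    have c2 : x - n ≤ x * Real.log (x / n) := by
      have e1 : x * (1 - (x / n)⁻¹) = x - n := by field_simp
      linarith [mul_le_mul_of_nonneg_left b2 hx0.le]
    have c3 : (x - n) * (Real.log (n + 1) - Real.log n) ≤ 1 / n :=
      (mul_le_of_le_one_left b3' (by linarith)).trans b3
    have c4 : (0 : ℝ) < 1 / n := by positivity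
    have c5 : (3 : ℝ) / n = 3 * (1 / n) := by ring
    rw [Real.norm_eq_abs, abs_le, c5]
    have d1 : x * Real.log (x / n) = x * Real.log x - x * Real.log n := by rw [← hlog]; ring
    have hG1 := hG.1
    have hG2 := hG.2
    constructor <;> nlinarith
  have h4 := h3.add h1
  rw [zero_add] at h4
  refine h4.congr fun x => ?_
  simp [Function.comp]

theorem log_aConst {k : ℕ} (hk : 1 ≤ k) :
    Real.log (aConst k) =
      (k : ℝ) / 2 * Real.log (2 * Real.pi) - Real.log (2 * Real.pi * k) / 2 := by
  have hk0 : (0 : ℝ) < k := by exact_mod_cast hk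
  have hpi := Real.pi_pos
  rw [aConst, Real.log_div (by positivity) (by positivity), Real.log_rpow (by positivity),
    Real.log_sqrt (by positivity)]

/-- Asymptotics of the Gamma factor of `dirichletTail`. -/
theorem tendsto_log_Gamma_ratio {k : ℕ} (hk : 1 ≤ k) :
    Tendsto (fun p : ℝ => Real.log (Real.Gamma (p + 1) ^ k / Real.Gamma ((k : ℝ) * p + 1)) +
      k * p * Real.log k - ((k : ℝ) - 1) / 2 * Real.log p) atTop (𝓝 (Real.log (aConst k))) := by
  have hk0 : (0 : ℝ) < k := by exact_mod_cast hk
  have h1 := tendsto_log_Gamma_add_one_sub.const_mul (k : ℝ)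
  have h2 := tendsto_log_Gamma_add_one_sub.comp (tendsto_id.const_mul_atTop hk0)
  -- The term `log (k * p) / 2` splits into `log p / 2` and the constant `log k / 2`, which belongs
  -- to the limit.
  have h3 := (h1.sub h2).sub_const (Real.log k / 2)
  have hlim : (k : ℝ) * (Real.log (2 * Real.pi) / 2) - Real.log (2 * Real.pi) / 2 - Real.log k / 2 =
      Real.log (aConst k) := by
    rw [log_aConst hk, Real.log_mul (by positivity) hk0.ne']
    ring
  rw [hlim] at h3
  refine h3.congr' ?_
  filter_upwards [eventually_gt_atTop 0] with p hp
  have g1 : 0 < Real.Gamma (p + 1) := Real.Gamma_pos_of_pos (by linarith)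
  have g2 : 0 < Real.Gamma ((k : ℝ) * p + 1) := Real.Gamma_pos_of_pos (by positivity)
  rw [Real.log_div (by positivity) g2.ne', Real.log_pow]
  simp only [Function.comp, id]
  rw [Real.log_mul hk0.ne' hp.ne']
  ring

end RealStirling

/-! ### Monotonicity and minimizers of `gFun` on the positive integers, and the overlap rate. -/

section MinimizersOfG

theorem gFun_pos (γ : ℝ) {x : ℝ} (hx : 0 < x) : 0 < gFun γ x :=
  mul_pos hx (Real.exp_pos _)

theorem log_gFun (γ : ℝ) {x : ℝ} (hx : 0 < x) :
    Real.log (gFun γ x) = Real.log x - γ * (1 - 1 / x) := by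
  rw [gFun, Real.log_mul hx.ne' (Real.exp_pos _).ne', Real.log_exp]
  ring

theorem gFun_one (γ : ℝ) : gFun γ 1 = 1 := by simp [gFun]

theorem gammaSeq_one : gammaSeq 1 = 2 * Real.log 2 := by
  simp [gammaSeq]
  norm_num

/-- This identity explains `gammaSeq`: it is the value of `γ` at which lengths `k` and `k + 1` tie.
All comparisons of values of `gFun` below reduce to it. -/
theorem log_gFun_succ (γ : ℝ) {k : ℕ} (hk : 1 ≤ k) :
    Real.log (gFun γ (k + 1 : ℕ)) =
      Real.log (gFun γ k) + (gammaSeq k - γ) / ((k : ℝ) * (k + 1)) := by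
  have hk0 : (0 : ℝ) < k := by exact_mod_cast hk
  rw [log_gFun γ hk0, log_gFun γ (by positivity), gammaSeq, Real.log_div (by positivity) hk0.ne']
  push_cast
  field_simp
  ring

/-- Apply `1 - 1/x < log x < x - 1` at `x = (k+1)/k`. The intervals are disjoint and ordered, so
`gammaSeq` increases strictly to infinity and `gFun γ` first falls, then rises. -/
theorem gammaSeq_mem_Ioo {k : ℕ} (hk : 1 ≤ k) : gammaSeq k ∈ Set.Ioo (k : ℝ) (k + 1) := by
  have hk0 : (0 : ℝ) < k := by exact_mod_cast hk
  have h1 : Real.log ((k + 1) / k) < (k + 1) / k - 1 :=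
    Real.log_lt_sub_one_of_pos (by positivity) (by rw [Ne, div_eq_one_iff_eq hk0.ne']; linarith)
  have h2 : Real.log (((k : ℝ) + 1) / k)⁻¹ < (((k : ℝ) + 1) / k)⁻¹ - 1 :=
    Real.log_lt_sub_one_of_pos (by positivity)
      (by rw [inv_div, Ne, div_eq_one_iff_eq (by positivity)]; linarith)
  rw [Real.log_inv] at h2
  have h3 : (k : ℝ) * (k + 1) * ((k + 1) / k - 1) = k + 1 := by field_simp; ring
  have h4 : (k : ℝ) * (k + 1) * ((((k : ℝ) + 1) / k)⁻¹ - 1) = -k := by field_simp; ring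
  have h5 : (0 : ℝ) < k * (k + 1) := by positivity
  constructor
  · have := mul_lt_mul_of_pos_left h2 h5
    rw [h4] at this
    rw [gammaSeq]
    linarith
  · have := mul_lt_mul_of_pos_left h1 h5
    rw [h3] at this
    exact this

theorem gammaSeq_lt_gammaSeq {j k : ℕ} (hj : 1 ≤ j) (hjk : j < k) : gammaSeq j < gammaSeq k := by
  have h1 := (gammaSeq_mem_Ioo hj).2
  have h2 := (gammaSeq_mem_Ioo (hj.trans hjk.le)).1
  have h3 : (j : ℝ) + 1 ≤ k := by exact_mod_cast hjk
  linarith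

theorem gammaSeq_le_gammaSeq {j k : ℕ} (hj : 1 ≤ j) (hjk : j ≤ k) : gammaSeq j ≤ gammaSeq k := by
  rcases eq_or_lt_of_le hjk with rfl | h
  · exact le_rfl
  · exact (gammaSeq_lt_gammaSeq hj h).le

theorem gFun_le_gFun_iff {γ : ℝ} {x y : ℝ} (hx : 0 < x) (hy : 0 < y) :
    gFun γ x ≤ gFun γ y ↔ Real.log (gFun γ x) ≤ Real.log (gFun γ y) :=
  (Real.log_le_log_iff (gFun_pos γ hx) (gFun_pos γ hy)).symm

theorem gFun_le_succ {γ : ℝ} {k : ℕ} (hk : 1 ≤ k) (h : γ ≤ gammaSeq k) :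
    gFun γ k ≤ gFun γ (k + 1 : ℕ) := by
  have hk0 : (0 : ℝ) < k := by exact_mod_cast hk
  rw [gFun_le_gFun_iff hk0 (by positivity), log_gFun_succ γ hk]
  have : 0 ≤ (gammaSeq k - γ) / ((k : ℝ) * (k + 1)) := div_nonneg (by linarith) (by positivity)
  linarith

theorem gFun_lt_succ {γ : ℝ} {k : ℕ} (hk : 1 ≤ k) (h : γ < gammaSeq k) :
    gFun γ k < gFun γ (k + 1 : ℕ) := by
  have hk0 : (0 : ℝ) < k := by exact_mod_cast hk
  rw [← Real.log_lt_log_iff (gFun_pos γ hk0) (gFun_pos γ (by positivity)), log_gFun_succ γ hk]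
  have : 0 < (gammaSeq k - γ) / ((k : ℝ) * (k + 1)) := div_pos (by linarith) (by positivity)
  linarith

theorem gFun_succ_le {γ : ℝ} {k : ℕ} (hk : 1 ≤ k) (h : gammaSeq k ≤ γ) :
    gFun γ (k + 1 : ℕ) ≤ gFun γ k := by
  have hk0 : (0 : ℝ) < k := by exact_mod_cast hk
  rw [gFun_le_gFun_iff (by positivity) hk0, log_gFun_succ γ hk]
  have : (gammaSeq k - γ) / ((k : ℝ) * (k + 1)) ≤ 0 :=
    div_nonpos_of_nonpos_of_nonneg (by linarith) (by positivity)
  linarith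

theorem gFun_succ_lt {γ : ℝ} {k : ℕ} (hk : 1 ≤ k) (h : gammaSeq k < γ) :
    gFun γ (k + 1 : ℕ) < gFun γ k := by
  have hk0 : (0 : ℝ) < k := by exact_mod_cast hk
  rw [← Real.log_lt_log_iff (gFun_pos γ (by positivity)) (gFun_pos γ hk0), log_gFun_succ γ hk]
  have : (gammaSeq k - γ) / ((k : ℝ) * (k + 1)) < 0 :=
    div_neg_of_neg_of_pos (by linarith) (by positivity)
  linarith

theorem gFun_le_of_le {γ : ℝ} {k j : ℕ} (hk : 1 ≤ k) (h : γ ≤ gammaSeq k) (hkj : k ≤ j) :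
    gFun γ k ≤ gFun γ j := by
  induction j, hkj using Nat.le_induction with
  | base => exact le_rfl
  | succ j hkj ih =>
    exact ih.trans (gFun_le_succ (hk.trans hkj) (h.trans (gammaSeq_le_gammaSeq hk hkj)))

theorem gFun_succ_le_of_le {γ : ℝ} {k j : ℕ} (hj : 1 ≤ j) (h : gammaSeq k ≤ γ) (hjk : j ≤ k) :
    gFun γ (k + 1 : ℕ) ≤ gFun γ j := by
  induction k, hjk using Nat.le_induction with
  | base => exact gFun_succ_le hj h
  | succ k hjk ih =>
    exact (gFun_succ_le (by omega) h).trans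
      (ih ((gammaSeq_le_gammaSeq (by omega) (by omega)).trans h))

/-- Away from `gammaSet`, `γ` lies strictly between two consecutive terms of `gammaSeq`. -/
theorem exists_gammaSeq_lt_lt {γ : ℝ} (hγ : γ ∉ gammaSet) (h : gammaSeq 1 < γ) :
    ∃ k : ℕ, 1 ≤ k ∧ gammaSeq k < γ ∧ γ < gammaSeq (k + 1) := by
  classical
  have hex : ∃ k : ℕ, γ < gammaSeq (k + 1) := by
    obtain ⟨k, hk⟩ := exists_nat_gt γ
    refine ⟨k, hk.trans ?_⟩
    have := (gammaSeq_mem_Ioo (k := k + 1) (by omega)).1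
    push_cast at this
    linarith
  have hpos : 1 ≤ Nat.find hex := by
    by_contra h0
    have h1 : Nat.find hex = 0 := by omega
    have h2 := Nat.find_spec hex
    rw [h1] at h2
    exact absurd h2 (not_lt.2 h.le)
  refine ⟨Nat.find hex, hpos, ?_, Nat.find_spec hex⟩
  have h3 := Nat.find_min hex (m := Nat.find hex - 1) (by omega)
  rw [Nat.sub_add_cancel hpos, not_lt] at h3
  exact lt_of_le_of_ne h3 fun h4 => hγ ⟨_, hpos, h4.symm⟩

/-- Bernoulli's inequality gives `(1 + 1/k) ^ k ≥ 2`. The bound supplies the lower bound on `γ`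
behind `overlap_rate_neg`. -/
theorem log_two_mul_le_gammaSeq {k : ℕ} (hk : 1 ≤ k) : ((k : ℝ) + 1) * Real.log 2 ≤ gammaSeq k := by
  have hk0 : (0 : ℝ) < k := by exact_mod_cast hk
  have h1 : Real.log 2 ≤ k * Real.log ((k + 1) / k) := by
    rw [← Real.log_pow]
    refine Real.log_le_log two_pos ?_
    have h2 := one_add_mul_le_pow (a := (1 : ℝ) / k) (by
      have : (0 : ℝ) < 1 / k := by positivity
      linarith) k
    have h3 : (1 : ℝ) + k * (1 / k) = 2 := by field_simp; norm_num
    have h4 : ((k : ℝ) + 1) / k = 1 + 1 / k := by field_simp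
    rwa [h4, ← h3]
  rw [gammaSeq, mul_comm (k : ℝ), mul_assoc]
  exact mul_le_mul_of_nonneg_left h1 (by positivity)

/-- The exponential rate of the number of pairs of light paths with `k` edges that share `l` of
them is negative. -/
theorem overlap_rate_neg {γ : ℝ} {k l : ℕ} (hl : 1 ≤ l) (hlk : l < k)
    (hγ : gammaSeq (k - 1) ≤ γ) :
    ((2 * k - l : ℕ) : ℝ) * Real.log (2 * gFun γ k / (2 * k - l : ℕ)) - l * Real.log 2 +
      ((2 * k - 2 - l : ℕ) : ℝ) * γ < 0 := by
  have hk0 : (0 : ℝ) < k := by exact_mod_cast (by omega : 0 < k)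
  have hl0 : (0 : ℝ) < l := by exact_mod_cast hl
  have hm : ((2 * k - l : ℕ) : ℝ) = 2 * k - l := by
    rw [Nat.cast_sub (by omega)]; push_cast; ring
  have hm2 : ((2 * k - 2 - l : ℕ) : ℝ) = 2 * k - 2 - l := by
    rw [Nat.cast_sub (by omega), Nat.cast_sub (by omega)]; push_cast; ring
  have hlk' : (l : ℝ) < k := by exact_mod_cast hlk
  have hm0 : (0 : ℝ) < 2 * k - l := by linarith
  have h1 := log_two_mul_le_gammaSeq (k := k - 1) (by omega)
  have h2 : (((k - 1 : ℕ) : ℝ) + 1) = k := by rw [Nat.cast_sub (by omega)]; push_cast; ring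
  rw [h2] at h1
  have h3 : (k : ℝ) * Real.log 2 ≤ γ := h1.trans hγ
  have h4 : l * Real.log 2 ≤ γ * (l / k) := by
    have := mul_le_mul_of_nonneg_right h3 (show 0 ≤ (l : ℝ) / k by positivity)
    have e : (k : ℝ) * Real.log 2 * (l / k) = l * Real.log 2 := by field_simp
    linarith
  have h5 : (2 * (k : ℝ) - l) * Real.log (2 * k / (2 * k - l)) ≤ l := by
    have := mul_le_mul_of_nonneg_left
      (Real.log_le_sub_one_of_pos (show 0 < 2 * (k : ℝ) / (2 * k - l) by positivity)) hm0.le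
    have e : (2 * (k : ℝ) - l) * (2 * k / (2 * k - l) - 1) = l := by field_simp; ring
    linarith
  have h6 : Real.log (2 * gFun γ k / (2 * k - l)) =
      Real.log (2 * k / (2 * k - l)) - γ * (1 - 1 / k) := by
    rw [Real.log_div (by have := gFun_pos γ hk0; positivity) hm0.ne',
      Real.log_mul two_ne_zero (gFun_pos γ hk0).ne', log_gFun γ hk0,
      Real.log_div (by positivity) hm0.ne', Real.log_mul two_ne_zero hk0.ne']
    ring
  rw [hm, hm2, h6]
  have h7 := Real.log_two_gt_d9
  have h8 : (2 * (k : ℝ) - l) * (γ * (1 - 1 / k)) = (2 * k - 2 - l) * γ + γ * (l / k) := by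
    field_simp; ring
  -- After cancellation the rate is `(2k-l) log(2k/(2k-l)) - γ l/k - l log 2`. The first term is at
  -- most `l`, and `γ ≥ k log 2` bounds the whole by `l (1 - 2 log 2)`.
  have h9 : (l : ℝ) * (1 - 2 * Real.log 2) < 0 := mul_neg_of_pos_of_neg hl0 (by linarith)
  nlinarith

end MinimizersOfG

/-! ### Moment bounds and Poisson approximation on a fixed complete graph. -/

section WeightedCompleteGraph

variable {V : Type*} [DecidableEq V] {u v : V}
  {Ω : Type*} [MeasurableSpace Ω] {μ : Measure Ω}
  {Y : (⊤ : SimpleGraph V).edgeSet → Ω → ℝ}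

/-- The weight of a path as a random variable. -/
noncomputable def weightOf (Y : (⊤ : SimpleGraph V).edgeSet → Ω → ℝ)
    (p : (⊤ : SimpleGraph V).Path u v) (ω : Ω) : ℝ :=
  ∑ e ∈ pathEdges p, Y e ω

theorem measurable_weightOf (hY : ∀ e, Measurable (Y e)) (p : (⊤ : SimpleGraph V).Path u v) :
    Measurable (weightOf Y p) :=
  Finset.measurable_sum _ fun e _ => hY e

theorem pathEdges_nonempty (huv : u ≠ v) (p : (⊤ : SimpleGraph V).Path u v) :
    (pathEdges p).Nonempty := by
  rw [← Finset.card_pos, card_pathEdges]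
  exact one_le_length huv p

theorem sum_pow_Ico_le {q : ℝ} (hq : 0 ≤ q) (hq1 : q < 1) (N : ℕ) :
    ∑ m ∈ Finset.Ico 1 N, q ^ m ≤ q / (1 - q) := by
  have h1 : (0 : ℝ) < 1 - q := by linarith
  rcases Nat.lt_or_ge N 1 with h | h
  · rw [Finset.Ico_eq_empty (by omega), Finset.sum_empty]
    positivity
  · have h2 : ∑ m ∈ Finset.Ico 1 N, q ^ m = q * ∑ m ∈ Finset.range (N - 1), q ^ m := by
      rw [Finset.sum_Ico_eq_sum_range, Finset.mul_sum]
      exact Finset.sum_congr rfl fun m _ => by rw [pow_add, pow_one]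
    have h3 := geom_sum_mul_neg q (N - 1)
    have h4 : ∑ m ∈ Finset.range (N - 1), q ^ m ≤ 1 / (1 - q) := by
      rw [le_div_iff₀ h1, h3]
      have := pow_nonneg hq (N - 1)
      linarith
    rw [h2, div_eq_mul_one_div]
    exact mul_le_mul_of_nonneg_left h4 hq

theorem measureReal_weightOf_le (hY : ∀ e, Measurable (Y e)) (hind : iIndepFun Y μ)
    (hpos : ∀ e, ∀ᵐ ω ∂μ, 0 < Y e ω) {a M : ℝ} (ha : 0 < a) (hM : 0 ≤ M)
    (hmom : ∀ e, ∫⁻ ω, ENNReal.ofReal (Y e ω ^ (-a)) ∂μ ≤ ENNReal.ofReal M) (huv : u ≠ v)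
    {c : ℝ} (hc : 0 < c) (p : (⊤ : SimpleGraph V).Path u v) :
    μ.real {ω | weightOf Y p ω ≤ c} ≤
      ((c / p.1.length) ^ p.1.length) ^ a * M ^ p.1.length := by
  have h := measure_weighted_sum_le hY hind hpos ha hM hmom (pathEdges_nonempty huv p)
    (w := fun _ => 1) (fun _ _ => one_pos) hc
  simp only [one_mul, Finset.prod_const_one, div_one, card_pathEdges] at h
  exact ENNReal.toReal_le_of_le_ofReal (by positivity) h

/-- If both paths are light, their total weight is at most `2 * c`. That total is a sum over the `2
* k - l` edges of the union in which shared edges have coefficient `2`, so the weighted tail bound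
applies with coefficient product `2 ^ l`. -/
theorem measureReal_inter_weightOf_le (hY : ∀ e, Measurable (Y e)) (hind : iIndepFun Y μ)
    (hpos : ∀ e, ∀ᵐ ω ∂μ, 0 < Y e ω) {a M : ℝ} (ha : 0 < a) (hM : 0 ≤ M)
    (hmom : ∀ e, ∫⁻ ω, ENNReal.ofReal (Y e ω ^ (-a)) ∂μ ≤ ENNReal.ofReal M) (huv : u ≠ v)
    {c : ℝ} (hc : 0 < c) {k l : ℕ} {p q : (⊤ : SimpleGraph V).Path u v} (hp : p.1.length = k)
    (hq : q.1.length = k) (hl : (pathEdges p ∩ pathEdges q).card = l) :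
    μ.real ({ω | weightOf Y p ω ≤ c} ∩ {ω | weightOf Y q ω ≤ c}) ≤
      (((2 * c / (2 * k - l : ℕ)) ^ (2 * k - l)) / 2 ^ l) ^ a * M ^ (2 * k - l) := by
  classical
  set S := pathEdges p ∪ pathEdges q with hS
  set w : (⊤ : SimpleGraph V).edgeSet → ℝ := fun e =>
    if e ∈ pathEdges p ∩ pathEdges q then 2 else 1 with hw
  have hcard : S.card = 2 * k - l := by
    have := Finset.card_union_add_card_inter (pathEdges p) (pathEdges q)
    rw [← hS, card_pathEdges, card_pathEdges, hp, hq, hl] at this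
    omega
  have hprod : ∏ e ∈ S, w e = 2 ^ l := by
    have hf : S.filter (· ∈ pathEdges p ∩ pathEdges q) = pathEdges p ∩ pathEdges q := by
      ext e
      simp only [hS, Finset.mem_filter, Finset.mem_union, Finset.mem_inter]
      tauto
    rw [hw, Finset.prod_ite, Finset.prod_const, Finset.prod_const_one, mul_one, hf, hl]
  have hne : S.Nonempty := (pathEdges_nonempty huv p).mono Finset.subset_union_left
  have h := measure_weighted_sum_le hY hind hpos ha hM hmom hne (w := w)
    (fun e _ => by simp only [hw]; split_ifs <;> norm_num) (show 0 < 2 * c by linarith)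
  rw [hcard, hprod] at h
  refine ENNReal.toReal_le_of_le_ofReal (by positivity) (le_trans (measure_mono ?_) h)
  rintro ω ⟨h1, h2⟩
  change weightOf Y p ω ≤ c at h1
  change weightOf Y q ω ≤ c at h2
  change ∑ e ∈ S, w e * Y e ω ≤ 2 * c
  have h3 : ∑ e ∈ S, w e * Y e ω = weightOf Y p ω + weightOf Y q ω := by
    rw [weightOf, weightOf, ← Finset.sum_union_inter, ← hS]
    have h4 : ∑ e ∈ pathEdges p ∩ pathEdges q, Y e ω =
        ∑ e ∈ S, if e ∈ pathEdges p ∩ pathEdges q then Y e ω else 0 := by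
      rw [← Finset.sum_filter]
      refine Finset.sum_congr ?_ fun _ _ => rfl
      ext e
      simp only [hS, Finset.mem_filter, Finset.mem_union, Finset.mem_inter]
      tauto
    rw [h4, ← Finset.sum_add_distrib]
    refine Finset.sum_congr rfl fun e _ => ?_
    simp only [hw]
    split_ifs <;> ring
  linarith

variable [Fintype V] [IsProbabilityMeasure μ]

/-- First moment bound for the existence of light paths with lengths in a given set. -/
theorem measureReal_exists_weightOf_le (hY : ∀ e, Measurable (Y e)) (hind : iIndepFun Y μ)
    (hpos : ∀ e, ∀ᵐ ω ∂μ, 0 < Y e ω) {a M : ℝ} (ha : 0 < a) (hM : 0 ≤ M)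
    (hmom : ∀ e, ∫⁻ ω, ENNReal.ofReal (Y e ω ^ (-a)) ∂μ ≤ ENNReal.ofReal M) (huv : u ≠ v)
    {c : ℝ} (hc : 0 < c) {L : Set ℕ} {q : ℝ} (hq : 0 ≤ q) (hq1 : q < 1)
    (hL : ∀ m ∈ L, 1 ≤ m →
      (Fintype.card V : ℝ) ^ (m - 1) * (((c / m) ^ m) ^ a * M ^ m) ≤ q ^ m) :
    μ.real {ω | ∃ p : (⊤ : SimpleGraph V).Path u v, p.1.length ∈ L ∧ weightOf Y p ω ≤ c} ≤
      q / (1 - q) := by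
  classical
  have hsub : {ω | ∃ p : (⊤ : SimpleGraph V).Path u v, p.1.length ∈ L ∧ weightOf Y p ω ≤ c} ⊆
      ⋃ m ∈ (Finset.Ico 1 (Fintype.card V)).filter (· ∈ L), ⋃ p ∈ pathsOfLength u v m,
        {ω | weightOf Y p ω ≤ c} := by
    rintro ω ⟨p, hpL, hp⟩
    simp only [Set.mem_iUnion]
    exact ⟨p.1.length, Finset.mem_filter.2 ⟨Finset.mem_Ico.2 ⟨one_le_length huv p,
      p.2.length_lt⟩, hpL⟩, p, mem_pathsOfLength.2 rfl, hp⟩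
  refine (measureReal_mono hsub (measure_ne_top _ _)).trans
    ((measureReal_biUnion_finset_le _ _).trans ?_)
  -- Summing a geometric series over the lengths makes the bound independent of the number of
  -- vertices.
  refine le_trans ?_ (sum_pow_Ico_le hq hq1 (Fintype.card V))
  rw [Finset.sum_filter]
  refine Finset.sum_le_sum fun m hm => ?_
  split_ifs with hmL
  · refine ((measureReal_biUnion_finset_le _ _).trans ?_).trans
      (hL m hmL (Finset.mem_Ico.1 hm).1)
    have h1 : ∀ p ∈ pathsOfLength u v m, μ.real {ω | weightOf Y p ω ≤ c} ≤
        ((c / m) ^ m) ^ a * M ^ m := by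
      intro p hp
      have := measureReal_weightOf_le hY hind hpos ha hM hmom huv hc p
      rwa [mem_pathsOfLength.1 hp] at this
    refine (Finset.sum_le_card_nsmul _ _ _ h1).trans ?_
    rw [nsmul_eq_mul]
    refine mul_le_mul_of_nonneg_right ?_ (by positivity)
    exact_mod_cast card_pathsOfLength_le m
  · positivity

/-- Distinct paths have edge sets not included in one another, so atomlessness excludes a tie for
each pair; there are finitely many pairs. -/
theorem ae_optimal_unique (hY : ∀ e, Measurable (Y e)) (hind : iIndepFun Y μ)
    (hatom : ∀ e x, μ {ω | Y e ω = x} = 0) :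
    ∀ᵐ ω ∂μ, ∀ p q : (⊤ : SimpleGraph V).Path u v, weightOf Y p ω = weightOf Y q ω → p = q := by
  rw [ae_all_iff]
  intro p
  rw [ae_all_iff]
  intro q
  by_cases hpq : p = q
  · exact ae_of_all _ fun _ _ => hpq
  · have h := measure_sum_eq_sum_eq_zero hY hind hatom
      (S := pathEdges p) (T := pathEdges q) fun h => hpq (eq_of_pathEdges_subset h)
    refine measure_mono_null (fun ω hω => ?_) h
    by_contra h'
    exact hω fun h'' => absurd h'' h'

/-- Poisson approximation for the number of light paths with `k` edges. -/
theorem abs_measureReal_forall_lt_weightOf_sub_exp_le (hY : ∀ e, Measurable (Y e))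
    (hind : iIndepFun Y μ)
    (hpos : ∀ e, ∀ᵐ ω ∂μ, 0 < Y e ω) {a M : ℝ} (ha : 0 < a) (hM : 0 ≤ M)
    (hmom : ∀ e, ∫⁻ ω, ENNReal.ofReal (Y e ω ^ (-a)) ∂μ ≤ ENNReal.ofReal M) (huv : u ≠ v)
    {c U : ℝ} (hc : 0 < c) {k : ℕ} (hk : 2 ≤ k)
    (hU : ∀ p ∈ pathsOfLength u v k, μ.real {ω | weightOf Y p ω ≤ c} ≤ U) :
    |μ.real {ω | ∀ p ∈ pathsOfLength u v k, c < weightOf Y p ω} -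
      Real.exp (-∑ p ∈ pathsOfLength u v k, μ.real {ω | weightOf Y p ω ≤ c})| ≤
      ((Fintype.card V : ℝ) ^ (k - 1) * U) ^ 2 * (k ^ 2 / Fintype.card V) +
        ∑ l ∈ Finset.Ico 1 k, ((k - 1).choose l * (k + 1) ^ l : ℕ) *
          ((Fintype.card V : ℝ) ^ (2 * k - 2 - l) *
            ((((2 * c / (2 * k - l : ℕ)) ^ (2 * k - l)) / 2 ^ l) ^ a * M ^ (2 * k - l))) := by
  classical
  set N := Fintype.card V with hN
  have hNpos : 0 < N := Fintype.card_pos_iff.2 ⟨u⟩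
  have hN0 : (0 : ℝ) < N := by exact_mod_cast hNpos
  set s := pathsOfLength u v k with hs
  set A : (⊤ : SimpleGraph V).Path u v → Set Ω := fun p => {ω | weightOf Y p ω ≤ c} with hA
  -- The dependency neighbourhood consists of the paths sharing an edge with `p`; the other paths
  -- depend only on edges outside `p`.
  set D : (⊤ : SimpleGraph V).Path u v → Finset ((⊤ : SimpleGraph V).Path u v) := fun p =>
    s.filter fun q => 1 ≤ (pathEdges p ∩ pathEdges q).card with hD
  have hAm : ∀ p, MeasurableSet (A p) := fun p =>
    measurableSet_le (measurable_weightOf hY p) measurable_const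
  have hindep : ∀ p ∈ s, IndepFun ((A p).indicator (1 : Ω → ℝ))
      (fun ω => ∑ q ∈ s \ D p, (A q).indicator (1 : Ω → ℕ) ω) μ := by
    intro p _
    have hdisj : Disjoint (pathEdges p) (pathEdges p)ᶜ := disjoint_compl_right
    have h := hind.indepFun_finset (pathEdges p) (pathEdges p)ᶜ hdisj hY
    have hsub : ∀ q ∈ s \ D p, pathEdges q ⊆ (pathEdges p)ᶜ := by
      intro q hq e he
      rw [Finset.mem_compl]
      intro hep
      rw [Finset.mem_sdiff, hD, Finset.mem_filter, not_and] at hq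
      exact hq.2 hq.1 (Finset.card_pos.2 ⟨e, Finset.mem_inter.2 ⟨hep, he⟩⟩)
    have hφ : Measurable fun f : pathEdges p → ℝ =>
        {f : pathEdges p → ℝ | ∑ e, f e ≤ c}.indicator (1 : (pathEdges p → ℝ) → ℝ) f := by
      refine (measurable_const (a := (1 : ℝ))).indicator ?_
      exact measurableSet_le (by fun_prop) measurable_const
    have hψ : Measurable fun f : ((pathEdges p)ᶜ : Finset _) → ℝ =>
        ∑ q ∈ (s \ D p).attach, {f : ((pathEdges p)ᶜ : Finset _) → ℝ |
          ∑ e ∈ (pathEdges q.1).attach, f ⟨e.1, hsub q.1 q.2 e.2⟩ ≤ c}.indicator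
            (1 : (((pathEdges p)ᶜ : Finset _) → ℝ) → ℕ) f := by
      refine Finset.measurable_sum _ fun q _ => ?_
      refine (measurable_const (a := (1 : ℕ))).indicator ?_
      refine measurableSet_le (Finset.measurable_sum _ fun e _ => ?_) measurable_const
      exact measurable_pi_apply _
    have h2 := h.comp hφ hψ
    have e1 : ((A p).indicator (1 : Ω → ℝ)) = (fun f : pathEdges p → ℝ =>
        {f : pathEdges p → ℝ | ∑ e, f e ≤ c}.indicator (1 : (pathEdges p → ℝ) → ℝ) f) ∘
          fun ω (e : pathEdges p) => Y e ω := by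
      funext ω
      simp only [Function.comp, Set.indicator_apply, Set.mem_ofPred_eq, hA, weightOf]
      simp only [← Finset.sum_coe_sort (pathEdges p) (fun e => Y e ω), Pi.one_apply]
    have e2 : (fun ω => ∑ q ∈ s \ D p, (A q).indicator (1 : Ω → ℕ) ω) =
        (fun f : ((pathEdges p)ᶜ : Finset _) → ℝ =>
        ∑ q ∈ (s \ D p).attach, {f : ((pathEdges p)ᶜ : Finset _) → ℝ |
          ∑ e ∈ (pathEdges q.1).attach, f ⟨e.1, hsub q.1 q.2 e.2⟩ ≤ c}.indicator
            (1 : (((pathEdges p)ᶜ : Finset _) → ℝ) → ℕ) f) ∘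
          fun ω (e : ((pathEdges p)ᶜ : Finset _)) => Y e ω := by
      funext ω
      simp only [Function.comp, Set.indicator_apply, Set.mem_ofPred_eq, hA, weightOf]
      rw [← Finset.sum_attach (s \ D p)]
      refine Finset.sum_congr rfl fun q _ => ?_
      simp only [← Finset.sum_attach (pathEdges q.1) (fun e => Y e ω), Pi.one_apply]
    rw [e1, e2]
    exact h2
  have hDself : ∀ p ∈ s, p ∈ D p := by
    intro p hp
    rw [hD, Finset.mem_filter, Finset.inter_self, card_pathEdges]
    exact ⟨hp, one_le_length huv p⟩
  have hmain := abs_measure_biInter_compl_sub_exp_le (μ := μ) s A (fun p _ => hAm p) D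
    (fun p _ => Finset.filter_subset _ _) hDself hindep
  have hset : (⋂ p ∈ s, (A p)ᶜ) = {ω | ∀ p ∈ s, c < weightOf Y p ω} := by
    ext ω
    simp [hA]
  rw [hset] at hmain
  have hcards : (s.card : ℝ) ≤ (N : ℝ) ^ (k - 1) := by exact_mod_cast card_pathsOfLength_le k
  have herase : ∀ p ∈ s, (D p).erase p =
      s.filter fun q => 1 ≤ (pathEdges p ∩ pathEdges q).card ∧ q ≠ p := by
    intro p _
    ext q
    simp only [hD, Finset.mem_erase, Finset.mem_filter]
    tauto
  -- The overlap count with `l = 1` gives `(k² - 1) N^(k-2)` other paths, and `p` itself is absorbed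
  -- into `k² N^(k-2)`.
  have hDcard : ∀ p ∈ s, ((D p).card : ℝ) ≤ (N : ℝ) ^ (k - 1) * (k ^ 2 / N) := by
    intro p hp
    have h1 : (D p).card ≤ (k - 1) * ((k + 1) * N ^ (k - 1 - 1)) + 1 := by
      have := card_overlap_le (l := 1) (mem_pathsOfLength.1 hp)
      rw [← hs, ← hN, ← herase p hp, Finset.card_erase_of_mem (hDself p hp), Nat.choose_one_right,
        pow_one] at this
      omega
    have h2 : (D p).card ≤ k ^ 2 * N ^ (k - 1 - 1) := by
      refine h1.trans ?_
      have h3 : 1 ≤ N ^ (k - 1 - 1) := Nat.one_le_pow _ _ hNpos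
      obtain ⟨j, rfl⟩ : ∃ j, k = j + 1 := ⟨k - 1, by omega⟩
      simp only [Nat.add_sub_cancel] at h3 ⊢
      nlinarith
    have h4 : (N : ℝ) ^ (k - 1) = N ^ (k - 1 - 1) * N := by
      rw [← pow_succ]
      congr 1
      omega
    rw [h4, mul_assoc, mul_div_cancel₀ _ hN0.ne', mul_comm]
    exact_mod_cast h2
  refine hmain.trans (add_le_add ?_ ?_)
  · rcases s.eq_empty_or_nonempty with he | ⟨p₀, hp₀⟩
    · rw [he, Finset.sum_empty]
      positivity
    have hU0 : 0 ≤ U := measureReal_nonneg.trans (hU p₀ hp₀)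
    have h1 : ∀ p ∈ s, ∑ q ∈ D p, μ.real (A p) * μ.real (A q) ≤
        (N : ℝ) ^ (k - 1) * (k ^ 2 / N) * (U * U) := by
      intro p hp
      have h2 : ∀ q ∈ D p, μ.real (A p) * μ.real (A q) ≤ U * U := fun q hq =>
        mul_le_mul (hU p hp) (hU q (Finset.filter_subset _ _ hq)) measureReal_nonneg hU0
      refine (Finset.sum_le_card_nsmul _ _ _ h2).trans ?_
      rw [nsmul_eq_mul]
      exact mul_le_mul_of_nonneg_right (hDcard p hp) (by positivity)
    refine (Finset.sum_le_card_nsmul _ _ _ h1).trans ?_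
    rw [nsmul_eq_mul]
    refine (mul_le_mul_of_nonneg_right hcards (by positivity)).trans (le_of_eq ?_)
    ring
  · set B : ℕ → ℝ := fun l =>
      (((2 * c / (2 * k - l : ℕ)) ^ (2 * k - l)) / 2 ^ l) ^ a * M ^ (2 * k - l) with hB
    have hB0 : ∀ l, 0 ≤ B l := fun l => by positivity
    have h1 : ∀ p ∈ s, ∑ q ∈ (D p).erase p, μ.real (A p ∩ A q) ≤
        ∑ l ∈ Finset.Ico 1 k,
          (((k - 1).choose l * ((k + 1) ^ l * N ^ (k - 1 - l)) : ℕ) : ℝ) * B l := by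
      intro p hp
      rw [herase p hp]
      -- Classify pairs by the exact overlap. It is smaller than `k`, since otherwise the edges of
      -- `q` would lie in `p` and the paths would coincide.
      have hmaps : ∀ q ∈ s.filter fun q => 1 ≤ (pathEdges p ∩ pathEdges q).card ∧ q ≠ p,
          (pathEdges p ∩ pathEdges q).card ∈ Finset.Ico 1 k := by
        intro q hq
        rw [Finset.mem_filter] at hq
        refine Finset.mem_Ico.2 ⟨hq.2.1, ?_⟩
        have h2 : (pathEdges p ∩ pathEdges q) ⊂ pathEdges q := by
          refine Finset.ssubset_iff_subset_ne.2 ⟨Finset.inter_subset_right, fun h => hq.2.2 ?_⟩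
          exact eq_of_pathEdges_subset (h ▸ Finset.inter_subset_left)
        have h3 := Finset.card_lt_card h2
        rwa [card_pathEdges q, mem_pathsOfLength.1 hq.1] at h3
      rw [← Finset.sum_fiberwise_of_maps_to hmaps]
      refine Finset.sum_le_sum fun l _ => ?_
      have h2 : ∀ q ∈ (s.filter fun q => 1 ≤ (pathEdges p ∩ pathEdges q).card ∧ q ≠ p).filter
          (fun q => (pathEdges p ∩ pathEdges q).card = l), μ.real (A p ∩ A q) ≤ B l := by
        intro q hq
        rw [Finset.mem_filter, Finset.mem_filter] at hq
        exact measureReal_inter_weightOf_le hY hind hpos ha hM hmom huv hc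
          (mem_pathsOfLength.1 hp) (mem_pathsOfLength.1 hq.1.1) hq.2
      refine (Finset.sum_le_card_nsmul _ _ _ h2).trans ?_
      rw [nsmul_eq_mul]
      refine mul_le_mul_of_nonneg_right ?_ (hB0 l)
      have h3 := card_overlap_le (l := l) (mem_pathsOfLength.1 hp)
      refine Nat.cast_le.2 (le_trans (Finset.card_le_card fun q hq => ?_) h3)
      rw [Finset.mem_filter, Finset.mem_filter] at hq
      exact Finset.mem_filter.2 ⟨hq.1.1, hq.2.ge, hq.1.2.2⟩
    refine (Finset.sum_le_card_nsmul _ _ _ h1).trans ?_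
    rw [nsmul_eq_mul]
    refine (mul_le_mul_of_nonneg_right hcards
      (Finset.sum_nonneg fun l _ => mul_nonneg (Nat.cast_nonneg _) (hB0 l))).trans ?_
    rw [Finset.mul_sum]
    refine Finset.sum_le_sum fun l hl => le_of_eq ?_
    have hl' := Finset.mem_Ico.1 hl
    have h5 : (N : ℝ) ^ (2 * k - 2 - l) = N ^ (k - 1) * N ^ (k - 1 - l) := by
      rw [← pow_add]
      congr 1
      omega
    rw [h5]
    push_cast
    ring

end WeightedCompleteGraph

/-! ### First moment and overlap estimates as `n` grows. -/

section EdgeModel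

/-- Independent positive edge weights on the complete graphs, with distribution function
`y ↦ G (y ^ (1 / s n))` on the `n`-th one. -/
structure IsEdgeModel {Ω : ℕ → Type*} [∀ n, MeasurableSpace (Ω n)] (μ : ∀ n, Measure (Ω n))
    (Y : ∀ n, (⊤ : SimpleGraph (Fin n)).edgeSet → Ω n → ℝ) (s : ℕ → ℝ) (G : ℝ → ℝ) : Prop where
  meas : ∀ n e, Measurable (Y n e)
  indep : ∀ n, iIndepFun (Y n) (μ n)
  pos : ∀ n e, ∀ᵐ ω ∂μ n, 0 < Y n e ω
  cdf : ∀ n e y, 0 < y → (μ n).real {ω | Y n e ω ≤ y} = G (y ^ (1 / s n))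

theorem tendsto_zero_of_mul_log {s : ℕ → ℝ} {γ : ℝ}
    (hsγ : Tendsto (fun n : ℕ => s n * Real.log n) atTop (𝓝 γ)) : Tendsto s atTop (𝓝 0) := by
  have hlog : Tendsto (fun n : ℕ => Real.log n) atTop atTop :=
    Real.tendsto_log_atTop.comp tendsto_natCast_atTop_atTop
  have h := hsγ.mul (tendsto_inv_atTop_zero.comp hlog)
  rw [mul_zero] at h
  refine h.congr' ?_
  filter_upwards [hlog.eventually_gt_atTop 0] with n hn
  simp only [Function.comp]
  field_simp

/-- Fixed powers of `K / s n` are `exp(o(1 / s n))`, so the moment constants do not affect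
exponential rates. -/
theorem tendsto_mul_log_div {s : ℕ → ℝ} (hs : ∀ n, 0 < s n) (hs0 : Tendsto s atTop (𝓝 0)) {K : ℝ}
    (hK : 0 < K) : Tendsto (fun n => s n * Real.log (K / s n)) atTop (𝓝 0) := by
  have h1 : Tendsto (fun n => s n * Real.log (s n)) atTop (𝓝 0) := by
    simpa [Function.comp_def] using (Real.continuous_mul_log.tendsto 0).comp hs0
  have h2 := (hs0.mul_const (Real.log K)).sub h1
  rw [zero_mul, sub_zero] at h2
  refine h2.congr fun n => ?_
  rw [Real.log_div hK.ne' (hs n).ne']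
  ring

variable {Ω : ℕ → Type*} [∀ n, MeasurableSpace (Ω n)] {μ : ∀ n, Measure (Ω n)}
  {Y : ∀ n, (⊤ : SimpleGraph (Fin n)).edgeSet → Ω n → ℝ} {s : ℕ → ℝ} {G : ℝ → ℝ} {γ C : ℝ}

variable [∀ n, IsProbabilityMeasure (μ n)]

theorem IsEdgeModel.lintegral_le (hY : IsEdgeModel μ Y s G) (hs : ∀ n, 0 < s n) (hC : 0 ≤ C)
    (hGC : ∀ x, 0 < x → G x ≤ C * x) {n : ℕ} (hn : s n < 1) (e) :
    ∫⁻ ω, ENNReal.ofReal (Y n e ω ^ (-((1 - s n) / s n))) ∂μ n ≤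
      ENNReal.ofReal ((1 + C) / s n) := by
  refine lintegral_neg_rpow_le (hY.meas n e) (hY.pos n e) hC (hs n) hn fun y hy => ?_
  rw [← ofReal_measureReal, hY.cdf n e y hy]
  exact ENNReal.ofReal_le_ofReal (hGC _ (Real.rpow_pos_of_pos hy _))

/-- Paths whose lengths `m` satisfy `g m > c` uniformly are heavier than `c`. -/
theorem IsEdgeModel.eventually_exists_weightOf_le (hY : IsEdgeModel μ Y s G) (hs : ∀ n, 0 < s n)
    (hγ : 0 ≤ γ) (hsγ : Tendsto (fun n : ℕ => s n * Real.log n) atTop (𝓝 γ)) (hC : 0 ≤ C)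
    (hGC : ∀ x, 0 < x → G x ≤ C * x) {c g₀ : ℝ} (hc : 0 < c) (hcg : c < g₀) {L : Set ℕ}
    (hL : ∀ m ∈ L, 1 ≤ m → g₀ ≤ gFun γ m) {ε : ℝ} (hε : 0 < ε) :
    ∀ᶠ n in atTop, ∀ u v : Fin n, u ≠ v →
      (μ n).real {ω | ∃ p : (⊤ : SimpleGraph (Fin n)).Path u v,
        p.1.length ∈ L ∧ weightOf (Y n) p ω ≤ c} ≤ ε := by
  have hs0 := tendsto_zero_of_mul_log hsγ
  -- Half of the logarithmic gap is reserved for errors; the other half remains as the decay rate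
  -- per edge.
  set δ := (Real.log g₀ - Real.log c) / 2 with hδ
  have hδ0 : 0 < δ := half_pos (sub_pos.2 (Real.log_lt_log hc hcg))
  have herr : Tendsto (fun n : ℕ => |s n * Real.log n - γ| + s n * γ + 2 * δ * s n +
      s n * Real.log ((1 + C) / s n)) atTop (𝓝 0) := by
    have h1 : Tendsto (fun n : ℕ => |s n * Real.log n - γ|) atTop (𝓝 0) := by
      simpa using (hsγ.sub_const γ).abs
    have h2 := ((h1.add (hs0.mul_const γ)).add (hs0.const_mul (2 * δ))).add
      (tendsto_mul_log_div hs hs0 (show 0 < 1 + C by linarith))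
    simpa using h2
  have hq : Tendsto (fun n => Real.exp (-(δ / s n))) atTop (𝓝 0) := by
    refine Real.tendsto_exp_neg_atTop_nhds_zero.comp ?_
    refine Tendsto.const_mul_atTop hδ0 (tendsto_inv_nhdsGT_zero.comp ?_)
    exact tendsto_nhdsWithin_iff.2 ⟨hs0, Eventually.of_forall hs⟩
  have hq2 : Tendsto (fun n => Real.exp (-(δ / s n)) / (1 - Real.exp (-(δ / s n)))) atTop
      (𝓝 0) := by
    simpa [Pi.div_def] using hq.div (hq.const_sub 1) (by norm_num)
  filter_upwards [herr.eventually (gt_mem_nhds hδ0), hs0.eventually (gt_mem_nhds one_pos),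
    hq2.eventually (gt_mem_nhds hε), eventually_ge_atTop 1] with n h1 h2 h3 hn u v huv
  refine le_trans ?_ h3.le
  have hsn := hs n
  have ha : 0 < (1 - s n) / s n := div_pos (by linarith) hsn
  refine measureReal_exists_weightOf_le (hY.meas n) (hY.indep n) (hY.pos n) ha
    (show 0 ≤ (1 + C) / s n by positivity) (hY.lintegral_le hs hC hGC h2) huv hc
    (Real.exp_pos _).le (Real.exp_lt_one_iff.2 (neg_lt_zero.2 (div_pos hδ0 hsn))) fun m hm hm1 => ?_
  rw [Fintype.card_fin]
  have hm0 : (0 : ℝ) < m := by exact_mod_cast hm1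
  have hn0 : (0 : ℝ) < n := by exact_mod_cast hn
  have hK : 0 < (1 + C) / s n := by positivity
  have hcm : 0 < c / m := by positivity
  rw [← Real.log_le_log_iff (by positivity) (by positivity), Real.log_mul (by positivity)
    (by positivity), Real.log_mul (by positivity) (by positivity), Real.log_pow, Real.log_rpow
    (by positivity), Real.log_pow, Real.log_pow, Real.log_pow, Real.log_exp]
  have hg : Real.log g₀ ≤ Real.log m - γ * (1 - 1 / m) := by
    rw [← log_gFun γ hm0]
    exact Real.log_le_log (hc.trans hcg) (hL m hm hm1)
  have hlc : Real.log (c / m) ≤ -(2 * δ) - γ * (1 - 1 / m) := by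
    rw [Real.log_div hc.ne' hm0.ne', hδ]
    linarith
  have hm2 : 0 ≤ 1 - 1 / (m : ℝ) := by
    rw [sub_nonneg, div_le_one hm0]
    exact_mod_cast hm1
  have hm3 : 1 - 1 / (m : ℝ) ≤ 1 := by
    have : 0 < 1 / (m : ℝ) := by positivity
    linarith
  -- The rate per edge, multiplied by `s n`. Since `0 ≤ 1 - 1/m ≤ 1`, the errors are controlled
  -- uniformly in the length `m`, as the geometric series requires.
  have key : (1 - 1 / (m : ℝ)) * (s n * Real.log n) + (1 - s n) * Real.log (c / m) +
      s n * Real.log ((1 + C) / s n) ≤ -δ := by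
    have e1 : (1 - s n) * Real.log (c / m) ≤ (1 - s n) * (-(2 * δ) - γ * (1 - 1 / m)) :=
      mul_le_mul_of_nonneg_left hlc (by linarith)
    have e2 : (1 - 1 / (m : ℝ)) * (s n * Real.log n - γ) ≤ |s n * Real.log n - γ| :=
      (mul_le_mul_of_nonneg_left (le_abs_self _) hm2).trans
        (mul_le_of_le_one_left (abs_nonneg _) hm3)
    have e3 : (1 - 1 / (m : ℝ)) * (s n * γ) ≤ s n * γ :=
      mul_le_of_le_one_left (by positivity) hm3
    nlinarith
  have hcast : ((m - 1 : ℕ) : ℝ) = m - 1 := by rw [Nat.cast_sub hm1, Nat.cast_one]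
  rw [hcast]
  have e4 : ((m : ℝ) - 1) * Real.log n + ((1 - s n) / s n * (m * Real.log (c / m)) +
      m * Real.log ((1 + C) / s n)) = m / s n * ((1 - 1 / (m : ℝ)) * (s n * Real.log n) +
      (1 - s n) * Real.log (c / m) + s n * Real.log ((1 + C) / s n)) := by
    field_simp
    ring
  have e5 : (m : ℝ) * -(δ / s n) = m / s n * -δ := by ring
  rw [e4, e5]
  exact mul_le_mul_of_nonneg_left key (by positivity)

/-- The logarithm of the term, times `s n`, converges to the rate in `overlap_rate_neg`; being
negative, it drives the logarithm to `-∞`. -/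
theorem tendsto_overlap_term (hs : ∀ n, 0 < s n)
    (hsγ : Tendsto (fun n : ℕ => s n * Real.log n) atTop (𝓝 γ)) {K : ℝ} (hK : 0 < K) {k l : ℕ}
    (hl : 1 ≤ l) (hlk : l < k) (hγk : gammaSeq (k - 1) ≤ γ) {c : ℕ → ℝ}
    (hc : Tendsto c atTop (𝓝 (gFun γ k))) :
    Tendsto (fun n : ℕ => (n : ℝ) ^ (2 * k - 2 - l) *
      ((((2 * c n / (2 * k - l : ℕ)) ^ (2 * k - l)) / 2 ^ l) ^ ((1 - s n) / s n) *
        (K / s n) ^ (2 * k - l))) atTop (𝓝 0) := by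
  have hs0 := tendsto_zero_of_mul_log hsγ
  have hk0 : (0 : ℝ) < k := by exact_mod_cast (by omega : 0 < k)
  have hg := gFun_pos γ hk0
  set m := 2 * k - l with hm
  have hm0 : (0 : ℝ) < m := by exact_mod_cast (by omega : 0 < m)
  have hrate := overlap_rate_neg hl hlk hγk
  rw [← hm] at hrate
  have hlogc : Tendsto (fun n => Real.log (2 * c n / m)) atTop
      (𝓝 (Real.log (2 * gFun γ k / m))) :=
    (Real.continuousAt_log (by positivity)).tendsto.comp ((hc.const_mul 2).div_const _)
  have hbr : Tendsto (fun n : ℕ => ((2 * k - 2 - l : ℕ) : ℝ) * (s n * Real.log n) +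
      (1 - s n) * (m * Real.log (2 * c n / m) - l * Real.log 2) +
      m * (s n * Real.log (K / s n))) atTop (𝓝 (((2 * k - 2 - l : ℕ) : ℝ) * γ +
        (1 - 0) * (m * Real.log (2 * gFun γ k / m) - l * Real.log 2) + m * 0)) :=
    ((hsγ.const_mul _).add ((hs0.const_sub 1).mul ((hlogc.const_mul _).sub_const _))).add
      ((tendsto_mul_log_div hs hs0 hK).const_mul _)
  have hneg : ((2 * k - 2 - l : ℕ) : ℝ) * γ +
      (1 - 0) * (m * Real.log (2 * gFun γ k / m) - l * Real.log 2) + m * 0 < 0 := by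
    linarith
  have hinv : Tendsto (fun n => (s n)⁻¹) atTop atTop :=
    tendsto_inv_nhdsGT_zero.comp (tendsto_nhdsWithin_iff.2 ⟨hs0, Eventually.of_forall hs⟩)
  refine (Real.tendsto_exp_atBot.comp (hinv.atTop_mul_neg hneg hbr)).congr' ?_
  filter_upwards [eventually_ge_atTop 1, hc.eventually (lt_mem_nhds hg)] with n hn hcn
  have hn0 : (0 : ℝ) < n := by exact_mod_cast hn
  have hsn := hs n
  have hpos : 0 < (2 * c n / m) ^ m / 2 ^ l := by positivity
  have hKs : 0 < K / s n := by positivity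
  have hlog : Real.log ((2 * c n / m) ^ m / 2 ^ l) =
      m * Real.log (2 * c n / m) - l * Real.log 2 := by
    rw [Real.log_div (by positivity) (by positivity), Real.log_pow, Real.log_pow]
  rw [Function.comp, ← Real.exp_log (show 0 < (n : ℝ) ^ (2 * k - 2 - l) *
      (((2 * c n / m) ^ m / 2 ^ l) ^ ((1 - s n) / s n) * (K / s n) ^ m) by positivity)]
  congr 1
  rw [Real.log_mul (by positivity) (by positivity), Real.log_mul (by positivity) (by positivity),
    Real.log_pow, Real.log_rpow hpos, Real.log_pow, hlog]
  field_simp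
  ring

end EdgeModel

/-! ### The critical window and the expected number of paths in it. -/

section CriticalWindow

/-- The relative correction in the critical window of the weight of paths with `k` edges. -/
noncomputable def windowShift (s : ℕ → ℝ) (γ : ℝ) (k : ℕ) (t : ℝ) (n : ℕ) : ℝ :=
  s n / k * (t - ((k : ℝ) - 1) / s n * (s n * Real.log n - γ - s n * Real.log (s n) / 2))

/-- The level of weights in the critical window of paths with `k` edges. -/
noncomputable def windowLevel (s : ℕ → ℝ) (γ lam : ℝ) (k : ℕ) (t : ℝ) (n : ℕ) : ℝ :=
  gFun γ k * (1 + windowShift s γ k t n) / lam ^ s n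

variable {s : ℕ → ℝ} {γ lam : ℝ} {k : ℕ}

theorem tendsto_sqrt_mul_log {s : ℕ → ℝ} (hs0 : Tendsto s atTop (𝓝 0)) :
    Tendsto (fun n => Real.sqrt (s n) * Real.log (s n)) atTop (𝓝 0) := by
  have h1 : Tendsto (fun n => Real.sqrt (s n)) atTop (𝓝 0) := by
    simpa [Function.comp_def] using (Real.continuous_sqrt.tendsto 0).comp hs0
  have h2 := ((Real.continuous_mul_log.tendsto 0).comp h1).const_mul 2
  simp only [zero_mul, mul_zero] at h2
  refine h2.congr fun n => ?_
  rcases le_or_gt (s n) 0 with h | h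
  · simp [Function.comp, Real.sqrt_eq_zero_of_nonpos h]
  · simp only [Function.comp, Real.log_sqrt h.le]
    ring

/-- The assumed rate enters here: as `s log n → γ > 0`, `(log n)^(-1/2)` is of order `√s`. The shift
is thus `o(√s)`, exactly what makes its square negligible after division by `s`. -/
theorem tendsto_windowShift_div_sqrt (hs : ∀ n, 0 < s n) (hγ : 0 < γ)
    (hsγ : Tendsto (fun n : ℕ => s n * Real.log n) atTop (𝓝 γ))
    (hrate : (fun n : ℕ => s n * Real.log n - γ) =o[atTop]
      (fun n : ℕ => Real.log n ^ (-(1 / 2) : ℝ))) (t : ℝ) :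
    Tendsto (fun n => windowShift s γ k t n / Real.sqrt (s n)) atTop (𝓝 0) := by
  have hs0 := tendsto_zero_of_mul_log hsγ
  have hlog : Tendsto (fun n : ℕ => Real.log n) atTop atTop :=
    Real.tendsto_log_atTop.comp tendsto_natCast_atTop_atTop
  have h1 : Tendsto (fun n => Real.sqrt (s n)) atTop (𝓝 0) := by
    simpa [Function.comp_def] using (Real.continuous_sqrt.tendsto 0).comp hs0
  have h2 : Tendsto (fun n : ℕ => (s n * Real.log n - γ) / Real.sqrt (s n)) atTop (𝓝 0) := by
    have h3 : Tendsto (fun n : ℕ => (Real.sqrt (s n * Real.log n))⁻¹) atTop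
        (𝓝 (Real.sqrt γ)⁻¹) :=
      ((Real.continuous_sqrt.tendsto γ).comp hsγ).inv₀ (Real.sqrt_pos.2 hγ).ne'
    have h4 := hrate.tendsto_div_nhds_zero.mul h3
    rw [zero_mul] at h4
    refine h4.congr' ?_
    filter_upwards [hlog.eventually_gt_atTop 0] with n hn
    have hsn := hs n
    rw [Real.rpow_neg hn.le, ← Real.sqrt_eq_rpow, Real.sqrt_mul hsn.le]
    have := Real.sqrt_pos.2 hn
    have := Real.sqrt_pos.2 hsn
    field_simp
  have h5 := (h1.mul_const (t / k)).sub (((h2.const_mul (((k : ℝ) - 1) / k))).sub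
    ((tendsto_sqrt_mul_log hs0).const_mul (((k : ℝ) - 1) / k / 2)))
  simp only [zero_mul, mul_zero, sub_zero] at h5
  refine h5.congr fun n => ?_
  have hsn := hs n
  have h6 := Real.sqrt_pos.2 hsn
  have h7 : s n = Real.sqrt (s n) * Real.sqrt (s n) := (Real.mul_self_sqrt hsn.le).symm
  rw [windowShift]
  generalize hr : Real.sqrt (s n) = r at *
  generalize Real.log (s n) = L1
  generalize Real.log n = L2
  rw [h7]
  field_simp

theorem tendsto_windowShift (hs : ∀ n, 0 < s n) (hγ : 0 < γ)
    (hsγ : Tendsto (fun n : ℕ => s n * Real.log n) atTop (𝓝 γ))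
    (hrate : (fun n : ℕ => s n * Real.log n - γ) =o[atTop]
      (fun n : ℕ => Real.log n ^ (-(1 / 2) : ℝ))) (t : ℝ) :
    Tendsto (windowShift s γ k t) atTop (𝓝 0) := by
  have hs0 := tendsto_zero_of_mul_log hsγ
  have h1 : Tendsto (fun n => Real.sqrt (s n)) atTop (𝓝 0) := by
    simpa [Function.comp_def] using (Real.continuous_sqrt.tendsto 0).comp hs0
  have h2 := (tendsto_windowShift_div_sqrt (k := k) hs hγ hsγ hrate t).mul h1
  rw [zero_mul] at h2
  refine h2.congr fun n => ?_
  have := Real.sqrt_pos.2 (hs n)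
  field_simp

theorem tendsto_windowLevel (hs : ∀ n, 0 < s n) (hγ : 0 < γ) (hlam : 0 < lam)
    (hsγ : Tendsto (fun n : ℕ => s n * Real.log n) atTop (𝓝 γ))
    (hrate : (fun n : ℕ => s n * Real.log n - γ) =o[atTop]
      (fun n : ℕ => Real.log n ^ (-(1 / 2) : ℝ))) (t : ℝ) :
    Tendsto (windowLevel s γ lam k t) atTop (𝓝 (gFun γ k)) := by
  have h1 : Tendsto (fun n => lam ^ s n) atTop (𝓝 (lam ^ (0 : ℝ))) :=
    ((Real.continuous_const_rpow hlam.ne').tendsto 0).comp (tendsto_zero_of_mul_log hsγ)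
  rw [Real.rpow_zero] at h1
  have h2 := (((tendsto_windowShift (k := k) hs hγ hsγ hrate t).const_add 1).const_mul
    (gFun γ k)).div h1 one_ne_zero
  rw [add_zero, mul_one, div_one] at h2
  exact h2

theorem abs_log_one_add_sub_le {x : ℝ} (hx : |x| ≤ 1 / 2) : |Real.log (1 + x) - x| ≤ 2 * x ^ 2 := by
  rw [abs_le] at hx
  have h0 : 0 < 1 + x := by linarith
  have h1 := Real.log_le_sub_one_of_pos h0
  have h2 := Real.one_sub_inv_le_log_of_pos h0
  have h3 : x - 2 * x ^ 2 ≤ 1 - (1 + x)⁻¹ := by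
    have e : 1 - (1 + x)⁻¹ = x / (1 + x) := by field_simp; ring
    rw [e, le_div_iff₀ h0]
    nlinarith [sq_nonneg x]
  rw [abs_le]
  constructor
  · linarith
  · nlinarith [sq_nonneg x]

/-- The expected number of paths with `k` edges and weight in the critical window. -/
theorem tendsto_pow_mul_dirichletTail (hk : 1 ≤ k) (hs : ∀ n, 0 < s n) (hγ : 0 < γ)
    (hlam : 0 < lam) (hsγ : Tendsto (fun n : ℕ => s n * Real.log n) atTop (𝓝 γ))
    (hrate : (fun n : ℕ => s n * Real.log n - γ) =o[atTop]
      (fun n : ℕ => Real.log n ^ (-(1 / 2) : ℝ))) (t : ℝ) :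
    Tendsto (fun n : ℕ => (n : ℝ) ^ (k - 1) * (lam ^ k *
      dirichletTail (1 / s n) k (windowLevel s γ lam k t n))) atTop
      (𝓝 (aConst k * Real.exp t)) := by
  have hs0 := tendsto_zero_of_mul_log hsγ
  have hk0 : (0 : ℝ) < k := by exact_mod_cast hk
  have hg := gFun_pos γ hk0
  have haC : 0 < aConst k := by
    have := Real.pi_pos
    unfold aConst
    positivity
  have hu := tendsto_windowShift (k := k) hs hγ hsγ hrate t
  have hinv : Tendsto (fun n => 1 / s n) atTop atTop := by
    simp_rw [one_div]
    exact tendsto_inv_nhdsGT_zero.comp (tendsto_nhdsWithin_iff.2 ⟨hs0, Eventually.of_forall hs⟩)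
  have hΓ := (tendsto_log_Gamma_ratio hk).comp hinv
  -- The level is raised to the power `k / s n`, so `log (1 + u)` may be replaced by `u` only up to
  -- an error of order `u² / s n`.
  have hcorr : Tendsto (fun n => k / s n * (Real.log (1 + windowShift s γ k t n) -
      windowShift s γ k t n)) atTop (𝓝 0) := by
    have h1 := ((tendsto_windowShift_div_sqrt (k := k) hs hγ hsγ hrate t).pow 2).const_mul
      (2 * (k : ℝ))
    rw [zero_pow two_ne_zero, mul_zero] at h1
    refine squeeze_zero_norm' ?_ h1
    have h2 : ∀ᶠ n in atTop, |windowShift s γ k t n| < 1 / 2 := by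
      have := hu.abs
      rw [abs_zero] at this
      exact this.eventually (gt_mem_nhds (by norm_num))
    filter_upwards [h2] with n hn
    have hsn := hs n
    rw [Real.norm_eq_abs, abs_mul, abs_of_pos (show 0 < k / s n by positivity), div_pow,
      Real.sq_sqrt hsn.le]
    refine (mul_le_mul_of_nonneg_left (abs_log_one_add_sub_le hn.le) (by positivity)).trans
      (le_of_eq ?_)
    ring
  have hmain := (hΓ.add hcorr).add_const t
  rw [add_zero] at hmain
  have hexp := (Real.continuous_exp.tendsto _).comp hmain
  rw [Real.exp_add, Real.exp_log haC] at hexp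
  refine hexp.congr' ?_
  filter_upwards [hu.eventually (lt_mem_nhds (show (-1 : ℝ) < 0 by norm_num)),
    eventually_ge_atTop 1] with n hun hn
  have hn0 : (0 : ℝ) < n := by exact_mod_cast hn
  have hsn := hs n
  have hu1 : 0 < 1 + windowShift s γ k t n := by linarith
  have hls : 0 < lam ^ s n := Real.rpow_pos_of_pos hlam _
  have hc : 0 < windowLevel s γ lam k t n := by
    unfold windowLevel
    positivity
  have g1 : 0 < Real.Gamma (1 / s n + 1) := Real.Gamma_pos_of_pos (by positivity)
  have g2 : 0 < Real.Gamma ((k : ℝ) * (1 / s n) + 1) := Real.Gamma_pos_of_pos (by positivity)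
  have hpos : 0 < (n : ℝ) ^ (k - 1) * (lam ^ k *
      dirichletTail (1 / s n) k (windowLevel s γ lam k t n)) := by
    unfold dirichletTail
    positivity
  rw [Function.comp, ← Real.exp_log hpos]
  congr 1
  -- With `log (1 + u)` split into `u` and the correction, the linear part cancels `(k-1) log n`,
  -- the term in `γ / s` and the logarithm left by Stirling's formula. The powers of `lam` cancel as
  -- well, and `t` remains.
  have hlogc : Real.log (windowLevel s γ lam k t n) = Real.log k - γ * (1 - 1 / k) +
      Real.log (1 + windowShift s γ k t n) - s n * Real.log lam := by
    rw [windowLevel, Real.log_div (by positivity) hls.ne', Real.log_mul hg.ne' hu1.ne',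
      log_gFun γ hk0, Real.log_rpow hlam]
  have hcast : ((k - 1 : ℕ) : ℝ) = k - 1 := by rw [Nat.cast_sub hk, Nat.cast_one]
  rw [Real.log_mul (by positivity) (by unfold dirichletTail; positivity), Real.log_pow,
    Real.log_mul (by positivity) (by unfold dirichletTail; positivity), Real.log_pow,
    dirichletTail, Real.log_mul (by positivity) (by positivity), Real.log_rpow hc, hlogc, hcast]
  simp only [Function.comp]
  rw [one_div, Real.log_inv]
  generalize Real.log (Real.Gamma ((s n)⁻¹ + 1) ^ k / Real.Gamma (k * (s n)⁻¹ + 1)) = A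
  generalize Real.log (1 + windowShift s γ k t n) = B
  rw [windowShift]
  generalize Real.log (s n) = C
  field_simp
  ring

end CriticalWindow

/-! ### Sharp tails of fixed-length paths and the Gumbel limit of their minimum. -/

section CriticalPaths

variable {Ω : ℕ → Type*} [∀ n, MeasurableSpace (Ω n)] {μ : ∀ n, Measure (Ω n)}
  {Y : ∀ n, (⊤ : SimpleGraph (Fin n)).edgeSet → Ω n → ℝ} {s : ℕ → ℝ} {G : ℝ → ℝ} {γ C lam : ℝ}
  [∀ n, IsProbabilityMeasure (μ n)] {k : ℕ}

/-- Sharp lower tail of the weight of a path with `k` edges. -/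
theorem IsEdgeModel.eventually_measureReal_weightOf_mem (hY : IsEdgeModel μ Y s G)
    (hs : ∀ n, 0 < s n) (hs0 : Tendsto s atTop (𝓝 0))
    (hG : Tendsto (fun x => G x / x) (𝓝[>] 0) (𝓝 lam)) (hlam : 0 < lam)
    {c : ℕ → ℝ} {g : ℝ} (hg0 : 0 < g) (hg1 : g < 1) (hc : Tendsto c atTop (𝓝 g)) {η : ℝ}
    (hη : 0 < η) (hη1 : η < 1) :
    ∀ᶠ n in atTop, ∀ u v : Fin n, u ≠ v → ∀ p ∈ pathsOfLength u v k,
      (μ n).real {ω | weightOf (Y n) p ω ≤ c n} ∈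
        Set.Icc (((1 - η) * lam) ^ k * dirichletTail (1 / s n) k (c n))
          (((1 + η) * lam) ^ k * dirichletTail (1 / s n) k (c n)) := by
  -- A level `c₀ < 1` keeps the argument of `G` below `c₀ ^ (1 / s n) → 0`, hence in the range where
  -- `G` is nearly linear.
  obtain ⟨c₀, hgc₀, hc₀1⟩ := exists_between hg1
  have hc₀0 : 0 < c₀ := hg0.trans hgc₀
  have hev : ∀ᶠ x in 𝓝[>] (0 : ℝ), G x / x ∈ Set.Ioo ((1 - η) * lam) ((1 + η) * lam) :=
    hG (Ioo_mem_nhds (by nlinarith) (by nlinarith))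
  obtain ⟨δ, hδ0, hδ⟩ := mem_nhdsGT_iff_exists_Ioo_subset.1 hev
  have hδ0' : (0 : ℝ) < δ := hδ0
  have hinv : Tendsto (fun n => 1 / s n) atTop atTop := by
    simp_rw [one_div]
    exact tendsto_inv_nhdsGT_zero.comp (tendsto_nhdsWithin_iff.2 ⟨hs0, Eventually.of_forall hs⟩)
  have hsmall : Tendsto (fun n => c₀ ^ (1 / s n)) atTop (𝓝 0) :=
    (tendsto_rpow_atTop_of_base_lt_one c₀ (by linarith) hc₀1).comp hinv
  filter_upwards [hsmall.eventually (gt_mem_nhds hδ0'), hc.eventually (gt_mem_nhds hgc₀),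
    hc.eventually (lt_mem_nhds hg0)] with n hn hcn hcn0 u v huv p hp
  have hsn := hs n
  have hp1 : 0 < 1 / s n := by positivity
  have hGb : ∀ y, 0 < y → y ≤ c₀ → (1 - η) * lam * y ^ (1 / s n) ≤ G (y ^ (1 / s n)) ∧
      G (y ^ (1 / s n)) ≤ (1 + η) * lam * y ^ (1 / s n) := by
    intro y hy hyc
    have hx : 0 < y ^ (1 / s n) := Real.rpow_pos_of_pos hy _
    have hxδ : y ^ (1 / s n) < δ :=
      (Real.rpow_le_rpow hy.le hyc hp1.le).trans_lt hn
    have h := hδ ⟨hx, hxδ⟩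
    exact ⟨(le_div_iff₀ hx).1 h.1.le, (div_le_iff₀ hx).1 h.2.le⟩
  have hcard := card_pathEdges p
  rw [mem_pathsOfLength.1 hp] at hcard
  have hdir := dirichletTail_nonneg hp1 k hcn0.le
  have hb1 : 0 ≤ (1 - η) * lam := mul_nonneg (by linarith) hlam.le
  have hb2 : 0 ≤ (1 + η) * lam := mul_nonneg (by linarith) hlam.le
  constructor
  · have h := dirichletTail_le_measure_sum (hY.meas n) (hY.indep n) (hY.pos n) hp1
      (b := (1 - η) * lam) (c₀ := c₀) hb1
      (fun e y hy hyc => ?_) (pathEdges_nonempty huv p) hcn0 hcn.le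
    · rw [hcard] at h
      rw [Measure.real, ← ENNReal.ofReal_le_iff_le_toReal (measure_ne_top _ _)]
      exact h
    · rw [← ofReal_measureReal, hY.cdf n e y hy]
      exact ENNReal.ofReal_le_ofReal (hGb y hy hyc).1
  · have h := measure_sum_le_dirichletTail (hY.meas n) (hY.indep n) (hY.pos n) hp1
      (b := (1 + η) * lam) (c₀ := c₀) hb2
      (fun e y hy hyc => ?_) (pathEdges_nonempty huv p) hcn0 hcn.le
    · rw [hcard] at h
      exact ENNReal.toReal_le_of_le_ofReal (by positivity) h
    · rw [← ofReal_measureReal, hY.cdf n e y hy]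
      exact ENNReal.ofReal_le_ofReal (hGb y hy hyc).2

/-- The minimal weight of the paths with `k` edges has Gumbel type fluctuations in the critical
window. -/
theorem IsEdgeModel.eventually_abs_forall_lt_weightOf_sub_le (hY : IsEdgeModel μ Y s G)
    (hs : ∀ n, 0 < s n) (hγ : 0 < γ)
    (hsγ : Tendsto (fun n : ℕ => s n * Real.log n) atTop (𝓝 γ))
    (hrate : (fun n : ℕ => s n * Real.log n - γ) =o[atTop]
      (fun n : ℕ => Real.log n ^ (-(1 / 2) : ℝ)))
    (hC : 0 ≤ C) (hGC : ∀ x, 0 < x → G x ≤ C * x)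
    (hG : Tendsto (fun x => G x / x) (𝓝[>] 0) (𝓝 lam)) (hlam : 0 < lam) (hk : 2 ≤ k)
    (hγk : gammaSeq (k - 1) ≤ γ) (hg1 : gFun γ k < 1) (t : ℝ) {ε : ℝ} (hε : 0 < ε) :
    ∀ᶠ n in atTop, ∀ u v : Fin n, u ≠ v →
      |(μ n).real {ω | ∀ p ∈ pathsOfLength u v k, windowLevel s γ lam k t n < weightOf (Y n) p ω} -
        Real.exp (-(aConst k * Real.exp t))| ≤ ε := by
  have hs0 := tendsto_zero_of_mul_log hsγ
  have hk0 : (0 : ℝ) < k := by exact_mod_cast (by omega : 0 < k)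
  have hg0 := gFun_pos γ hk0
  have hc := tendsto_windowLevel (k := k) hs hγ hlam hsγ hrate t
  set c := windowLevel s γ lam k t with hcdef
  set m := aConst k * Real.exp t with hm
  have hE := tendsto_pow_mul_dirichletTail (by omega : 1 ≤ k) hs hγ hlam hsγ hrate t
  rw [← hcdef, ← hm] at hE
  set E : ℕ → ℝ := fun n =>
    (n : ℝ) ^ (k - 1) * (lam ^ k * dirichletTail (1 / s n) k (c n)) with hEdef
  -- choice of the precision
  have hcont : ∀ σ : ℝ, Tendsto (fun η : ℝ => Real.exp (-((1 + σ * η) ^ k * m))) (𝓝[>] 0)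
      (𝓝 (Real.exp (-m))) := by
    intro σ
    have h : Continuous fun η : ℝ => Real.exp (-((1 + σ * η) ^ k * m)) := by fun_prop
    have h2 := h.tendsto 0
    simp only [mul_zero, add_zero, one_pow, one_mul] at h2
    exact h2.mono_left nhdsWithin_le_nhds
  obtain ⟨η, ⟨hη1, hη2⟩, hη0, hηlt⟩ :=
    ((((hcont 1).eventually (lt_mem_nhds (show Real.exp (-m) - ε < Real.exp (-m) by linarith))).and
      ((hcont (-1)).eventually (gt_mem_nhds (show Real.exp (-m) < Real.exp (-m) + ε by
        linarith)))).and (Ioo_mem_nhdsGT (show (0 : ℝ) < 1 by norm_num))).exists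
  rw [one_mul] at hη1
  have hratio : Tendsto (fun n : ℕ => (((n - k : ℕ) : ℝ) / n) ^ (k - 1)) atTop (𝓝 1) := by
    have h1 : Tendsto (fun n : ℕ => 1 - (k : ℝ) / n) atTop (𝓝 (1 - 0)) :=
      (tendsto_const_div_atTop_nhds_zero_nat (k : ℝ)).const_sub 1
    have h2 : Tendsto (fun n : ℕ => ((n - k : ℕ) : ℝ) / n) atTop (𝓝 (1 - 0)) := by
      refine h1.congr' ?_
      filter_upwards [eventually_ge_atTop k, eventually_ge_atTop 1] with n hn hn1
      have hn0 : (0 : ℝ) < n := by exact_mod_cast hn1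
      rw [Nat.cast_sub hn]
      field_simp
    simpa using h2.pow (k - 1)
  -- The total error of the Poisson approximation: a bounded squared mean times `k² / n`, plus
  -- finitely many overlap terms.
  have hR : Tendsto (fun n : ℕ => ((1 + η) ^ k * E n) ^ 2 * ((k : ℝ) ^ 2 / n) +
      ∑ l ∈ Finset.Ico 1 k, ((k - 1).choose l * (k + 1) ^ l : ℕ) *
          ((n : ℝ) ^ (2 * k - 2 - l) *
            ((((2 * c n / (2 * k - l : ℕ)) ^ (2 * k - l)) / 2 ^ l) ^ ((1 - s n) / s n) *
              ((1 + C) / s n) ^ (2 * k - l)))) atTop (𝓝 0) := by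
    have h1 := ((hE.const_mul ((1 + η) ^ k)).pow 2).mul
      (tendsto_const_div_atTop_nhds_zero_nat ((k : ℝ) ^ 2))
    have h2 : Tendsto (fun n : ℕ => ∑ l ∈ Finset.Ico 1 k, ((k - 1).choose l * (k + 1) ^ l : ℕ) *
          ((n : ℝ) ^ (2 * k - 2 - l) *
            ((((2 * c n / (2 * k - l : ℕ)) ^ (2 * k - l)) / 2 ^ l) ^ ((1 - s n) / s n) *
              ((1 + C) / s n) ^ (2 * k - l)))) atTop (𝓝 (∑ l ∈ Finset.Ico 1 k,
                (((k - 1).choose l * (k + 1) ^ l : ℕ) : ℝ) * 0)) := by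
      refine tendsto_finsetSum _ fun l hl => Tendsto.const_mul _ ?_
      exact tendsto_overlap_term hs hsγ (by linarith) (Finset.mem_Ico.1 hl).1
        (Finset.mem_Ico.1 hl).2 hγk hc
    simpa using h1.add h2
  -- The mean is trapped using the counts `(n-k)^(k-1)` and `n^(k-1)` and the tail factors `(1 ±
  -- η)^k`; a larger mean gives the lower bound on the void probability.
  have hup := ((Real.continuous_exp.tendsto _).comp (hE.const_mul ((1 + η) ^ k)).neg).sub hR
  have hlow := ((Real.continuous_exp.tendsto _).comp
    ((hratio.mul (hE.const_mul ((1 - η) ^ k)))).neg).add hR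
  rw [sub_zero] at hup
  rw [add_zero, one_mul] at hlow
  have hη2' : Real.exp (-((1 - η) ^ k * m)) < Real.exp (-m) + ε := by
    rwa [neg_one_mul, ← sub_eq_add_neg] at hη2
  filter_upwards [hY.eventually_measureReal_weightOf_mem hs hs0 hG hlam hg0 hg1
    hc hη0 hηlt, hup.eventually (lt_mem_nhds hη1), hlow.eventually (gt_mem_nhds hη2'),
    hs0.eventually (gt_mem_nhds one_pos), hc.eventually (lt_mem_nhds hg0), eventually_ge_atTop k]
    with n h1 h2 h3 hsn1 hcn hnk u v huv
  have hsn := hs n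
  have hn0 : (0 : ℝ) < n := by exact_mod_cast (by omega : 0 < n)
  have hdir := dirichletTail_nonneg (show 0 < 1 / s n by positivity) k hcn.le
  have hmain := abs_measureReal_forall_lt_weightOf_sub_exp_le (hY.meas n) (hY.indep n) (hY.pos n)
    (div_pos (by linarith) hsn : 0 < (1 - s n) / s n)
    (show 0 ≤ (1 + C) / s n by positivity) (hY.lintegral_le hs hC hGC hsn1) huv hcn hk
    (fun p hp => (h1 u v huv p hp).2)
  rw [Fintype.card_fin] at hmain
  have hEU : (n : ℝ) ^ (k - 1) * (((1 + η) * lam) ^ k * dirichletTail (1 / s n) k (c n)) =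
      (1 + η) ^ k * E n := by
    rw [hEdef, mul_pow]
    ring
  rw [hEU] at hmain
  have hcard1 : ((pathsOfLength u v k).card : ℝ) ≤ (n : ℝ) ^ (k - 1) := by
    have := card_pathsOfLength_le (u := u) (v := v) k
    rw [Fintype.card_fin] at this
    exact_mod_cast this
  have hcard2 : ((n - k : ℕ) : ℝ) ^ (k - 1) ≤ (pathsOfLength u v k).card := by
    have := le_card_pathsOfLength huv (by omega : 1 ≤ k) (by rwa [Fintype.card_fin])
    rw [Fintype.card_fin] at this
    exact_mod_cast this
  have hS1 : ∑ p ∈ pathsOfLength u v k, (μ n).real {ω | weightOf (Y n) p ω ≤ c n} ≤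
      (1 + η) ^ k * E n := by
    refine (Finset.sum_le_card_nsmul _ _ _ fun p hp => (h1 u v huv p hp).2).trans ?_
    rw [nsmul_eq_mul, ← hEU]
    exact mul_le_mul_of_nonneg_right hcard1 (by positivity)
  have hS2 : (((n - k : ℕ) : ℝ) / n) ^ (k - 1) * ((1 - η) ^ k * E n) ≤
      ∑ p ∈ pathsOfLength u v k, (μ n).real {ω | weightOf (Y n) p ω ≤ c n} := by
    refine le_trans ?_ (Finset.card_nsmul_le_sum _ _ _ fun p hp => (h1 u v huv p hp).1)
    rw [nsmul_eq_mul]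
    have h4 : (((n - k : ℕ) : ℝ) / n) ^ (k - 1) * ((1 - η) ^ k * E n) =
        ((n - k : ℕ) : ℝ) ^ (k - 1) *
          (((1 - η) * lam) ^ k * dirichletTail (1 / s n) k (c n)) := by
      rw [hEdef, mul_pow, div_pow]
      field_simp
    rw [h4]
    have : 0 ≤ 1 - η := by linarith
    exact mul_le_mul_of_nonneg_right hcard2 (by positivity)
  have h5 := Real.exp_le_exp.2 (neg_le_neg hS1)
  have h6 := Real.exp_le_exp.2 (neg_le_neg hS2)
  simp only [Function.comp] at h2 h3
  rw [abs_le] at hmain ⊢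
  constructor <;> linarith [hmain.1, hmain.2]

end CriticalPaths

/-! ### Optimal paths in a finite weighted complete graph. -/

section OptimalPath

variable {V : Type*} {w : Sym2 V → ℝ} {u v : V}

theorem exists_isOptimalPath [Finite V] (w : Sym2 V → ℝ) (u v : V) :
    ∃ p : (⊤ : SimpleGraph V).Path u v, IsOptimalPath w p := by
  classical
  have := Fintype.ofFinite V
  have : Nonempty ((⊤ : SimpleGraph V).Path u v) := by
    have : Nonempty V := ⟨u⟩
    obtain ⟨p⟩ := (SimpleGraph.connected_top (V := V)).preconnected u v
    exact ⟨p.toPath⟩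
  exact Finite.exists_min (pathWeight w)

theorem IsOptimalPath.optimalWeight_eq {p : (⊤ : SimpleGraph V).Path u v}
    (hp : IsOptimalPath w p) : optimalWeight w u v = pathWeight w p := by
  have : Nonempty ((⊤ : SimpleGraph V).Path u v) := ⟨p⟩
  exact le_antisymm (ciInf_le ⟨pathWeight w p, by rintro _ ⟨q, rfl⟩; exact hp q⟩ p)
    (le_ciInf hp)

theorem IsOptimalPath.optimalLength_eq {p : (⊤ : SimpleGraph V).Path u v}
    (hp : IsOptimalPath w p)
    (huniq : ∀ q : (⊤ : SimpleGraph V).Path u v, IsOptimalPath w q → q = p) :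
    optimalLength w u v = p.1.length := by
  have h : ∃! p : (⊤ : SimpleGraph V).Path u v, IsOptimalPath w p := ⟨p, hp, huniq⟩
  rw [optimalLength, dif_pos h, huniq _ h.exists.choose_spec]

end OptimalPath

/-! ### Paths with a single edge. -/

section DirectEdge

variable {V : Type*} {u v : V} {Ω : Type*}

/-- The edge `uv` of the complete graph. -/
def directEdge (huv : u ≠ v) : (⊤ : SimpleGraph V).edgeSet :=
  ⟨s(u, v), by simpa using huv⟩

theorem weightOf_eq_directEdge [DecidableEq V] (huv : u ≠ v)
    (Y : (⊤ : SimpleGraph V).edgeSet → Ω → ℝ)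
    {p : (⊤ : SimpleGraph V).Path u v} (hp : p.1.length = 1) (ω : Ω) :
    weightOf Y p ω = Y (directEdge huv) ω := by
  have h : pathEdges p = {directEdge huv} := by
    obtain ⟨p, hp'⟩ := p
    ext e
    rw [mem_pathEdges, Finset.mem_singleton, Subtype.ext_iff]
    cases p with
    | nil => exact absurd rfl huv
    | cons h q =>
      cases q with
      | nil => simp [directEdge]
      | cons h q => simp at hp
  rw [weightOf, h, Finset.sum_singleton]

theorem exists_path_length_eq_one (huv : u ≠ v) :
    ∃ p : (⊤ : SimpleGraph V).Path u v, p.1.length = 1 := by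
  have h : (⊤ : SimpleGraph V).Adj u v := by simpa using huv
  exact ⟨SimpleGraph.Path.singleton h, by simp [SimpleGraph.Path.singleton]⟩

end DirectEdge

/-! ### Properties of the distribution function `G`. -/

section DistributionFunction

variable {Ω : Type*} [MeasurableSpace Ω] {P : Measure Ω} [IsProbabilityMeasure P] {Z : Ω → ℝ}
  {F : ℝ → ℝ}

theorem measureReal_lt_eq_of_continuous_cdf (hF : ∀ x, P.real {ω | Z ω ≤ x} = F x)
    (hFc : Continuous F) (x : ℝ) : P.real {ω | Z ω < x} = F x := by
  refine le_antisymm ?_ ?_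
  · rw [← hF]
    exact measureReal_mono fun ω (h : Z ω < x) => h.le
  · refine le_of_tendsto ((hFc.tendsto x).mono_left nhdsWithin_le_nhds : Tendsto F (𝓝[<] x) _) ?_
    filter_upwards [self_mem_nhdsWithin] with y hy
    rw [← hF]
    exact measureReal_mono fun ω (h : Z ω ≤ y) => lt_of_le_of_lt h hy

theorem measure_eq_zero_of_continuous_cdf (hZ : AEMeasurable Z P)
    (hF : ∀ x, P.real {ω | Z ω ≤ x} = F x) (hFc : Continuous F) (x : ℝ) :
    P {ω | Z ω = x} = 0 := by
  have h1 : {ω | Z ω = x} = {ω | Z ω ≤ x} \ {ω | Z ω < x} := by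
    ext ω
    simp [le_antisymm_iff]
  have h2 : {ω | Z ω < x} ⊆ {ω | Z ω ≤ x} := fun ω (h : Z ω < x) => h.le
  rw [h1, measure_sdiff h2
    (nullMeasurableSet_lt hZ aemeasurable_const) (measure_ne_top _ _), ← ofReal_measureReal,
    ← ofReal_measureReal, hF, measureReal_lt_eq_of_continuous_cdf hF hFc, tsub_self]

theorem tendsto_atTop_one_of_cdf (hF : ∀ x, P.real {ω | Z ω ≤ x} = F x)
    (hZ : AEMeasurable Z P) : Tendsto F atTop (𝓝 1) := by
  have := Measure.isProbabilityMeasure_map hZ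
  refine (tendsto_cdf_atTop (P.map Z)).congr fun x => ?_
  rw [cdf_eq_real, map_measureReal_apply_of_aemeasurable hZ measurableSet_Iic, ← hF]
  rfl

theorem cdf_zero_of_pos (hZpos : ∀ᵐ ω ∂P, 0 < Z ω) (hF : ∀ x, P.real {ω | Z ω ≤ x} = F x) :
    F 0 = 0 := by
  rw [← hF, measureReal_eq_zero_iff]
  exact measure_mono_null (fun ω (h : Z ω ≤ 0) => not_lt.2 h) hZpos

theorem tendsto_div_of_hasDerivWithinAt {lam : ℝ} (hF0 : F 0 = 0)
    (hlam : HasDerivWithinAt F lam (Set.Ici 0) 0) :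
    Tendsto (fun x => F x / x) (𝓝[>] 0) (𝓝 lam) := by
  have h := hasDerivWithinAt_iff_tendsto_slope.1 hlam
  rw [Set.Ici_sdiff_left] at h
  refine h.congr fun x => ?_
  rw [slope_def_field, hF0, sub_zero, sub_zero]

/-- Near zero the derivative controls the ratio; away from zero the bound `F ≤ 1` suffices. The
resulting global linear bound feeds the moment estimate, which uses all levels. -/
theorem exists_le_mul_of_tendsto_div {lam : ℝ} (hF1 : ∀ x, F x ≤ 1)
    (h : Tendsto (fun x => F x / x) (𝓝[>] 0) (𝓝 lam)) :
    ∃ C, 0 ≤ C ∧ ∀ x, 0 < x → F x ≤ C * x := by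
  obtain ⟨δ, hδ, h1⟩ := mem_nhdsGT_iff_exists_Ioo_subset.1
    (h.eventually (gt_mem_nhds (lt_add_one lam)))
  have hδ : 0 < δ := hδ
  refine ⟨max (|lam + 1|) (1 / δ), le_max_of_le_left (abs_nonneg _), fun x hx => ?_⟩
  rcases lt_or_ge x δ with hxδ | hxδ
  · have h2 : F x / x < lam + 1 := h1 ⟨hx, hxδ⟩
    rw [div_lt_iff₀ hx] at h2
    refine h2.le.trans ?_
    gcongr
    exact (le_abs_self _).trans (le_max_left _ _)
  · calc F x ≤ 1 := hF1 x
      _ = 1 / δ * δ := by field_simp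
      _ ≤ _ := by
        gcongr
        exact le_max_right _ _

end DistributionFunction

/-! ### From the given weights to measurable edge weights with a unique geodesic. -/

section Geodesics

/-- On the `n`-th complete graph, `W n` and `H n` are almost surely the weight and the number of
edges of a lightest path between two distinct vertices. -/
def IsGeodesicModel {Ω : ℕ → Type*} [∀ n, MeasurableSpace (Ω n)] (μ : ∀ n, Measure (Ω n))
    (Y : ∀ n, (⊤ : SimpleGraph (Fin n)).edgeSet → Ω n → ℝ) (W : ∀ n, Ω n → ℝ)
    (H : ∀ n, Ω n → ℕ) : Prop :=
  ∀ n, 2 ≤ n → ∃ u v : Fin n, u ≠ v ∧ ∀ᵐ ω ∂μ n, ∃ p : (⊤ : SimpleGraph (Fin n)).Path u v,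
    W n ω = weightOf (Y n) p ω ∧ H n ω = p.1.length ∧
      ∀ q : (⊤ : SimpleGraph (Fin n)).Path u v, weightOf (Y n) p ω ≤ weightOf (Y n) q ω

/-- Replace each non-loop weight by a measurable version; independence and the law survive, and
positivity and atomlessness transfer from `Z` since `z ↦ z ^ s` is a bijection of the positive
reals. -/
theorem exists_isEdgeModel {Ω₀ : Type*} [MeasurableSpace Ω₀] {P₀ : Measure Ω₀}
    [IsProbabilityMeasure P₀] {Z : Ω₀ → ℝ} (hZ : AEMeasurable Z P₀) (hZpos : ∀ᵐ ω ∂P₀, 0 < Z ω)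
    {G : ℝ → ℝ} (hG : ∀ x, P₀.real {ω | Z ω ≤ x} = G x) (hGcont : Continuous G)
    {s : ℕ → ℝ} (hs : ∀ n, 0 < s n)
    {Ω : ℕ → Type*} [∀ n, MeasurableSpace (Ω n)] {P : ∀ n, Measure (Ω n)}
    [∀ n, IsProbabilityMeasure (P n)] {X : ∀ n, Sym2 (Fin n) → Ω n → ℝ}
    (hX : ∀ n, IsIIDEdgeWeights (X n) (P n) (fun ω => Z ω ^ s n) P₀) :
    ∃ Y : ∀ n, (⊤ : SimpleGraph (Fin n)).edgeSet → Ω n → ℝ, IsEdgeModel P Y s G ∧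
      (∀ n e x, P n {ω | Y n e ω = x} = 0) ∧
      ∀ n (e : (⊤ : SimpleGraph (Fin n)).edgeSet), X n e =ᵐ[P n] Y n e := by
  have hm : ∀ n (e : (⊤ : SimpleGraph (Fin n)).edgeSet), AEMeasurable (X n e) (P n) :=
    fun n e => ((hX n).2 e e.2).aemeasurable_fst
  have hid : ∀ n (e : (⊤ : SimpleGraph (Fin n)).edgeSet),
      IdentDistrib ((hm n e).mk _) (fun ω => Z ω ^ s n) (P n) P₀ := fun n e =>
    (IdentDistrib.of_ae_eq (hm n e).measurable_mk.aemeasurable (hm n e).ae_eq_mk.symm).trans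
      ((hX n).2 e e.2)
  refine ⟨fun n e => (hm n e).mk _, ⟨fun n e => (hm n e).measurable_mk, fun n => ?_, fun n e => ?_,
    fun n e y hy => ?_⟩, fun n e x => ?_, fun n e => (hm n e).ae_eq_mk⟩
  · exact (iIndepFun_congr fun e => (hm n e).ae_eq_mk).1 (hX n).1
  · refine (hid n e).symm.ae_mem_snd measurableSet_Ioi ?_
    filter_upwards [hZpos] with ω hω using Real.rpow_pos_of_pos hω _
  · have h := (hid n e).measure_mem_eq (measurableSet_Iic (a := y))
    rw [← hG, measureReal_def, measureReal_def]
    congr 1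
    refine h.trans (measure_congr ?_)
    filter_upwards [hZpos] with ω hω
    refine propext ?_
    change Z ω ^ s n ≤ y ↔ Z ω ≤ y ^ (1 / s n)
    rw [one_div, Real.le_rpow_inv_iff_of_pos hω.le hy.le (hs n)]
  · refine ((hid n e).measure_mem_eq (measurableSet_singleton x)).trans ?_
    have h := measure_eq_zero_of_continuous_cdf hZ hG hGcont (x ^ (s n)⁻¹)
    refine le_antisymm ((measure_mono_ae ?_).trans h.le) bot_le
    filter_upwards [hZpos] with ω hω (hx : Z ω ^ s n = x)
    change Z ω = x ^ (s n)⁻¹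
    rw [← hx, Real.rpow_rpow_inv hω.le (hs n).ne']

variable {Ω : ℕ → Type*} [∀ n, MeasurableSpace (Ω n)] {P : ∀ n, Measure (Ω n)}
    [∀ n, IsProbabilityMeasure (P n)] {X : ∀ n, Sym2 (Fin n) → Ω n → ℝ}
    {Y : ∀ n, (⊤ : SimpleGraph (Fin n)).edgeSet → Ω n → ℝ}
    {W : ∀ n, Ω n → ℝ} {H : ∀ n, Ω n → ℕ}

/-- Almost surely no two paths tie, so `optimalLength` takes its meaningful branch rather than the
default `0`. -/
theorem isGeodesicModel (hYm : ∀ n e, Measurable (Y n e)) (hYi : ∀ n, iIndepFun (Y n) (P n))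
    (hatom : ∀ n e x, P n {ω | Y n e ω = x} = 0)
    (hXY : ∀ n (e : (⊤ : SimpleGraph (Fin n)).edgeSet), X n e =ᵐ[P n] Y n e)
    (hW : ∀ n ω, W n ω = fppWeight n (fun e => X n e ω))
    (hH : ∀ n ω, H n ω = fppHopcount n (fun e => X n e ω)) : IsGeodesicModel P Y W H := by
  intro n hn
  have huv : (⟨0, by omega⟩ : Fin n) ≠ ⟨1, by omega⟩ := by simp
  refine ⟨⟨0, by omega⟩, ⟨1, by omega⟩, huv, ?_⟩
  have hall : ∀ᵐ ω ∂P n, ∀ e : (⊤ : SimpleGraph (Fin n)).edgeSet, X n e ω = Y n e ω :=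
    ae_all_iff.2 fun e => hXY n e
  filter_upwards [hall, ae_optimal_unique (u := ⟨0, by omega⟩) (v := ⟨1, by omega⟩) (hYm n) (hYi n)
    (hatom n)] with ω h1 h2
  have hwt : ∀ p : (⊤ : SimpleGraph (Fin n)).Path ⟨0, by omega⟩ ⟨1, by omega⟩,
      pathWeight (fun e => X n e ω) p = weightOf (Y n) p ω := fun p => by
    rw [pathWeight_eq_sum]
    exact Finset.sum_congr rfl fun e _ => h1 e
  obtain ⟨p, hp⟩ := exists_isOptimalPath (fun e => X n e ω) (⟨0, by omega⟩ : Fin n) ⟨1, by omega⟩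
  refine ⟨p, ?_, ?_, fun q => ?_⟩
  · rw [hW, fppWeight, dif_pos hn, hp.optimalWeight_eq, hwt]
  · rw [hH, fppHopcount, dif_pos hn, hp.optimalLength_eq]
    intro q hq
    refine h2 _ _ ?_
    rw [← hwt, ← hwt]
    exact le_antisymm (hq p) (hp q)
  · rw [← hwt, ← hwt]
    exact hp q

theorem aemeasurable_fppWeight {n : ℕ} {Ω : Type*} [MeasurableSpace Ω] {P : Measure Ω}
    {X : Sym2 (Fin n) → Ω → ℝ}
    (hX : ∀ e ∈ (⊤ : SimpleGraph (Fin n)).edgeSet, AEMeasurable (X e) P) :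
    AEMeasurable (fun ω => fppWeight n fun e => X e ω) P := by
  unfold fppWeight
  split_ifs with hn
  · refine AEMeasurable.iInf fun p => ?_
    simp_rw [pathWeight_eq_sum]
    exact Finset.aemeasurable_fun_sum _ fun e _ => hX e e.2
  · exact aemeasurable_const

end Geodesics

/-! ### Concentration of weight and hopcount, and limits of distribution functions. -/

section Concentration

theorem measureReal_le_of_ae_imp {Ω : Type*} [MeasurableSpace Ω] {μ : Measure Ω}
    [IsFiniteMeasure μ] {p q : Ω → Prop} (h : ∀ᵐ ω ∂μ, p ω → q ω) :
    μ.real {ω | p ω} ≤ μ.real {ω | q ω} :=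
  ENNReal.toReal_mono (measure_ne_top _ _) (measure_mono_ae h)

theorem measureReal_le_add_of_ae_imp {Ω : Type*} [MeasurableSpace Ω] {μ : Measure Ω}
    [IsFiniteMeasure μ] {p q r : Ω → Prop} (h : ∀ᵐ ω ∂μ, p ω → q ω ∨ r ω) :
    μ.real {ω | p ω} ≤ μ.real {ω | q ω} + μ.real {ω | r ω} :=
  (measureReal_le_of_ae_imp h).trans (measureReal_union_le _ _)

variable {Ω : ℕ → Type*} [∀ n, MeasurableSpace (Ω n)] {μ : ∀ n, Measure (Ω n)}
  [∀ n, IsProbabilityMeasure (μ n)]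

theorem tendsto_measure_one {p q : ∀ n, Ω n → Prop}
    (h : ∀ ε : ℝ, 0 < ε → ∀ᶠ n in atTop, (μ n).real {ω | q n ω} ≤ ε)
    (hpq : ∀ᶠ n in atTop, ∀ᵐ ω ∂μ n, p n ω ∨ q n ω) :
    Tendsto (fun n => μ n {ω | p n ω}) atTop (𝓝 1) := by
  have h1 : Tendsto (fun n => (μ n).real {ω | p n ω}) atTop (𝓝 1) := by
    refine tendsto_order.2 ⟨fun a ha => ?_, fun a ha =>
      Eventually.of_forall fun n => measureReal_le_one.trans_lt ha⟩
    filter_upwards [h ((1 - a) / 2) (by linarith), hpq] with n hn hn'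
    have h2 := measureReal_le_add_of_ae_imp (p := fun _ => True) (hn'.mono fun ω h _ => h)
    have h3 : (μ n).real {_ω | True} = 1 := by simp
    linarith
  have h2 := ENNReal.tendsto_ofReal h1
  simpa using h2

theorem tendstoInProbConst_of_eventually_le {W : ∀ n, Ω n → ℝ} {a : ℝ}
    (hlow : ∀ c < a, ∀ ε : ℝ, 0 < ε → ∀ᶠ n in atTop, (μ n).real {ω | W n ω ≤ c} ≤ ε)
    (hupp : ∀ c > a, ∀ ε : ℝ, 0 < ε → ∀ᶠ n in atTop, (μ n).real {ω | c < W n ω} ≤ ε) :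
    TendstoInProbConst W μ a := by
  intro δ hδ
  have h1 : Tendsto (fun n => (μ n).real {ω | δ ≤ |W n ω - a|}) atTop (𝓝 0) := by
    refine tendsto_order.2 ⟨fun b hb => Eventually.of_forall fun n =>
      hb.trans_le measureReal_nonneg, fun b hb => ?_⟩
    filter_upwards [hlow (a - δ) (by linarith) (b / 3) (by linarith),
      hupp (a + δ / 2) (by linarith) (b / 3) (by linarith)] with n h2 h3
    have h4 := measureReal_le_add_of_ae_imp (μ := μ n) (p := fun ω => δ ≤ |W n ω - a|)
      (q := fun ω => W n ω ≤ a - δ) (r := fun ω => a + δ / 2 < W n ω)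
      (ae_of_all _ fun ω h => by
        rcases le_abs.1 h with h | h
        · exact Or.inr (by linarith)
        · exact Or.inl (by linarith))
    linarith
  have h2 := ENNReal.tendsto_ofReal h1
  simpa using h2

variable {Y : ∀ n, (⊤ : SimpleGraph (Fin n)).edgeSet → Ω n → ℝ} {s : ℕ → ℝ} {G : ℝ → ℝ}
  {W : ∀ n, Ω n → ℝ} {H : ∀ n, Ω n → ℕ} {γ C lam : ℝ}

theorem IsGeodesicModel.tendsto_hop (hWH : IsGeodesicModel μ Y W H) {q : ℕ → Prop} {L : Set ℕ}
    (h : ∀ ε : ℝ, 0 < ε → ∀ᶠ n in atTop, (μ n).real {ω | H n ω ∈ L} ≤ ε)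
    (hL : ∀ m, 1 ≤ m → m ∉ L → q m) : Tendsto (fun n => μ n {ω | q (H n ω)}) atTop (𝓝 1) := by
  refine tendsto_measure_one h ?_
  filter_upwards [eventually_ge_atTop 2] with n hn
  obtain ⟨u, v, huv, hp⟩ := hWH n hn
  filter_upwards [hp] with ω ⟨p, _, hH, _⟩
  by_cases hmem : H n ω ∈ L
  · exact Or.inr hmem
  · exact Or.inl (hL _ (hH ▸ one_le_length huv p) hmem)

/-- The hopcount avoids the lengths `m` for which `g m` exceeds an upper bound of the weight. -/
theorem IsGeodesicModel.eventually_hop_mem_le (hWH : IsGeodesicModel μ Y W H)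
    (hY : IsEdgeModel μ Y s G) (hs : ∀ n, 0 < s n) (hγ : 0 ≤ γ)
    (hsγ : Tendsto (fun n : ℕ => s n * Real.log n) atTop (𝓝 γ)) (hC : 0 ≤ C)
    (hGC : ∀ x, 0 < x → G x ≤ C * x) {c g₀ : ℝ} (hc : 0 < c) (hcg : c < g₀) {L : Set ℕ}
    (hL : ∀ m ∈ L, 1 ≤ m → g₀ ≤ gFun γ m)
    (hupp : ∀ ε : ℝ, 0 < ε → ∀ᶠ n in atTop, (μ n).real {ω | c < W n ω} ≤ ε) {ε : ℝ} (hε : 0 < ε) :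
    ∀ᶠ n in atTop, (μ n).real {ω | H n ω ∈ L} ≤ ε := by
  filter_upwards [eventually_ge_atTop 2, hupp (ε / 2) (half_pos hε),
    hY.eventually_exists_weightOf_le hs hγ hsγ hC hGC hc hcg hL (half_pos hε)] with n hn h1 h2
  obtain ⟨u, v, huv, hp⟩ := hWH n hn
  -- Either the optimal weight exceeds `c`, or the optimal path is itself a path of forbidden length
  -- lighter than `c`.
  have h3 := measureReal_le_add_of_ae_imp (μ := μ n) (p := fun ω => H n ω ∈ L)
    (q := fun ω => c < W n ω) (r := fun ω => ∃ p : (⊤ : SimpleGraph (Fin n)).Path u v,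
        p.1.length ∈ L ∧ weightOf (Y n) p ω ≤ c) (by
      filter_upwards [hp] with ω ⟨p, hW, hH, _⟩ hmem
      rcases lt_or_ge c (W n ω) with h | h
      · exact Or.inl h
      · exact Or.inr ⟨p, hH ▸ hmem, hW ▸ h⟩)
  linarith [h2 u v huv]

theorem IsGeodesicModel.eventually_weight_le_le (hWH : IsGeodesicModel μ Y W H)
    (hY : IsEdgeModel μ Y s G) (hs : ∀ n, 0 < s n) (hγ : 0 ≤ γ)
    (hsγ : Tendsto (fun n : ℕ => s n * Real.log n) atTop (𝓝 γ)) (hC : 0 ≤ C)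
    (hGC : ∀ x, 0 < x → G x ≤ C * x) {c g₀ : ℝ} (hg₀ : 0 < g₀) (hcg : c < g₀)
    (hL : ∀ m : ℕ, 1 ≤ m → g₀ ≤ gFun γ m) {ε : ℝ} (hε : 0 < ε) :
    ∀ᶠ n in atTop, (μ n).real {ω | W n ω ≤ c} ≤ ε := by
  filter_upwards [eventually_ge_atTop 2,
    -- The first moment bound needs a positive level, while `c` may be negative; the maximum stays
    -- below `g₀`.
    hY.eventually_exists_weightOf_le (c := max c (g₀ / 2)) (L := Set.univ) hs hγ hsγ hC hGC
      (lt_max_of_lt_right (half_pos hg₀)) (max_lt hcg (half_lt_self hg₀)) (fun m _ => hL m) hε]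
    with n hn h2
  obtain ⟨u, v, huv, hp⟩ := hWH n hn
  refine (measureReal_le_of_ae_imp ?_).trans (h2 u v huv)
  filter_upwards [hp] with ω ⟨p, hW, _, _⟩ h
  exact ⟨p, Set.mem_univ _, (hW ▸ h).trans (le_max_left _ _)⟩

theorem IsEdgeModel.measureReal_lt (hY : IsEdgeModel μ Y s G) {n : ℕ} (e) {y : ℝ} (hy : 0 < y) :
    (μ n).real {ω | y < Y n e ω} = 1 - G (y ^ (1 / s n)) := by
  rw [← hY.cdf n e y hy, ← probReal_compl_eq_one_sub (measurableSet_le (hY.meas n e)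
    measurable_const)]
  congr 1
  ext ω
  simp

theorem IsGeodesicModel.eventually_lt_weight_le_of_one_lt (hWH : IsGeodesicModel μ Y W H)
    (hY : IsEdgeModel μ Y s G) (hs : ∀ n, 0 < s n) (hs0 : Tendsto s atTop (𝓝 0))
    (hG1 : Tendsto G atTop (𝓝 1)) {c : ℝ} (hc : 1 < c) {ε : ℝ} (hε : 0 < ε) :
    ∀ᶠ n in atTop, (μ n).real {ω | c < W n ω} ≤ ε := by
  -- The direct edge alone suffices: it exceeds `c > 1` only if `Z` exceeds a level tending to
  -- infinity.
  have h1 : Tendsto (fun n => c ^ (1 / s n)) atTop atTop := by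
    refine (tendsto_rpow_atTop_of_base_gt_one c hc).comp ?_
    simp_rw [one_div]
    exact tendsto_inv_nhdsGT_zero.comp (tendsto_nhdsWithin_iff.2 ⟨hs0, Eventually.of_forall hs⟩)
  have h2 : Tendsto (fun n => 1 - G (c ^ (1 / s n))) atTop (𝓝 0) := by
    simpa using (hG1.comp h1).const_sub 1
  filter_upwards [eventually_ge_atTop 2, h2.eventually (ge_mem_nhds hε)] with n hn h3
  obtain ⟨u, v, huv, hp⟩ := hWH n hn
  rw [← hY.measureReal_lt (directEdge huv) (by linarith)] at h3
  refine (measureReal_le_of_ae_imp ?_).trans h3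
  filter_upwards [hp] with ω ⟨p, hW, _, hmin⟩ h
  obtain ⟨q, hq⟩ := exists_path_length_eq_one huv
  rw [← weightOf_eq_directEdge huv (Y n) hq]
  exact (hW ▸ h).trans_le (hmin q)

theorem exp_neg_mul_exp_tendsto {a : ℝ} (ha : 0 < a) :
    Tendsto (fun t => Real.exp (-(a * Real.exp t))) atTop (𝓝 0) :=
  Real.tendsto_exp_neg_atTop_nhds_zero.comp (Real.tendsto_exp_atTop.const_mul_atTop ha)

theorem aConst_pos {k : ℕ} (hk : 1 ≤ k) : 0 < aConst k := by
  have h : (0 : ℝ) < k := by exact_mod_cast hk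
  unfold aConst
  positivity

/-- For large `t` the limiting probability of no path in the window is small, while for that fixed
`t` the window level still tends to `gFun γ k < c`. -/
theorem IsGeodesicModel.eventually_lt_weight_le (hWH : IsGeodesicModel μ Y W H)
    (hY : IsEdgeModel μ Y s G) (hs : ∀ n, 0 < s n) (hγ : 0 < γ)
    (hsγ : Tendsto (fun n : ℕ => s n * Real.log n) atTop (𝓝 γ))
    (hrate : (fun n : ℕ => s n * Real.log n - γ) =o[atTop]
      (fun n : ℕ => Real.log n ^ (-(1 / 2) : ℝ)))
    (hC : 0 ≤ C) (hGC : ∀ x, 0 < x → G x ≤ C * x)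
    (hG : Tendsto (fun x => G x / x) (𝓝[>] 0) (𝓝 lam)) (hlam : 0 < lam) {k : ℕ} (hk : 2 ≤ k)
    (hγk : gammaSeq (k - 1) ≤ γ) (hg1 : gFun γ k < 1) {c : ℝ} (hc : gFun γ k < c) {ε : ℝ}
    (hε : 0 < ε) :
    ∀ᶠ n in atTop, (μ n).real {ω | c < W n ω} ≤ ε := by
  obtain ⟨t, ht⟩ := ((exp_neg_mul_exp_tendsto (aConst_pos (by omega : 1 ≤ k))).eventually
    (ge_mem_nhds (half_pos hε))).exists
  filter_upwards [eventually_ge_atTop 2,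
    (tendsto_windowLevel (k := k) hs hγ hlam hsγ hrate t).eventually (ge_mem_nhds hc),
    hY.eventually_abs_forall_lt_weightOf_sub_le hs hγ hsγ hrate hC hGC hG hlam hk hγk hg1 t
      (half_pos hε)] with n hn h1 h2
  obtain ⟨u, v, huv, hp⟩ := hWH n hn
  have h3 := (abs_le.1 (h2 u v huv)).2
  refine (measureReal_le_of_ae_imp (q := fun ω => ∀ p ∈ pathsOfLength u v k,
    windowLevel s γ lam k t n < weightOf (Y n) p ω) ?_).trans (by linarith)
  filter_upwards [hp] with ω ⟨p, hW, _, hmin⟩ h q _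
  exact h1.trans_lt ((hW ▸ h).trans_le (hmin q))

/-- If only paths with `k` edges matter, then the rescaled weight has the claimed limit law. -/
theorem IsGeodesicModel.tendsto_measureReal_weight_le (hWH : IsGeodesicModel μ Y W H)
    (hY : IsEdgeModel μ Y s G) (hs : ∀ n, 0 < s n) (hγ : 0 < γ)
    (hsγ : Tendsto (fun n : ℕ => s n * Real.log n) atTop (𝓝 γ))
    (hrate : (fun n : ℕ => s n * Real.log n - γ) =o[atTop]
      (fun n : ℕ => Real.log n ^ (-(1 / 2) : ℝ)))
    (hC : 0 ≤ C) (hGC : ∀ x, 0 < x → G x ≤ C * x)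
    (hG : Tendsto (fun x => G x / x) (𝓝[>] 0) (𝓝 lam)) (hlam : 0 < lam) {k : ℕ} (hk : 2 ≤ k)
    (hγk : gammaSeq (k - 1) ≤ γ) (hg1 : gFun γ k < 1) {g₀ : ℝ} (hg₀ : gFun γ k < g₀)
    (hL : ∀ m : ℕ, 1 ≤ m → m ≠ k → g₀ ≤ gFun γ m) (t : ℝ) :
    Tendsto (fun n => (μ n).real {ω | W n ω ≤ windowLevel s γ lam k t n}) atTop
      (𝓝 (1 - Real.exp (-(aConst k * Real.exp t)))) := by
  -- The window level falls below `c`, and paths of other lengths are heavier than `c` with high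
  -- probability.
  obtain ⟨c, hkc, hcg⟩ := exists_between hg₀
  have hc : 0 < c := (gFun_pos γ (by exact_mod_cast (by omega : 0 < k))).trans hkc
  rw [Metric.tendsto_nhds]
  intro ε hε
  filter_upwards [eventually_ge_atTop 2,
    (tendsto_windowLevel (k := k) hs hγ hlam hsγ hrate t).eventually (ge_mem_nhds hkc),
    hY.eventually_abs_forall_lt_weightOf_sub_le hs hγ hsγ hrate hC hGC hG hlam hk hγk hg1 t
      (show 0 < ε / 3 by positivity),
    hY.eventually_exists_weightOf_le (L := {m | m ≠ k}) hs hγ.le hsγ hC hGC hc hcg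
      (fun m hm hm1 => hL m hm1 hm) (show 0 < ε / 3 by positivity)] with n hn h1 h2 h3
  obtain ⟨u, v, huv, hp⟩ := hWH n hn
  have h2 := abs_le.1 (h2 u v huv)
  have h3 := h3 u v huv
  have hcompl : (μ n).real {ω | ∃ p ∈ pathsOfLength u v k,
        weightOf (Y n) p ω ≤ windowLevel s γ lam k t n} =
      1 - (μ n).real {ω | ∀ p ∈ pathsOfLength u v k,
        windowLevel s γ lam k t n < weightOf (Y n) p ω} := by
    rw [← probReal_compl_eq_one_sub]
    · congr 1
      ext ω
      simp
    · simp_rw [Set.ofPred_forall]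
      exact Finset.measurableSet_biInter _ fun p _ =>
        measurableSet_lt measurable_const (measurable_weightOf (hY.meas n) p)
  have hlow := measureReal_le_of_ae_imp (μ := μ n) (p := fun ω => ∃ p ∈ pathsOfLength u v k,
      weightOf (Y n) p ω ≤ windowLevel s γ lam k t n)
    (q := fun ω => W n ω ≤ windowLevel s γ lam k t n) (by
      filter_upwards [hp] with ω ⟨p, hW, _, hmin⟩ ⟨q, _, hq⟩
      exact hW ▸ (hmin q).trans hq)
  have hupp := measureReal_le_add_of_ae_imp (μ := μ n)
    (p := fun ω => W n ω ≤ windowLevel s γ lam k t n)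
    (q := fun ω => ∃ p ∈ pathsOfLength u v k,
      weightOf (Y n) p ω ≤ windowLevel s γ lam k t n)
    (r := fun ω => ∃ p : (⊤ : SimpleGraph (Fin n)).Path u v,
        p.1.length ≠ k ∧ weightOf (Y n) p ω ≤ c) (by
      filter_upwards [hp] with ω ⟨p, hW, _, _⟩ h
      by_cases hpk : p.1.length = k
      · exact Or.inl ⟨p, mem_pathsOfLength.2 hpk, hW ▸ h⟩
      · exact Or.inr ⟨p, hpk, (hW ▸ h).trans h1⟩)
  rw [Real.dist_eq, abs_lt]
  constructor <;> linarith

/-- If only the direct edge matters, then the rescaled weight has the law of `log Z`. -/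
theorem IsGeodesicModel.tendsto_measureReal_weight_le_of_direct (hWH : IsGeodesicModel μ Y W H)
    (hY : IsEdgeModel μ Y s G) (hs : ∀ n, 0 < s n) (hs0 : Tendsto s atTop (𝓝 0))
    (hG : Continuous G)
    (hhop : ∀ ε : ℝ, 0 < ε → ∀ᶠ n in atTop, (μ n).real {ω | H n ω ∈ {m | 2 ≤ m}} ≤ ε) (t : ℝ) :
    Tendsto (fun n => (μ n).real {ω | (W n ω - 1) / s n ≤ t}) atTop (𝓝 (G (Real.exp t))) := by
  have hst : Tendsto (fun n => 1 + s n * t) atTop (𝓝 1) := by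
    simpa using (hs0.mul_const t).const_add 1
  have hlim : Tendsto (fun n => G ((1 + s n * t) ^ (1 / s n))) atTop (𝓝 (G (Real.exp t))) := by
    refine (hG.tendsto _).comp ?_
    -- With `x = 1 / s n → ∞` this is `(1 + t / x) ^ x → exp t`, the origin of the logarithm in the
    -- limit law.
    have h := (Real.tendsto_one_add_div_rpow_exp t).comp
      (tendsto_inv_nhdsGT_zero.comp (tendsto_nhdsWithin_iff.2 ⟨hs0, Eventually.of_forall hs⟩))
    refine h.congr fun n => ?_
    simp only [Function.comp, one_div, div_inv_eq_mul]
    rw [mul_comm]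
  rw [Metric.tendsto_nhds]
  intro ε hε
  filter_upwards [eventually_ge_atTop 2, hst.eventually (lt_mem_nhds one_pos),
    hhop (ε / 3) (by positivity), (Metric.tendsto_nhds.1 hlim) (ε / 3) (by positivity)]
    with n hn h1 h2 h3
  obtain ⟨u, v, huv, hp⟩ := hWH n hn
  rw [← hY.cdf n (directEdge huv) _ h1, Real.dist_eq, abs_lt] at h3
  have hiff : ∀ ω, (W n ω - 1) / s n ≤ t ↔ W n ω ≤ 1 + s n * t := fun ω => by
    rw [div_le_iff₀ (hs n), sub_le_iff_le_add', mul_comm]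
  simp_rw [hiff]
  have hlow := measureReal_le_of_ae_imp (μ := μ n)
    (p := fun ω => Y n (directEdge huv) ω ≤ 1 + s n * t)
    (q := fun ω => W n ω ≤ 1 + s n * t) (by
      obtain ⟨q, hq⟩ := exists_path_length_eq_one huv
      filter_upwards [hp] with ω ⟨p, hW, _, hmin⟩ h
      rw [← weightOf_eq_directEdge huv (Y n) hq] at h
      exact hW ▸ (hmin q).trans h)
  have hupp := measureReal_le_add_of_ae_imp (μ := μ n)
    (p := fun ω => W n ω ≤ 1 + s n * t)
    (q := fun ω => Y n (directEdge huv) ω ≤ 1 + s n * t)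
    (r := fun ω => 2 ≤ H n ω) (by
      filter_upwards [hp] with ω ⟨p, hW, hH, _⟩ h
      by_cases hp2 : 2 ≤ p.1.length
      · exact Or.inr (hH ▸ hp2)
      · rw [← weightOf_eq_directEdge huv (Y n) (p := p) (by have := one_le_length huv p; omega)]
        exact Or.inl (hW ▸ h))
  rw [Real.dist_eq, abs_lt]
  constructor <;> linarith

end Concentration

/-! ### Identification of the limit law and the four regimes of `γ`. -/

theorem IsStandardGumbel.measureReal_neg_sub_log_le {Ω : Type*} [MeasurableSpace Ω] {Λ : Ω → ℝ}
    {P : Measure Ω} [IsProbabilityMeasure P] (hΛ : IsStandardGumbel Λ P) {a : ℝ} (ha : 0 < a)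
    (t : ℝ) : P.real {ω | -Λ ω - Real.log a ≤ t} = 1 - Real.exp (-(a * Real.exp t)) := by
  have h1 := measureReal_lt_eq_of_continuous_cdf hΛ.2 (by fun_prop) (-t - Real.log a)
  have h2 : Real.exp (-(-t - Real.log a)) = a * Real.exp t := by
    rw [show -(-t - Real.log a) = Real.log a + t by ring, Real.exp_add, Real.exp_log ha]
  rw [h2] at h1
  rw [← h1, ← probReal_compl_eq_one_sub₀ (nullMeasurableSet_lt hΛ.1 aemeasurable_const)]
  congr 1
  ext ω
  simp only [Set.mem_ofPred_eq, Set.mem_compl_iff, not_lt]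
  constructor <;> intro h <;> linarith

/-- Solving the rescaled inequality for the weight is how `windowLevel` was obtained; all the
factors involved are positive. -/
theorem rescaled_le_iff_le_windowLevel {s : ℕ → ℝ} {γ lam w : ℝ} {k : ℕ} {n : ℕ} (hs : 0 < s n)
    (hlam : 0 < lam) (hk : 1 ≤ k) (t : ℝ) :
    (k : ℝ) / (gFun γ k * s n) * (lam ^ s n * w - gFun γ k)
        + ((k : ℝ) - 1) / s n * (s n * Real.log n - γ - s n * Real.log (s n) / 2) ≤ t ↔
      w ≤ windowLevel s γ lam k t n := by
  have hk0 : (0 : ℝ) < k := by exact_mod_cast hk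
  have hg := gFun_pos γ hk0
  have hl := Real.rpow_pos_of_pos hlam (s n)
  rw [windowLevel, windowShift, le_div_iff₀ hl, ← le_sub_iff_add_le]
  generalize t - ((k : ℝ) - 1) / s n * (s n * Real.log n - γ - s n * Real.log (s n) / 2) = τ
  rw [div_mul_eq_mul_div, div_le_iff₀ (by positivity), ← sub_nonneg, ← sub_nonneg (b := w * _)]
  have h : gFun γ k * (1 + s n / k * τ) - w * lam ^ s n =
      (τ * (gFun γ k * s n) - k * (lam ^ s n * w - gFun γ k)) / k := by
    field_simp
    ring
  rw [h, le_div_iff₀ hk0, zero_mul]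

theorem gFun_le_of_ge {γ : ℝ} {m j : ℕ} (hm : 1 ≤ m) (hmj : m ≤ j) (h : gammaSeq j ≤ γ) :
    gFun γ j ≤ gFun γ m := by
  rcases eq_or_lt_of_le hmj with rfl | hlt
  · exact le_rfl
  · obtain ⟨i, rfl⟩ := Nat.exists_eq_add_of_lt hlt
    exact gFun_succ_le_of_le hm ((gammaSeq_le_gammaSeq (by omega) (Nat.le_succ _)).trans h)
      (by omega)

theorem gFun_succ_lt_of_le {γ : ℝ} {m j : ℕ} (hm : 1 ≤ m) (hmj : m ≤ j) (h : gammaSeq j < γ) :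
    gFun γ (j + 1 : ℕ) < gFun γ m :=
  (gFun_succ_lt (hm.trans hmj) h).trans_le (gFun_le_of_ge hm hmj h.le)

theorem theorem1p4
    {Ω₀ : Type*} [MeasurableSpace Ω₀] (P₀ : Measure Ω₀) [IsProbabilityMeasure P₀]
    -- the positive random variable `Z`, with continuous distribution function `G`
    (Z : Ω₀ → ℝ) (hZ : AEMeasurable Z P₀) (hZpos : ∀ᵐ ω ∂P₀, 0 < Z ω)
    (G : ℝ → ℝ) (hG : ∀ x, G x = P₀.real {ω | Z ω ≤ x}) (hGcont : Continuous G)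
    -- `G` is `C²` on `[0, xhat]`, with `G'(0+) = lam > 0`
    (xhat : ℝ) (hxhat : 0 < xhat) (hGC2 : ContDiffOn ℝ 2 G (Set.Icc 0 xhat))
    (lam : ℝ) (hlam : HasDerivWithinAt G lam (Set.Ici 0) 0) (hlampos : 0 < lam)
    -- the sequence `s_n` of positive numbers with `s_n log n → γ`
    (s : ℕ → ℝ) (hs : ∀ n, 0 < s n) (γ : ℝ) (hγ : 0 ≤ γ)
    (hsγ : Tendsto (fun n : ℕ => s n * Real.log n) atTop (𝓝 γ))
    -- for every `n`, i.i.d. edge weights on `K_n` with the distribution of `Z ^ s_n`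
    {Ω : ℕ → Type*} [∀ n, MeasurableSpace (Ω n)] (P : ∀ n, Measure (Ω n))
    [∀ n, IsProbabilityMeasure (P n)]
    (X : ∀ n, Sym2 (Fin n) → Ω n → ℝ)
    (hX : ∀ n, IsIIDEdgeWeights (X n) (P n) (fun ω => Z ω ^ s n) P₀)
    -- the weight and the hopcount of the optimal path
    (W : ∀ n, Ω n → ℝ) (hW : ∀ n ω, W n ω = fppWeight n (fun e => X n e ω))
    (H : ∀ n, Ω n → ℕ) (hH : ∀ n ω, H n ω = fppHopcount n (fun e => X n e ω))
    -- a standard Gumbel random variable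
    {Ω₁ : Type*} [MeasurableSpace Ω₁] (P₁ : Measure Ω₁) [IsProbabilityMeasure P₁]
    (Λ : Ω₁ → ℝ) (hΛ : IsStandardGumbel Λ P₁) :
    -- (a)
    (γ < 2 * Real.log 2 →
      TendstoInDistribution (fun n ω => (W n ω - 1) / s n) atTop
        (fun ω => Real.log (Z ω)) P P₀ ∧
      Tendsto (fun n => P n {ω | H n ω = 1}) atTop (𝓝 1)) ∧
    -- (b)
    (γ = 2 * Real.log 2 →
      TendstoInProbConst W P 1 ∧
      Tendsto (fun n => P n {ω | H n ω = 1 ∨ H n ω = 2}) atTop (𝓝 1)) ∧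
    -- (c)
    ((fun n : ℕ => s n * Real.log n - γ) =o[atTop] (fun n : ℕ => Real.log n ^ (-(1 / 2) : ℝ)) →
      γ ∉ gammaSet → 2 * Real.log 2 < γ →
      ∃ k : ℕ, IsUniqueMinimizer γ k ∧
        TendstoInDistribution
          (fun n ω =>
            (k : ℝ) / (gFun γ k * s n) * (lam ^ s n * W n ω - gFun γ k)
              + ((k : ℝ) - 1) / s n * (s n * Real.log n - γ - s n * Real.log (s n) / 2))
          atTop (fun ω => -Λ ω - Real.log (aConst k)) P P₁ ∧
        Tendsto (fun n => P n {ω | H n ω = k}) atTop (𝓝 1)) ∧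
    -- (d)
    (∀ k : ℕ, 2 ≤ k → γ = gammaSeq k →
      (fun n : ℕ => s n * Real.log n - γ) =o[atTop] (fun n : ℕ => Real.log n ^ (-(1 / 2) : ℝ)) →
      TendstoInProbConst W P (gFun γ k) ∧
      Tendsto (fun n => P n {ω | H n ω = k ∨ H n ω = k + 1}) atTop (𝓝 1)) := by
  have hG' : ∀ x, P₀.real {ω | Z ω ≤ x} = G x := fun x => (hG x).symm
  have hGlim := tendsto_div_of_hasDerivWithinAt (cdf_zero_of_pos hZpos hG') hlam
  obtain ⟨C, hC, hGC⟩ := exists_le_mul_of_tendsto_div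
    (fun x => by rw [hG]; exact measureReal_le_one) hGlim
  have hG1 := tendsto_atTop_one_of_cdf hG' hZ
  have hs0 := tendsto_zero_of_mul_log hsγ
  obtain ⟨Y, hY, hatom, hXY⟩ := exists_isEdgeModel hZ hZpos hG' hGcont hs hX
  have hWH : IsGeodesicModel P Y W H := isGeodesicModel hY.meas hY.indep hatom hXY hW hH
  have hWm : ∀ n, AEMeasurable (W n) (P n) := fun n => by
    rw [funext (hW n)]
    exact aemeasurable_fppWeight fun e he => ((hX n).2 e he).aemeasurable_fst
  rw [← gammaSeq_one]
  refine ⟨fun hγ1 => ?_, fun hγ1 => ?_, fun hrate hγΓ hγ1 => ?_, fun k hk hγk hrate => ?_⟩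
  -- Below the first critical value `gFun γ` increases from `1`. The direct edge bounds the weight
  -- by any level above `1`, which excludes every length from `2` on.
  · have hg2 : 1 < gFun γ (2 : ℕ) := by
      simpa [gFun_one] using gFun_lt_succ le_rfl hγ1
    have hγ2 : γ ≤ gammaSeq 2 := hγ1.le.trans (gammaSeq_le_gammaSeq le_rfl one_le_two)
    obtain ⟨c, hc1, hc2⟩ := exists_between hg2
    have hhop : ∀ ε : ℝ, 0 < ε → ∀ᶠ n in atTop, (P n).real {ω | H n ω ∈ {m | 2 ≤ m}} ≤ ε :=
      fun ε hε => hWH.eventually_hop_mem_le hY hs hγ hsγ hC hGC (by linarith) hc2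
        (fun m hm _ => gFun_le_of_le one_le_two hγ2 hm)
        (fun ε hε => hWH.eventually_lt_weight_le_of_one_lt hY hs hs0 hG1 hc1 hε) hε
    refine ⟨tendstoInDistribution_of_tendsto_cdf
      (fun n => ((hWm n).sub_const 1).div_const _) hZ.log fun t => ?_,
      hWH.tendsto_hop (q := fun m => m = 1) hhop fun m hm hm2 => ?_⟩
    · have h : P₀.real {ω | Real.log (Z ω) ≤ t} = G (Real.exp t) := by
        rw [hG]
        refine congrArg ENNReal.toReal (measure_congr ?_)
        filter_upwards [hZpos] with ω hω
        exact propext (Real.log_le_iff_le_exp hω)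
      rw [h]
      exact hWH.tendsto_measureReal_weight_le_of_direct hY hs hs0 hGcont hhop t
    · have : ¬ 2 ≤ m := hm2
      omega
  -- Lengths `1` and `2` tie at the value `1`. The upper bound still comes from the direct edge, so
  -- no rate of convergence is needed.
  · have hg3 : 1 < gFun γ (3 : ℕ) := by
      have h1 := gFun_le_succ le_rfl hγ1.le
      have h2 := gFun_lt_succ one_le_two (hγ1.trans_lt (gammaSeq_lt_gammaSeq le_rfl one_lt_two))
      rw [Nat.cast_one, gFun_one] at h1
      exact h1.trans_lt h2
    have hγ3 : γ ≤ gammaSeq 3 := hγ1.le.trans (gammaSeq_le_gammaSeq le_rfl (by norm_num))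
    obtain ⟨c, hc1, hc2⟩ := exists_between hg3
    refine ⟨tendstoInProbConst_of_eventually_le (fun c hc ε hε => ?_) fun c hc ε hε =>
      hWH.eventually_lt_weight_le_of_one_lt hY hs hs0 hG1 hc hε,
      hWH.tendsto_hop (q := fun m => m = 1 ∨ m = 2) (L := {m | 3 ≤ m}) (fun ε hε =>
        hWH.eventually_hop_mem_le hY hs hγ hsγ hC hGC (by linarith) hc2
        (fun m hm _ => gFun_le_of_le (by norm_num) hγ3 hm)
        (fun ε hε => hWH.eventually_lt_weight_le_of_one_lt hY hs hs0 hG1 hc1 hε) hε)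
        fun m hm hm2 => ?_⟩
    · refine hWH.eventually_weight_le_le hY hs hγ hsγ hC hGC one_pos hc (fun m hm => ?_) hε
      simpa [gFun_one] using gFun_le_of_le le_rfl hγ1.le hm
    · have : ¬ 3 ≤ m := hm2
      omega
  · obtain ⟨j, hj, hjγ, hγj⟩ := exists_gammaSeq_lt_lt hγΓ hγ1
    have hγ0 : 0 < γ := by
      rw [gammaSeq_one] at hγ1
      exact lt_trans (by positivity) hγ1
    have hg1 : gFun γ (j + 1 : ℕ) < 1 := by
      simpa [gFun_one] using gFun_succ_lt_of_le le_rfl hj hjγ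
    -- The minimizer is `j + 1`. As `gFun γ` falls before it and rises after it, its two neighbours
    -- give a uniform gap to all other lengths.
    have hg₀ : gFun γ (j + 1 : ℕ) < min (gFun γ j) (gFun γ (j + 1 + 1 : ℕ)) :=
      lt_min (gFun_succ_lt hj hjγ) (gFun_lt_succ (by omega) hγj)
    have hL : ∀ m : ℕ, 1 ≤ m → m ≠ j + 1 →
        min (gFun γ j) (gFun γ (j + 1 + 1 : ℕ)) ≤ gFun γ m := fun m hm hmj => by
      rcases lt_or_gt_of_ne hmj with h | h
      · exact min_le_of_left_le (gFun_le_of_ge hm (by omega) hjγ.le)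
      · exact min_le_of_right_le (gFun_le_of_le (by omega)
          (hγj.le.trans (gammaSeq_le_gammaSeq (by omega) (Nat.le_succ _))) h)
    have hg0 : 0 < gFun γ (j + 1 : ℕ) := gFun_pos γ (by positivity)
    obtain ⟨c, hc1, hc2⟩ := exists_between hg₀
    refine ⟨j + 1, ⟨by omega, fun m hm hmj => hg₀.trans_le (hL m hm hmj)⟩,
      tendstoInDistribution_of_tendsto_cdf (fun n => ?_) (hΛ.1.neg.sub_const _) fun t => ?_,
      hWH.tendsto_hop (q := fun m => m = j + 1) (L := {m | m ≠ j + 1}) (fun ε hε =>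
        hWH.eventually_hop_mem_le hY hs hγ hsγ hC hGC (hg0.trans hc1) hc2
        (fun m hm hm1 => hL m hm1 hm)
        (fun ε hε => hWH.eventually_lt_weight_le (k := j + 1) hY hs hγ0
          hsγ hrate hC hGC hGlim hlampos (by omega) hjγ.le hg1 hc1 hε) hε)
        fun m _ hm => not_not.1 hm⟩
    · exact ((((hWm n).const_mul _).sub_const _).const_mul _).add_const _
    · rw [hΛ.measureReal_neg_sub_log_le (aConst_pos (by omega))]
      simp_rw [rescaled_le_iff_le_windowLevel (hs _) hlampos (show 1 ≤ j + 1 by omega)]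
      exact hWH.tendsto_measureReal_weight_le (k := j + 1) hY hs hγ0 hsγ hrate hC hGC hGlim
        hlampos (by omega) hjγ.le hg1 hg₀ hL t
  · obtain ⟨j, rfl⟩ := Nat.exists_eq_add_of_le' (show 1 ≤ k by omega)
    have hj : 1 ≤ j := by omega
    have hjγ : gammaSeq j < γ := hγk ▸ gammaSeq_lt_gammaSeq hj (Nat.lt_succ_self j)
    have hγj : γ < gammaSeq (j + 1 + 1) :=
      hγk ▸ gammaSeq_lt_gammaSeq (by omega) (Nat.lt_succ_self _)
    have hγ0 : 0 < γ :=
      hγk ▸ lt_trans (by positivity) (gammaSeq_mem_Ioo (show 1 ≤ j + 1 by omega)).1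
    have hg1 : gFun γ (j + 1 : ℕ) < 1 := by
      simpa [gFun_one] using gFun_succ_lt_of_le le_rfl hj hjγ
    have hg0 : 0 < gFun γ (j + 1 : ℕ) := gFun_pos γ (by positivity)
    -- Now `j + 1` and `j + 2` tie, so the gap is measured at `j` and `j + 3`. The upper bound on
    -- the weight uses paths with `j + 1` edges only.
    have hg₀ : gFun γ (j + 1 : ℕ) < min (gFun γ j) (gFun γ (j + 1 + 1 + 1 : ℕ)) :=
      lt_min (gFun_succ_lt hj hjγ)
        ((gFun_le_succ (by omega) hγk.le).trans_lt (gFun_lt_succ (by omega) hγj))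
    have hL : ∀ m ∈ {m : ℕ | m ≠ j + 1 ∧ m ≠ j + 1 + 1}, 1 ≤ m →
        min (gFun γ j) (gFun γ (j + 1 + 1 + 1 : ℕ)) ≤ gFun γ m := fun m ⟨h1, h2⟩ hm => by
      rcases lt_or_gt_of_ne h1 with h | h
      · exact min_le_of_left_le (gFun_le_of_ge hm (by omega) hjγ.le)
      · exact min_le_of_right_le (gFun_le_of_le (by omega)
          (hγj.le.trans (gammaSeq_le_gammaSeq (by omega) (Nat.le_succ _))) (by omega))
    have hmin : ∀ m : ℕ, 1 ≤ m → gFun γ (j + 1 : ℕ) ≤ gFun γ m := fun m hm => by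
      rcases le_or_gt m j with h | h
      · exact (gFun_succ_lt_of_le hm h hjγ).le
      · exact gFun_le_of_le (by omega) hγk.le h
    have hupp : ∀ c > gFun γ (j + 1 : ℕ), ∀ ε : ℝ, 0 < ε →
        ∀ᶠ n in atTop, (P n).real {ω | c < W n ω} ≤ ε := fun c hc ε hε =>
      hWH.eventually_lt_weight_le hY hs hγ0 hsγ hrate hC hGC hGlim hlampos hk hjγ.le hg1 hc hε
    obtain ⟨c, hc1, hc2⟩ := exists_between hg₀
    refine ⟨tendstoInProbConst_of_eventually_le (fun c hc ε hε =>
        hWH.eventually_weight_le_le hY hs hγ hsγ hC hGC hg0 hc hmin hε) hupp,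
      hWH.tendsto_hop (q := fun m => m = j + 1 ∨ m = j + 1 + 1) (fun ε hε =>
        hWH.eventually_hop_mem_le hY hs hγ hsγ hC hGC (hg0.trans hc1) hc2 hL (hupp c hc1) hε)
        fun m _ hm => ?_⟩
    have hm : ¬ (m ≠ j + 1 ∧ m ≠ j + 1 + 1) := hm
    omega
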